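/- Let $m,\beta,\gamma>0$ be real with $\gamma\neq 1$. Let $\mathbf H_2=H^1(0,1)\times L^2(0,1)\times\mathbb C$ (complex-valued functions) with norm $$\|(f,g,\eta)\|^2=\int_0^1\big(|f'(x)|^2+|g(x)|^2\big)\,dx+\beta|f(0)|^2+\tfrac1m|\eta|^2 ,$$ and let $\mathbf A_2$ be the operator $\mathbf A_2(f,g,\eta)=(g,f'',-f'(1))$ in $\mathbf H_2$ with domain $$D(\mathbf A_2)=\{(f,g,\eta)\in\mathbf H_2:\ (g,f'',-f'(1))\in\mathbf H_2,\ f'(0)=\gamma g(0)+\beta f(0),\ \eta=m\,g(1)\}.$$ For $\mu\in\mathbb C$ put $f_\mu(x)=[(1+\gamma)\mu+\beta]e^{\mu x}+[(1-\gamma)\mu-\beta]e^{-\mu x}$, and for $n\in\mathbb Z$ put $n_\beta=n$ if $\gamma>1$ and $n_\beta=n+\frac12$ if $0<\gamma<1$. Then: 1. There is a sequence of generalized eigenfunctions of $\mathbf A_2$ that forms a Riesz basis of $\mathbf H_2$ (the image of an orthonormal basis under a bounded, boundedly invertible operator). 2. For every eigenvalue $\mu$ of $\mathbf A_2$ the eigenspace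 is one-dimensional and is spanned by $(f_\mu,\ \mu f_\mu,\ m\mu f_\mu(1))$. 3. There is a family $(\lambda_n)_{n\in\mathbb Z}$ of eigenvalues of $\mathbf A_2$ such that, for some $N$, the $\lambda_n$ with $|n|\ge N$ are pairwise distinct and exhaust all but finitely many eigenvalues, and, as $|n|\to\infty$, $$\lambda_n=\tfrac12\ln\frac{|\gamma-1|}{\gamma+1}+n_\beta\pi i+O(|n|^{-1}).$$ Moreover, with $f_n=f_{\lambda_n}$ and $$F_n(x)=\lambda_n^{-2}\big(f_n'(x),\ \lambda_nf_n(x),\ \beta f_n(0),\ -\lambda_n^{-1}f_n'(1)\big),$$ one has, uniformly in $x\in[0,1]$, $$F_n(x)=\big((1+\gamma)p_n(x)-(1-\gamma)q_n(x),\ (1+\gamma)p_n(x)+(1-\gamma)q_n(x),\ 0,\ 0\big)+O(|n|^{-1}),$$ where $p_n(x)=\left|\frac{\gamma-1}{\gamma+1}\right|^{x/2}e^{in_\beta\pi x}$ and $q_n(x)=\left|\frac{\gamma+1}{\gamma-1}\right|^{x/2}e^{-in_\beta\pi x}$. -/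

import Mathlib

open MeasureTheory Set
open scoped ContDiff

noncomputable section

namespace TipMassWave

/-- The complex Hilbert space `L²(0,1)`. -/
abbrev L2 : Type := Lp ℂ 2 (volume.restrict (Ioo (0 : ℝ) 1))

/-- `u` is the weak derivative of `f` on the open interval `(0,1)`. -/
def HasWeakDeriv (f u : ℝ → ℂ) : Prop :=
  ∀ φ : ℝ → ℝ, ContDiff ℝ ∞ φ → HasCompactSupport φ → tsupport φ ⊆ Ioo (0 : ℝ) 1 →
    ∫ x in Ioo (0 : ℝ) 1, deriv φ x • f x = -∫ x in Ioo (0 : ℝ) 1, φ x • u x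

/-- The function on `ℝ` obtained from a function on `[0,1]` by constant continuation. -/
abbrev ext (f : C(unitInterval, ℂ)) : ℝ → ℂ := IccExtend (zero_le_one' ℝ) f

theorem continuous_ext (f : C(unitInterval, ℂ)) : Continuous (ext f) :=
  f.continuous.Icc_extend'

theorem ext_apply (f : C(unitInterval, ℂ)) (x : unitInterval) : ext f (x : ℝ) = f x :=
  IccExtend_val _ _ x

theorem ext_add (f g : C(unitInterval, ℂ)) : ext (f + g) = ext f + ext g := rfl

theorem ext_smul (c : ℂ) (f : C(unitInterval, ℂ)) : ext (c • f) = c • ext f := rfl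

theorem memLp_ext (f : C(unitInterval, ℂ)) :
    MemLp (ext f) 2 (volume.restrict (Ioo (0 : ℝ) 1)) :=
  MemLp.of_bound (continuous_ext f).aestronglyMeasurable ‖f‖
    (Filter.Eventually.of_forall fun _ => f.norm_coe_le_norm _)

/-- The class in `L²(0,1)` of a continuous function on `[0,1]`. -/
def contToL2 : C(unitInterval, ℂ) →ₗ[ℂ] L2 where
  toFun f := (memLp_ext f).toLp (ext f)
  map_add' f g := MemLp.toLp_add (memLp_ext f) (memLp_ext g)
  map_smul' c f := MemLp.toLp_const_smul c (memLp_ext f)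

theorem eq_of_ext_ae_eq {f g : C(unitInterval, ℂ)}
    (h : ext f =ᵐ[volume.restrict (Ioo (0 : ℝ) 1)] ext g) : f = g := by
  have h1 : EqOn (ext f) (ext g) (Icc (0 : ℝ) 1) := by
    refine Measure.eqOn_Icc_of_ae_eq (μ := volume) zero_ne_one ?_
      (continuous_ext f).continuousOn (continuous_ext g).continuousOn
    rwa [← Measure.restrict_congr_set (Ioo_ae_eq_Icc (μ := (volume : Measure ℝ)))]
  ext x
  rw [← ext_apply f x, ← ext_apply g x]
  exact h1 x.2

theorem contToL2_injective : Function.Injective contToL2 := by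
  intro f g h
  exact eq_of_ext_ae_eq ((MemLp.toLp_eq_toLp_iff (memLp_ext f) (memLp_ext g)).1 h)

theorem integrableOn_smul {φ : ℝ → ℝ} (hφ : Continuous φ) (hc : HasCompactSupport φ)
    {u : ℝ → ℂ} (hu : MemLp u 2 (volume.restrict (Ioo (0 : ℝ) 1))) :
    IntegrableOn (fun x => φ x • u x) (Ioo (0 : ℝ) 1) := by
  obtain ⟨C, hC⟩ := hc.exists_bound_of_continuous hφ
  exact (hu.integrable one_le_two).bdd_smul C hφ.aestronglyMeasurable
    (Filter.Eventually.of_forall hC)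

/-- The Sobolev space `H¹(0,1)`: pairs `(f, f')` of a continuous function `f` on `[0,1]`
(the continuous representative of the Sobolev class) and its weak derivative `f' ∈ L²(0,1)`. -/
def H1 : Submodule ℂ (C(unitInterval, ℂ) × L2) where
  carrier := {p | HasWeakDeriv (ext p.1) p.2}
  zero_mem' := by
    intro φ _ _ _
    have h : ∫ x in Ioo (0 : ℝ) 1, φ x • (0 : L2) x = 0 := by
      refine integral_eq_zero_of_ae ?_
      filter_upwards [Lp.coeFn_zero ℂ 2 (volume.restrict (Ioo (0 : ℝ) 1))] with x hx
      rw [hx]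
      exact smul_zero _
    have h' : ∫ x in Ioo (0 : ℝ) 1, deriv φ x • ext 0 x = 0 :=
      integral_eq_zero_of_ae (Filter.Eventually.of_forall fun x => smul_zero (deriv φ x))
    exact h'.trans (by rw [← neg_zero, ← h]; rfl)
  add_mem' := by
    rintro ⟨f, u⟩ ⟨g, v⟩ hf hg φ h1 h2 h3
    have hd : Continuous (deriv φ) := h1.continuous_deriv (by simp)
    have e1 : ∫ x in Ioo (0 : ℝ) 1, deriv φ x • ext (f + g) x =
        (∫ x in Ioo (0 : ℝ) 1, deriv φ x • ext f x)
          + ∫ x in Ioo (0 : ℝ) 1, deriv φ x • ext g x := by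
      rw [← integral_add (integrableOn_smul hd h2.deriv (memLp_ext f))
        (integrableOn_smul hd h2.deriv (memLp_ext g))]
      refine integral_congr_ae (Filter.Eventually.of_forall fun x => ?_)
      exact smul_add _ _ _
    have e2 : ∫ x in Ioo (0 : ℝ) 1, φ x • (u + v : L2) x =
        (∫ x in Ioo (0 : ℝ) 1, φ x • u x) + ∫ x in Ioo (0 : ℝ) 1, φ x • v x := by
      rw [← integral_add (integrableOn_smul h1.continuous h2 (Lp.memLp u))
        (integrableOn_smul h1.continuous h2 (Lp.memLp v))]
      refine integral_congr_ae ?_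
      filter_upwards [Lp.coeFn_add u v] with x hx
      rw [hx]
      exact smul_add _ _ _
    have hf' := hf φ h1 h2 h3
    have hg' := hg φ h1 h2 h3
    simp only [Prod.mk_add_mk] at hf' hg' ⊢
    rw [e1, e2, hf', hg']
    ring
  smul_mem' := by
    rintro c ⟨f, u⟩ hf φ h1 h2 h3
    have e1 : ∫ x in Ioo (0 : ℝ) 1, deriv φ x • ext (c • f) x =
        c • ∫ x in Ioo (0 : ℝ) 1, deriv φ x • ext f x := by
      rw [← integral_smul]
      refine integral_congr_ae (Filter.Eventually.of_forall fun x => ?_)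
      simp only [ext_smul, Pi.smul_apply]
      exact smul_comm _ _ _
    have e2 : ∫ x in Ioo (0 : ℝ) 1, φ x • (c • u : L2) x =
        c • ∫ x in Ioo (0 : ℝ) 1, φ x • u x := by
      rw [← integral_smul]
      refine integral_congr_ae ?_
      filter_upwards [Lp.coeFn_smul c u] with x hx
      rw [hx, Pi.smul_apply]
      exact smul_comm _ _ _
    have hf' := hf φ h1 h2 h3
    simp only [Prod.smul_mk] at hf' ⊢
    rw [e1, e2, hf', smul_neg]

namespace H1

/-- The continuous function on `[0,1]` underlying an element of `H¹(0,1)`. -/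
def fn : H1 →ₗ[ℂ] C(unitInterval, ℂ) := (LinearMap.fst ℂ _ _).comp H1.subtype

/-- The weak derivative of an element of `H¹(0,1)`. -/
def der : H1 →ₗ[ℂ] L2 := (LinearMap.snd ℂ _ _).comp H1.subtype

/-- The embedding `H¹(0,1) → L²(0,1)`. -/
def toL2 : H1 →ₗ[ℂ] L2 := contToL2.comp fn

theorem hasWeakDeriv (f : H1) : HasWeakDeriv (ext (fn f)) (der f) := f.2

end H1

theorem exists_test_primitive {g : ℝ → ℝ} (hg : ContDiff ℝ ∞ g) (hc : HasCompactSupport g)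
    (hs : tsupport g ⊆ Ioo (0 : ℝ) 1) (h0 : ∫ x, g x = 0) :
    ∃ G : ℝ → ℝ, ContDiff ℝ ∞ G ∧ HasCompactSupport G ∧ tsupport G ⊆ Ioo (0 : ℝ) 1 ∧
      deriv G = g := by
  obtain ⟨a, b, ha, hb, hab⟩ : ∃ a b : ℝ, 0 < a ∧ b < 1 ∧ tsupport g ⊆ Icc a b := by
    rcases (tsupport g).eq_empty_or_nonempty with he | hne
    · exact ⟨1, 0, one_pos, zero_lt_one, by simp [he]⟩
    · exact ⟨sInf (tsupport g), sSup (tsupport g), (hs (hc.isCompact.sInf_mem hne)).1,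
        (hs (hc.isCompact.sSup_mem hne)).2,
        fun x hx => ⟨csInf_le hc.isCompact.bddBelow hx, le_csSup hc.isCompact.bddAbove hx⟩⟩
  have hz : ∀ x, x ∉ Icc a b → g x = 0 := fun x hx =>
    image_eq_zero_of_notMem_tsupport fun h => hx (hab h)
  have hi : Integrable g := hg.continuous.integrable_of_hasCompactSupport hc
  set G : ℝ → ℝ := fun x => ∫ t in Iic x, g t with hG
  have hderiv : ∀ x, HasDerivAt G (g x) x := by
    intro x
    have e : G = fun y => (∫ t in (0 : ℝ)..y, g t) + ∫ t in Iic (0 : ℝ), g t := by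
      funext y
      rw [← intervalIntegral.integral_Iic_sub_Iic hi.integrableOn hi.integrableOn]
      simp [hG]
    rw [e]
    exact (intervalIntegral.integral_hasDerivAt_right (hg.continuous.intervalIntegrable _ _)
      hg.continuous.stronglyMeasurable.stronglyMeasurableAtFilter
      hg.continuous.continuousAt).add_const _
  have hd : deriv G = g := funext fun x => (hderiv x).deriv
  have hGz : ∀ x, x ∉ Icc a b → G x = 0 := by
    intro x hx
    by_cases h : x < a
    · refine setIntegral_eq_zero_of_forall_eq_zero fun t ht => hz t fun h' => ?_
      exact absurd (h'.1.trans ht) (not_le.2 h)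
    · have hbx : b < x := by
        by_contra h'
        exact hx ⟨not_lt.1 h, not_lt.1 h'⟩
      have : ∫ t in Iic x, g t = ∫ t, g t := by
        refine setIntegral_eq_integral_of_forall_compl_eq_zero fun t ht => hz t fun h' => ?_
        exact ht (h'.2.trans hbx.le)
      rw [hG]
      simp only
      rw [this, h0]
  have hsub : tsupport G ⊆ Icc a b := by
    refine closure_minimal (fun x hx => ?_) isClosed_Icc
    by_contra h
    exact hx (hGz x h)
  refine ⟨G, ?_, isCompact_Icc.of_isClosed_subset (isClosed_tsupport G) hsub,
    hsub.trans fun x hx => ⟨ha.trans_le hx.1, hx.2.trans_lt hb⟩, hd⟩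
  rw [contDiff_infty_iff_deriv]
  exact ⟨fun x => (hderiv x).differentiableAt, hd ▸ hg⟩

/-- A continuous function on `[0,1]` with vanishing weak derivative is constant. -/
theorem apply_eq_of_weakDeriv_zero {f : C(unitInterval, ℂ)} {u : ℝ → ℂ}
    (hf : HasWeakDeriv (ext f) u) (hu : u =ᵐ[volume.restrict (Ioo (0 : ℝ) 1)] 0) :
    ∃ c : ℂ, f = ContinuousMap.const _ c := by
  have hf0 : ∀ φ : ℝ → ℝ, ContDiff ℝ ∞ φ → HasCompactSupport φ →
      tsupport φ ⊆ Ioo (0 : ℝ) 1 → ∫ x in Ioo (0 : ℝ) 1, deriv φ x • ext f x = 0 := by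
    intro φ h1 h2 h3
    rw [hf φ h1 h2 h3, neg_eq_zero]
    refine integral_eq_zero_of_ae ?_
    filter_upwards [hu] with x hx
    simp [hx]
  let ψb : ContDiffBump (1 / 2 : ℝ) := ⟨1 / 8, 1 / 4, by norm_num, by norm_num⟩
  set ψ : ℝ → ℝ := ψb.normed volume with hψ
  have ψ1 : ContDiff ℝ ∞ ψ := ψb.contDiff_normed
  have ψ2 : HasCompactSupport ψ := ψb.hasCompactSupport_normed
  have ψ3 : tsupport ψ ⊆ Ioo (0 : ℝ) 1 := by
    rw [hψ, ψb.tsupport_normed_eq, Real.closedBall_eq_Icc]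
    intro x hx
    have e : ψb.rOut = 1 / 4 := rfl
    rw [e] at hx
    constructor <;> [linarith [hx.1]; linarith [hx.2]]
  have ψ4 : ∫ x, ψ x = 1 := ψb.integral_normed
  set c : ℂ := ∫ x in Ioo (0 : ℝ) 1, ψ x • ext f x with hcdef
  refine ⟨c, eq_of_ext_ae_eq ?_⟩
  have key : ∀ᵐ x ∂(volume : Measure ℝ), x ∈ Ioo (0 : ℝ) 1 → ext f x - c = 0 := by
    refine IsOpen.ae_eq_zero_of_integral_contDiff_smul_eq_zero isOpen_Ioo
      (((continuous_ext f).sub continuous_const).locallyIntegrable.locallyIntegrableOn _) ?_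
    intro g g1 g2 g3
    set k : ℝ := ∫ x, g x with hk
    obtain ⟨G, G1, G2, G3, G4⟩ := exists_test_primitive (g := fun x => g x - k * ψ x)
      (g1.sub (contDiff_const.mul ψ1)) (g2.sub (ψ2.mul_left (f := fun _ => k)))
      ((tsupport_sub g (fun x => k * ψ x)).trans
        (union_subset g3 ((tsupport_mul_subset_right (f := fun _ => k)).trans ψ3)))
      (by
        rw [integral_sub (g1.continuous.integrable_of_hasCompactSupport g2)
          ((ψ1.continuous.integrable_of_hasCompactSupport ψ2).const_mul k),
          integral_const_mul, ψ4]
        simp [hk])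
    have h := hf0 G G1 G2 G3
    rw [G4] at h
    have ig := integrableOn_smul g1.continuous g2 (memLp_ext f)
    have iψ := integrableOn_smul ψ1.continuous ψ2 (memLp_ext f)
    have e1 : ∫ x in Ioo (0 : ℝ) 1, (g x - k * ψ x) • ext f x =
        (∫ x in Ioo (0 : ℝ) 1, g x • ext f x) - k • c := by
      have e0 : ∫ x in Ioo (0 : ℝ) 1, (g x • ext f x - k • (ψ x • ext f x)) =
          (∫ x in Ioo (0 : ℝ) 1, g x • ext f x)
            - ∫ x in Ioo (0 : ℝ) 1, k • (ψ x • ext f x) := integral_sub ig (iψ.smul k)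
      rw [hcdef, ← integral_smul, ← e0]
      simp only [sub_smul, mul_smul]
    have hzero : ∀ x, x ∉ Ioo (0 : ℝ) 1 → g x = 0 := fun x hx =>
      image_eq_zero_of_notMem_tsupport fun h' => hx (g3 h')
    have e2 : ∫ x, g x • (ext f x - c) = ∫ x in Ioo (0 : ℝ) 1, g x • (ext f x - c) := by
      refine (setIntegral_eq_integral_of_forall_compl_eq_zero fun x hx => ?_).symm
      rw [hzero x hx, zero_smul]
    have e3 : ∫ x in Ioo (0 : ℝ) 1, g x = k :=
      setIntegral_eq_integral_of_forall_compl_eq_zero fun x hx => hzero x hx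
    have gi : IntegrableOn g (Ioo (0 : ℝ) 1) :=
      (g1.continuous.integrable_of_hasCompactSupport g2).integrableOn
    rw [e2]
    simp only [smul_sub]
    rw [integral_sub ig (gi.smul_const c), integral_smul_const, e3, ← e1, h]
  rw [Filter.EventuallyEq, ae_restrict_iff' measurableSet_Ioo]
  filter_upwards [key] with x hx hxm
  exact sub_eq_zero.1 (hx hxm)

/-- The state space `H¹(0,1) × L²(0,1) × ℂ`; the parameters enter only through the norm. -/
def H2 (_β _m : ℝ) : Type := H1 × L2 × ℂ

namespace H2

variable {β m : ℝ}

instance : AddCommGroup (H2 β m) := inferInstanceAs (AddCommGroup (H1 × L2 × ℂ))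

instance : Module ℂ (H2 β m) := inferInstanceAs (Module ℂ (H1 × L2 × ℂ))

/-- First component `f` of a state `(f, g, η)`. -/
def pos : H2 β m →ₗ[ℂ] H1 := LinearMap.fst ℂ H1 (L2 × ℂ)

/-- Second component `g` of a state `(f, g, η)`. -/
def vel : H2 β m →ₗ[ℂ] L2 := (LinearMap.fst ℂ L2 ℂ).comp (LinearMap.snd ℂ H1 (L2 × ℂ))

/-- Third component `η` of a state `(f, g, η)`. -/
def tip : H2 β m →ₗ[ℂ] ℂ := (LinearMap.snd ℂ L2 ℂ).comp (LinearMap.snd ℂ H1 (L2 × ℂ))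

theorem ext_iff' {y z : H2 β m} :
    y = z ↔ pos y = pos z ∧ vel y = vel z ∧ tip y = tip z := by
  constructor
  · rintro rfl
    exact ⟨rfl, rfl, rfl⟩
  · rintro ⟨h1, h2, h3⟩
    exact Prod.ext h1 (Prod.ext h2 h3)

theorem re_inner_self {F : Type*} [NormedAddCommGroup F] [InnerProductSpace ℂ F] (x : F) :
    (inner ℂ x x).re = ‖x‖ ^ 2 :=
  inner_self_eq_norm_sq (𝕜 := ℂ) x

/-- The inner product
`⟪f₁', f₂'⟫ + ⟪g₁, g₂⟫ + β conj(f₁(0)) f₂(0) + conj(η₁) η₂ / m` of the state space. -/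
@[reducible]
def core (hβ : 0 < β) (hm : 0 < m) : InnerProductSpace.Core ℂ (H2 β m) where
  inner y z := inner ℂ (H1.der (pos y)) (H1.der (pos z)) + inner ℂ (vel y) (vel z)
    + (β : ℂ) * inner ℂ (H1.fn (pos y) 0) (H1.fn (pos z) 0)
    + inner ℂ (tip y) (tip z) / (m : ℂ)
  conj_inner_symm y z := by
    simp only [map_add, map_mul, map_div₀, inner_conj_symm, Complex.conj_ofReal]
  re_inner_nonneg y := by
    simp only [RCLike.re_to_complex, Complex.add_re, Complex.re_ofReal_mul,
      Complex.div_ofReal_re, re_inner_self]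
    positivity
  add_left x y z := by
    simp only [map_add, inner_add_left, ContinuousMap.add_apply]
    ring
  smul_left x y r := by
    simp only [map_smul, inner_smul_left, ContinuousMap.smul_apply]
    ring
  definite y hy := by
    have hre := congrArg Complex.re hy
    simp only [Complex.add_re, Complex.re_ofReal_mul, Complex.div_ofReal_re, Complex.zero_re,
      re_inner_self] at hre
    have e1 : H1.der (pos y) = 0 := by
      rw [← norm_eq_zero, ← sq_eq_zero_iff]
      have : 0 ≤ ‖tip y‖ ^ 2 / m := by positivity
      have : 0 ≤ β * ‖H1.fn (pos y) 0‖ ^ 2 := by positivity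
      nlinarith [sq_nonneg ‖vel y‖, sq_nonneg ‖H1.der (pos y)‖]
    have e2 : vel y = 0 := by
      rw [← norm_eq_zero, ← sq_eq_zero_iff]
      have : 0 ≤ ‖tip y‖ ^ 2 / m := by positivity
      have : 0 ≤ β * ‖H1.fn (pos y) 0‖ ^ 2 := by positivity
      nlinarith [sq_nonneg ‖vel y‖, sq_nonneg ‖H1.der (pos y)‖]
    have e3 : H1.fn (pos y) 0 = 0 := by
      rw [← norm_eq_zero, ← sq_eq_zero_iff]
      have h5 : 0 ≤ ‖tip y‖ ^ 2 / m := by positivity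
      have h6 : 0 ≤ β * ‖H1.fn (pos y) 0‖ ^ 2 := by positivity
      have h7 : β * ‖H1.fn (pos y) 0‖ ^ 2 = 0 := by
        nlinarith [sq_nonneg ‖vel y‖, sq_nonneg ‖H1.der (pos y)‖]
      exact (mul_eq_zero.1 h7).resolve_left hβ.ne'
    have e4 : tip y = 0 := by
      rw [← norm_eq_zero, ← sq_eq_zero_iff]
      have h5 : 0 ≤ ‖tip y‖ ^ 2 / m := by positivity
      have h6 : 0 ≤ β * ‖H1.fn (pos y) 0‖ ^ 2 := by positivity
      have h7 : ‖tip y‖ ^ 2 / m = 0 := by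
        nlinarith [sq_nonneg ‖vel y‖, sq_nonneg ‖H1.der (pos y)‖]
      exact (div_eq_zero_iff.1 h7).resolve_right hm.ne'
    have e5 : pos y = 0 := by
      obtain ⟨c, hc⟩ := apply_eq_of_weakDeriv_zero (H1.hasWeakDeriv (pos y))
        (by rw [e1]; exact Lp.coeFn_zero ℂ 2 _)
      have hc0 : c = 0 := by
        rw [hc] at e3
        exact e3
      have hfn : H1.fn (pos y) = 0 := by
        rw [hc, hc0]
        rfl
      exact Subtype.ext (Prod.ext hfn e1)
    exact ext_iff'.2 ⟨by rw [e5, map_zero], by rw [e2, map_zero], by rw [e4, map_zero]⟩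

instance [hβ : Fact (0 < β)] [hm : Fact (0 < m)] : NormedAddCommGroup (H2 β m) :=
  @InnerProductSpace.Core.toNormedAddCommGroup ℂ (H2 β m) _ _ _ (core hβ.out hm.out)

instance [hβ : Fact (0 < β)] [hm : Fact (0 < m)] : InnerProductSpace ℂ (H2 β m) :=
  InnerProductSpace.ofCore (core hβ.out hm.out).toCore

/-- The norm of the state space:
`‖(f, g, η)‖² = ∫₀¹ |f'|² + |g|² dx + β |f(0)|² + |η|² / m`. -/
theorem norm_sq [hβ : Fact (0 < β)] [hm : Fact (0 < m)] (y : H2 β m) :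
    ‖y‖ ^ 2 = (∫ x in Ioo (0 : ℝ) 1, ‖H1.der (pos y) x‖ ^ 2 + ‖vel y x‖ ^ 2)
      + β * ‖H1.fn (pos y) 0‖ ^ 2 + ‖tip y‖ ^ 2 / m := by
  have hL : ∀ u : L2, Integrable (fun x => ‖u x‖ ^ 2) (volume.restrict (Ioo (0 : ℝ) 1)) :=
    fun u => (Lp.memLp u).integrable_norm_pow two_ne_zero
  have hn : ∀ u : L2, ∫ x in Ioo (0 : ℝ) 1, ‖u x‖ ^ 2 = ‖u‖ ^ 2 := by
    intro u
    have h := congrArg Complex.re (L2.inner_def (𝕜 := ℂ) u u)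
    simp only [inner_self_eq_norm_sq_to_K] at h
    have h' : ∫ x in Ioo (0 : ℝ) 1, ((‖u x‖ : ℂ) ^ 2)
        = ((∫ x in Ioo (0 : ℝ) 1, ‖u x‖ ^ 2 : ℝ) : ℂ) := by
      rw [← integral_complex_ofReal]
      simp
    erw [h'] at h
    norm_cast at h
    exact h.symm
  rw [integral_add (hL _) (hL _), hn, hn, ← inner_self_eq_norm_sq (𝕜 := ℂ) y]
  change Complex.re (inner ℂ (H1.der (pos y)) (H1.der (pos y)) + inner ℂ (vel y) (vel y)
    + (β : ℂ) * inner ℂ (H1.fn (pos y) 0) (H1.fn (pos y) 0)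
    + inner ℂ (tip y) (tip y) / (m : ℂ)) = _
  simp only [Complex.add_re, Complex.re_ofReal_mul, Complex.div_ofReal_re, re_inner_self]

end H2

/-- The graph of the operator `(f, g, η) ↦ (g, f'', -f'(1))` on the domain of those
`(f, g, η)` with `(g, f'', -f'(1))` in the state space, `f'(0) = γ g(0) + β f(0)` and
`η = m g(1)`. Here `v ∈ H¹(0,1)` is the derivative `f'`, so that `f'' = v'`, and the first
component of the image is `g`, now as an element of `H¹(0,1)`. -/
def A2Graph (m β γ : ℝ) : Submodule ℂ (H2 β m × H2 β m) where
  carrier := {p |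
    H1.toL2 (H2.pos p.2) = H2.vel p.1 ∧
    H2.tip p.1 = m * H1.fn (H2.pos p.2) 1 ∧
    ∃ v : H1, H1.toL2 v = H1.der (H2.pos p.1) ∧
      H1.der v = H2.vel p.2 ∧
      -(H1.fn v 1) = H2.tip p.2 ∧
      H1.fn v 0 = γ * H1.fn (H2.pos p.2) 0 + β * H1.fn (H2.pos p.1) 0}
  zero_mem' := ⟨by simp, by simp, 0, by simp, by simp, by simp, by simp⟩
  add_mem' := by
    rintro p q ⟨h1, h2, v, h3, h4, h5, h6⟩ ⟨k1, k2, w, k3, k4, k5, k6⟩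
    refine ⟨?_, ?_, v + w, ?_, ?_, ?_, ?_⟩
    · simp only [Prod.fst_add, Prod.snd_add, map_add, h1, k1]
    · simp only [Prod.fst_add, Prod.snd_add, map_add, h2, k2, ContinuousMap.add_apply]
      ring
    · simp only [Prod.fst_add, map_add, h3, k3]
    · simp only [Prod.snd_add, map_add, h4, k4]
    · simp only [Prod.snd_add, map_add, ← h5, ← k5, ContinuousMap.add_apply]
      ring
    · simp only [Prod.fst_add, Prod.snd_add, map_add, h6, k6, ContinuousMap.add_apply]
      ring
  smul_mem' := by
    rintro c p ⟨h1, h2, v, h3, h4, h5, h6⟩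
    refine ⟨?_, ?_, c • v, ?_, ?_, ?_, ?_⟩
    · simp only [Prod.smul_fst, Prod.smul_snd, map_smul, h1]
    · simp only [Prod.smul_fst, Prod.smul_snd, map_smul, h2, ContinuousMap.smul_apply,
        smul_eq_mul]
      ring
    · simp only [Prod.smul_fst, map_smul, h3]
    · simp only [Prod.smul_snd, map_smul, h4]
    · simp only [Prod.smul_snd, map_smul, ← h5, ContinuousMap.smul_apply, smul_eq_mul]
      ring
    · simp only [Prod.smul_fst, Prod.smul_snd, map_smul, h6, ContinuousMap.smul_apply,
        smul_eq_mul]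
      ring

/-- An element of `H¹(0,1)`, with its weak derivative, is determined by its class in
`L²(0,1)`. -/
theorem H1.toL2_injective : Function.Injective H1.toL2 := by
  intro p q h
  have hfn : H1.fn p = H1.fn q := contToL2_injective h
  have hint : ∀ u : L2, IntegrableOn u (Ioo (0 : ℝ) 1) := fun u =>
    (Lp.memLp u).integrable one_le_two
  have key : ∀ᵐ x ∂(volume : Measure ℝ), x ∈ Ioo (0 : ℝ) 1 →
      H1.der p x - H1.der q x = 0 := by
    refine IsOpen.ae_eq_zero_of_integral_contDiff_smul_eq_zero isOpen_Ioo
      ((hint _).sub (hint _)).locallyIntegrableOn ?_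
    intro g g1 g2 g3
    have hp := H1.hasWeakDeriv p g g1 g2 g3
    have hq := H1.hasWeakDeriv q g g1 g2 g3
    rw [hfn, hq, neg_inj] at hp
    rw [← setIntegral_eq_integral_of_forall_compl_eq_zero (s := Ioo (0 : ℝ) 1)]
    · simp only [smul_sub]
      rw [integral_sub (integrableOn_smul g1.continuous g2 (Lp.memLp _))
        (integrableOn_smul g1.continuous g2 (Lp.memLp _)), hp, sub_self]
    · intro x hx
      rw [image_eq_zero_of_notMem_tsupport fun h' => hx (g3 h'), zero_smul]
  refine Subtype.ext (Prod.ext hfn (Lp.ext ?_))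
  rw [Filter.EventuallyEq, ae_restrict_iff' measurableSet_Ioo]
  filter_upwards [key] with x hx hxm
  exact sub_eq_zero.1 (hx hxm)

theorem A2Graph_single_valued (m β γ : ℝ) :
    ∀ p ∈ A2Graph m β γ, p.1 = 0 → p.2 = 0 := by
  rintro ⟨y, z⟩ ⟨h1, -, v, h3, h4, h5, -⟩ hy
  simp only at hy h1 h3 h4 h5 ⊢
  subst hy
  have hz : H2.pos z = 0 := H1.toL2_injective (by rw [h1, map_zero, map_zero])
  have hv : v = 0 := H1.toL2_injective (by rw [h3, map_zero, map_zero, map_zero])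
  subst hv
  refine H2.ext_iff'.2 ⟨by rw [hz, map_zero], by rw [← h4, map_zero, map_zero], ?_⟩
  rw [← h5]
  simp

/-- The operator `A₂(f, g, η) = (g, f'', -f'(1))` as an unbounded operator. -/
def A2 (m β γ : ℝ) : H2 β m →ₗ.[ℂ] H2 β m := (A2Graph m β γ).toLinearPMap

theorem A2_graph (m β γ : ℝ) : (A2 m β γ).graph = A2Graph m β γ :=
  Submodule.toLinearPMap_graph_eq _ (A2Graph_single_valued m β γ)

section Abstract

variable {E : Type*} [AddCommGroup E] [Module ℂ E]

/-- `y` lies in the domain of `A` and `A y = μ y`. -/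
def InEigenspace (A : E →ₗ.[ℂ] E) (μ : ℂ) (y : E) : Prop :=
  ∃ h : y ∈ A.domain, A ⟨y, h⟩ = μ • y

/-- `μ` is an eigenvalue of the unbounded operator `A`. -/
def IsEigenvalue (A : E →ₗ.[ℂ] E) (μ : ℂ) : Prop :=
  ∃ y : E, y ≠ 0 ∧ InEigenspace A μ y

/-- `y` lies in the domain of `(A - μ)^k` and `(A - μ)^k y = 0`. -/
def InKerPow (A : E →ₗ.[ℂ] E) (μ : ℂ) : ℕ → E → Prop
  | 0, y => y = 0
  | k + 1, y => ∃ h : y ∈ A.domain, InKerPow A μ k (A ⟨y, h⟩ - μ • y)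

/-- `y` is a generalized eigenvector (root vector) of the unbounded operator `A`. -/
def IsGeneralizedEigenvector (A : E →ₗ.[ℂ] E) (y : E) : Prop :=
  y ≠ 0 ∧ ∃ (μ : ℂ) (k : ℕ), InKerPow A μ k y

end Abstract

/-- A Riesz basis: the image of an orthonormal basis under a bounded operator with bounded
inverse. -/
def IsRieszBasis {ι H : Type*} [NormedAddCommGroup H] [InnerProductSpace ℂ H]
    (φ : ι → H) : Prop :=
  ∃ (b : HilbertBasis ι ℂ H) (T : H ≃L[ℂ] H), ∀ n, φ n = T (b n)

/-- The function `[(1+γ)μ + β] e^{μx} + [(1-γ)μ - β] e^{-μx}`. -/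
def eigFun (β γ : ℝ) (μ : ℂ) (x : ℝ) : ℂ :=
  ((1 + γ) * μ + β) * Complex.exp (μ * x) + ((1 - γ) * μ - β) * Complex.exp (-(μ * x))

/-- The shifted index: `n` if `γ > 1` and `n + 1/2` if `γ < 1`. -/
def shiftedIndex (γ : ℝ) (n : ℤ) : ℝ := if 1 < γ then n else n + 1 / 2

/-- `|(γ-1)/(γ+1)|^{x/2} e^{i n_β π x}`. -/
def waveR (γ : ℝ) (n : ℤ) (x : ℝ) : ℂ :=
  ((|(γ - 1) / (γ + 1)| ^ (x / 2) : ℝ) : ℂ) *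
    Complex.exp (Complex.I * shiftedIndex γ n * Real.pi * x)

/-- `|(γ+1)/(γ-1)|^{x/2} e^{-i n_β π x}`. -/
def waveL (γ : ℝ) (n : ℤ) (x : ℝ) : ℂ :=
  ((|(γ + 1) / (γ - 1)| ^ (x / 2) : ℝ) : ℂ) *
    Complex.exp (-(Complex.I * shiftedIndex γ n * Real.pi * x))

end TipMassWave

end

open TipMassWave

/-! The spectral problem is explicit. If `A₂ y = μ y`, then `f' + μ f` and `f' - μ f` solve
first-order equations, so `y` is determined by `f(0)`, and the boundary condition at `1` holds for a
nonzero `y` exactly when the entire function `charFun` vanishes (`eigenspace_structure`,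
`isEigenvalue_iff`). This gives the eigenspaces.

For large `μ` the equation `charFun = 0` reads `e^{2μ} = (γ-1)/(γ+1) · q(μ)` with `q(μ) = 1 +
O(1/μ)`. Taking logarithms turns it into `μ = ξₙ + ½ log q(μ)`, where `ξₙ` is `leadEv γ n`. The
perturbation is small and contracting, so each large `|n|` has one solution, at distance `O(1/|n|)`
from `ξₙ` (`exists_charFun_zeros`). All other zeros lie in a disc, hence are finitely many.
Inserting the asymptotics into the exponentials gives the asymptotics of the eigenfunctions.

For the Riesz basis, use the travelling components `g + f'` and `g - f'`. Reflecting one of them to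
`(-1,0)` turns the pair into one function on `(-1,1)`, so the exponentials of period two, shifted by
`n_β`, give an orthonormal basis (`exists_hilbertBasis_refVec`); two unit vectors account for `f(0)`
and `η`. Multiplying the components by `2(1±γ)` times real exponentials maps this basis to the
leading terms of the eigenvectors (`exists_equiv_refVec`). The errors are `O(1/|n|)`, thus square
summable, and since invertible operators form an open set, the eigenvectors agree with a Riesz basis
off a finite index set `F` (`exists_equiv_eq_off_finset`).

The missing vectors are found without counting multiplicities. The bounded inverse of `A₂` preserves
the closed span of the eigenvectors already used and acts on the quotient `ℂ^F`, invertibly because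
its range is dense. A basis of root vectors of this matrix lifts to root vectors of the inverse,
hence of `A₂` (`exists_riesz_basis_root_vectors`, `inKerPow_of_A2inv`). -/

namespace TipMassWave

/-! ### Square summable perturbations of Riesz bases. -/

section RieszPerturbation

variable {J E : Type*} [NormedAddCommGroup E] [InnerProductSpace ℂ E]

theorem hasSum_norm_repr_sq (b : HilbertBasis J ℂ E) (y : E) :
    HasSum (fun j => ‖b.repr y j‖ ^ 2) (‖y‖ ^ 2) := by
  have h := b.hasSum_inner_mul_inner y y
  have h2 := Complex.hasSum_re h
  have e : (inner ℂ y y).re = ‖y‖ ^ 2 := inner_self_eq_norm_sq (𝕜 := ℂ) y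
  rw [e] at h2
  refine h2.congr_fun fun j => ?_
  rw [b.repr_apply_apply, ← inner_conj_symm y, Complex.conj_mul']
  norm_cast

/-- A square summable family is the image of a Hilbert basis under a bounded operator. -/
theorem exists_clm_of_summable_sq [CompleteSpace E] (b : HilbertBasis J ℂ E) (d : J → E)
    (hd : Summable fun j => ‖d j‖ ^ 2) :
    ∃ D : E →L[ℂ] E, (∀ j, D (b j) = d j) ∧ ‖D‖ ≤ √(∑' j, ‖d j‖ ^ 2) := by
  classical
  -- Cauchy–Schwarz gives both the absolute convergence of the series defining `D y` and the
  -- Hilbert–Schmidt bound on `‖D‖`.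
  have key : ∀ y : E, (Summable fun j => ‖b.repr y j‖ * ‖d j‖) ∧
      ∑' j, ‖b.repr y j‖ * ‖d j‖ ≤ ‖y‖ * √(∑' j, ‖d j‖ ^ 2) := by
    intro y
    have h := Real.summable_and_inner_le_Lp_mul_Lq_tsum_of_nonneg
      (f := fun j => ‖b.repr y j‖) (g := fun j => ‖d j‖) Real.HolderConjugate.two_two
      (fun _ => norm_nonneg _) (fun _ => norm_nonneg _)
      (by simpa using (hasSum_norm_repr_sq b y).summable) (by simpa using hd)
    refine ⟨h.1, h.2.trans_eq ?_⟩
    simp only [Real.rpow_ofNat]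
    rw [(hasSum_norm_repr_sq b y).tsum_eq, ← Real.sqrt_eq_rpow, ← Real.sqrt_eq_rpow,
      Real.sqrt_sq (norm_nonneg y)]
  have hs : ∀ y : E, Summable fun j => b.repr y j • d j := fun y =>
    Summable.of_norm (by simpa only [norm_smul] using (key y).1)
  let D0 : E →ₗ[ℂ] E :=
    { toFun := fun y => ∑' j, b.repr y j • d j
      map_add' := fun y z => by
        rw [← (hs y).tsum_add (hs z)]
        refine tsum_congr fun j => ?_
        rw [map_add, lp.coeFn_add, Pi.add_apply, add_smul]
      map_smul' := fun c y => by
        rw [RingHom.id_apply, ← (hs y).tsum_const_smul]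
        refine tsum_congr fun j => ?_
        rw [map_smul, lp.coeFn_smul, Pi.smul_apply, smul_assoc] }
  refine ⟨D0.mkContinuous (√(∑' j, ‖d j‖ ^ 2)) fun y => ?_, fun j => ?_,
    LinearMap.mkContinuous_norm_le _ (Real.sqrt_nonneg _) _⟩
  · rw [mul_comm]
    refine le_trans (norm_tsum_le_tsum_norm ?_) ?_
    · simpa only [norm_smul] using (key y).1
    · simpa only [norm_smul] using (key y).2
  · change ∑' k, b.repr (b j) k • d k = d j
    rw [tsum_eq_single j]
    · rw [b.repr_self, lp.single_apply_self, one_smul]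
    · intro k hk
      rw [b.repr_self, lp.single_apply_ne _ _ _ hk, zero_smul]

theorem exists_finset_tail_small {f : J → ℝ} (hf : Summable f) (F₀ : Finset J) {ε : ℝ}
    (hε : 0 < ε) : ∃ F : Finset J, F₀ ⊆ F ∧ ∃ s < ε, HasSum ((F : Set J)ᶜ.indicator f) s := by
  classical
  have h := (hf.hasSum.eventually (lt_mem_nhds (show ∑' j, f j - ε < ∑' j, f j by linarith))).and
    (Filter.eventually_ge_atTop F₀)
  obtain ⟨F, h1, h2⟩ := h.exists
  refine ⟨F, h2, ∑' j, f j - ∑ j ∈ F, f j, by linarith, ?_⟩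
  have hF : HasSum ((F : Set J).indicator f) (∑ j ∈ F, f j) := by
    rw [← Finset.sum_congr rfl fun j hj => indicator_of_mem (Finset.mem_coe.2 hj) f]
    exact hasSum_sum_of_ne_finset_zero fun j hj => indicator_of_notMem (by simpa using hj) f
  refine (hf.hasSum.sub hF).congr_fun fun j => ?_
  by_cases hj : j ∈ F <;> simp [hj]

/-- A family that is quadratically close to a Riesz basis agrees, off a finite set of indices,
with some Riesz basis. -/
theorem exists_equiv_eq_off_finset [CompleteSpace E] (b : HilbertBasis J ℂ E) (S : E ≃L[ℂ] E)
    (x : J → E) (F₀ : Finset J)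
    (hx : Summable ((F₀ : Set J)ᶜ.indicator fun j => ‖x j - S (b j)‖ ^ 2)) :
    ∃ (F : Finset J) (P : E ≃L[ℂ] E), F₀ ⊆ F ∧ ∀ j ∉ F, P (b j) = x j := by
  -- Invertible operators form an open set; `ε` is the radius of a ball around `S` inside it.
  obtain ⟨ε, hε, hball⟩ := Metric.mem_nhds_iff.1 (ContinuousLinearEquiv.nhds S)
  obtain ⟨F, hF, s, hs, hsum⟩ := exists_finset_tail_small hx F₀ (sq_pos_of_pos hε)
  have e : ∀ j, (F : Set J)ᶜ.indicator ((F₀ : Set J)ᶜ.indicator fun j => ‖x j - S (b j)‖ ^ 2) j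
      = ‖(F : Set J)ᶜ.indicator (fun j => x j - S (b j)) j‖ ^ 2 := by
    intro j
    by_cases hj : j ∈ F
    · simp [hj]
    · have : j ∉ F₀ := fun h => hj (hF h)
      simp [hj, this]
  have hsum' := hsum.congr_fun fun j => (e j).symm
  -- `D` corrects `S (b j)` to `x j` off `F` and vanishes on the vectors indexed by `F`, so the tail
  -- bound makes `S + D` invertible.
  obtain ⟨D, hD, hn⟩ := exists_clm_of_summable_sq b _ hsum'.summable
  have hDε : ‖D‖ < ε := by
    refine hn.trans_lt ?_
    rw [hsum'.tsum_eq, Real.sqrt_lt' hε]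
    exact hs
  obtain ⟨P, hP⟩ := hball (show (S : E →L[ℂ] E) + D ∈ Metric.ball (S : E →L[ℂ] E) ε by
    rw [Metric.mem_ball, dist_eq_norm, add_sub_cancel_left]
    exact hDε)
  refine ⟨F, P, hF, fun j hj => ?_⟩
  have : (P : E →L[ℂ] E) (b j) = x j := by
    rw [hP, add_apply, hD, indicator_of_mem (by simpa using hj)]
    simp
  exact this

end RieszPerturbation

/-! ### Completing a cofinite family of eigenvectors by root vectors. -/

section RootVectors

theorem clm_mul_apply {E : Type*} [NormedAddCommGroup E] [NormedSpace ℂ E] (A B : E →L[ℂ] E)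
    (y : E) : (A * B) y = A (B y) := rfl

/-- An endomorphism of a finite dimensional complex space has a basis of root vectors. -/
theorem exists_basis_root_vectors {ι V : Type*} [Fintype ι] [AddCommGroup V] [Module ℂ V]
    [FiniteDimensional ℂ V] (hV : Module.finrank ℂ V = Fintype.card ι) (f : Module.End ℂ V) :
    ∃ v : Module.Basis ι ℂ V, ∀ i, ∃ (κ : ℂ) (k : ℕ), ((f - κ • 1) ^ k) (v i) = 0 := by
  classical
  have hs : ⊤ ≤ Submodule.span ℂ (⋃ κ : ℂ, (f.maxGenEigenspace κ : Set V)) := by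
    rw [← Module.End.iSup_maxGenEigenspace_eq_top f, Submodule.span_iUnion]
    exact iSup_mono fun κ => Submodule.subset_span
  let v := Module.Basis.ofSpan hs
  have : Fintype _ := FiniteDimensional.fintypeBasisIndex v
  let e := Fintype.equivOfCardEq ((Module.finrank_eq_card_basis v).symm.trans hV)
  refine ⟨v.reindex e, fun i => ?_⟩
  have hv : v (e.symm i) ∈ ⋃ κ : ℂ, (f.maxGenEigenspace κ : Set V) :=
    Module.Basis.ofSpan_subset hs ⟨_, rfl⟩
  obtain ⟨κ, hκ⟩ := mem_iUnion.1 hv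
  obtain ⟨k, hk⟩ := (Module.End.mem_maxGenEigenspace f κ _).1 hκ
  exact ⟨κ, k, by rwa [Module.Basis.reindex_apply]⟩

variable {J E : Type*} [NormedAddCommGroup E] [InnerProductSpace ℂ E]

/-- Bounded multipliers preserve square summability of coefficients. This supplies the diagonal
resolvent. -/
theorem exists_repr_eq_mul (b : HilbertBasis J ℂ E) (c : J → ℂ) {C : ℝ} (hc : ∀ j, ‖c j‖ ≤ C)
    (y : E) : ∃ z : E, ∀ j, b.repr z j = c j * b.repr y j := by
  have hm : Memℓp (fun j => c j * b.repr y j) 2 := by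
    refine memℓp_gen ?_
    have h := ((hasSum_norm_repr_sq b y).summable.mul_left (C ^ 2))
    refine Summable.of_nonneg_of_le (fun j => by positivity) (fun j => ?_) h
    simp only [ENNReal.toReal_ofNat, Real.rpow_ofNat, norm_mul, mul_pow]
    gcongr
    exact hc j
  exact ⟨b.repr.symm ⟨_, hm⟩, fun j => by rw [LinearIsometryEquiv.apply_symm_apply]⟩

variable (b : HilbertBasis J ℂ E) (P : E ≃L[ℂ] E) (F : Finset J)

/-- The coordinates, with indices in `F`, relative to the Riesz basis `P b`. -/
noncomputable def finCoord : E →ₗ[ℂ] (F → ℂ) :=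
  LinearMap.pi fun j => (innerSL ℂ (b j)).toLinearMap ∘ₗ (P.symm : E →L[ℂ] E).toLinearMap

theorem finCoord_apply (y : E) (j : F) : finCoord b P F y j = b.repr (P.symm y) j := by
  rw [b.repr_apply_apply]
  rfl

theorem continuous_finCoord : Continuous (finCoord b P F) :=
  continuous_pi fun j => ((innerSL ℂ (b j)).comp (P.symm : E →L[ℂ] E)).continuous

theorem hasSum_riesz (y : E) : HasSum (fun j => b.repr (P.symm y) j • P (b j)) y := by
  have := (b.hasSum_repr (P.symm y)).mapL (P : E →L[ℂ] E)
  simpa using this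

variable {b P F} {R : E →L[ℂ] E} {κ : J → ℂ}

/-- The kernel of `finCoord` is the closed span of the `P (b j)` with `j ∉ F`, all eigenvectors of
`R`; expanding `y` and using continuity shows that it is invariant. Hence `R` acts on the quotient.
-/
theorem finCoord_map_eq_zero (hR : ∀ j ∉ F, R (P (b j)) = κ j • P (b j)) {y : E}
    (hy : finCoord b P F y = 0) : finCoord b P F (R y) = 0 := by
  classical
  funext i
  have h := (hasSum_riesz b P y).mapL ((innerSL ℂ (b i)).comp ((P.symm : E →L[ℂ] E).comp R))
  have h0 : ∀ j, (innerSL ℂ (b i)).comp ((P.symm : E →L[ℂ] E).comp R)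
      (b.repr (P.symm y) j • P (b j)) = 0 := by
    intro j
    by_cases hj : j ∈ F
    · have : b.repr (P.symm y) j = 0 := by
        rw [← finCoord_apply b P F y ⟨j, hj⟩, hy]
        rfl
      rw [this, zero_smul, map_zero]
    · have hij : (i : J) ≠ j := fun h => hj (h ▸ i.2)
      have ho : inner ℂ (b i) (b j) = 0 := b.orthonormal.2 hij
      simp [hR j hj, ho]
  simp only [h0] at h
  rw [finCoord_apply, b.repr_apply_apply]
  exact h.unique hasSum_zero

/-- On the kernel of `finCoord` the operator `R` is diagonal, so `R - z` is inverted coefficientwise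
except where `κ j = z`. There the convention `0⁻¹ = 0` leaves a defect lying in the eigenspace of
`z`, which one further factor `R - z` annihilates. -/
theorem exists_resolvent_step (hR : ∀ j ∉ F, R (P (b j)) = κ j • P (b j))
    (hκ : ∀ ε > 0, {j | ε ≤ ‖κ j‖}.Finite) {z : ℂ} (hz : z ≠ 0) {w : E}
    (hw : finCoord b P F w = 0) :
    ∃ w₁ : E, finCoord b P F w₁ = 0 ∧ (R - z • 1) ((R - z • 1) w₁ - w) = 0 := by
  classical
  -- If `‖κ j‖ < ‖z‖/2`, then `κ j` is at distance at least `‖z‖/2` from `z`; only finitely many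
  -- other indices remain.
  obtain ⟨C, hC⟩ : ∃ C : ℝ, ∀ j, ‖(κ j - z)⁻¹‖ ≤ C := by
    have hfin := hκ (‖z‖ / 2) (by positivity)
    obtain ⟨C, hC⟩ := (hfin.image fun j => ‖(κ j - z)⁻¹‖).bddAbove
    refine ⟨max C (2 / ‖z‖), fun j => ?_⟩
    by_cases hj : ‖z‖ / 2 ≤ ‖κ j‖
    · exact (hC ⟨j, hj, rfl⟩).trans (le_max_left _ _)
    · refine le_trans ?_ (le_max_right _ _)
      have h1 : ‖z‖ / 2 ≤ ‖κ j - z‖ := by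
        have := norm_sub_norm_le z (κ j)
        rw [norm_sub_rev] at this
        linarith [not_le.1 hj]
      rw [norm_inv, inv_le_comm₀ (lt_of_lt_of_le (by positivity) h1) (by positivity)]
      rwa [inv_div]
  obtain ⟨a, ha⟩ := exists_repr_eq_mul b (fun j => (κ j - z)⁻¹) hC (P.symm w)
  have hw0 : ∀ j ∈ F, b.repr (P.symm w) j = 0 := fun j hj => by
    rw [← finCoord_apply b P F w ⟨j, hj⟩, hw]
    rfl
  refine ⟨P a, ?_, ?_⟩
  · funext i
    rw [finCoord_apply, P.symm_apply_apply, ha, hw0 i i.2, mul_zero]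
    rfl
  · have h1 := (hasSum_riesz b P (P a)).mapL ((R - z • 1) * (R - z • 1))
    have h2 := (hasSum_riesz b P w).mapL (R - z • 1)
    have h3 := h1.sub h2
    have hterm : ∀ j, ((R - z • 1) * (R - z • 1)) (b.repr (P.symm (P a)) j • P (b j)) -
        (R - z • 1) (b.repr (P.symm w) j • P (b j)) = 0 := by
      intro j
      rw [P.symm_apply_apply, ha]
      by_cases hj : j ∈ F
      · simp [hw0 j hj]
      · by_cases hzj : κ j = z
        · simp [hR j hj, hzj]
        · have : κ j - z ≠ 0 := sub_ne_zero.2 hzj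
          have e : ∀ c : ℂ, (R - z • 1) (c • P (b j)) = ((κ j - z) * c) • P (b j) := by
            intro c
            simp [hR j hj]
            module
          rw [clm_mul_apply, e, e, e, mul_inv_cancel_left₀ this, sub_self]
    simp only [hterm] at h3
    rw [map_sub]
    exact h3.unique hasSum_zero

/-- Each division by `R - z` leaves a defect killed by `R - z`. The next factor removes the earlier
defect, so a single extra factor suffices for every `k`. -/
theorem exists_resolvent_pow (hR : ∀ j ∉ F, R (P (b j)) = κ j • P (b j))
    (hκ : ∀ ε > 0, {j | ε ≤ ‖κ j‖}.Finite) {z : ℂ} (hz : z ≠ 0) (k : ℕ) :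
    ∀ w : E, finCoord b P F w = 0 → ∃ w' : E, finCoord b P F w' = 0 ∧
      (R - z • 1) (((R - z • 1) ^ k) w' - w) = 0 := by
  induction k with
  | zero => exact fun w hw => ⟨w, hw, by simp⟩
  | succ k ih =>
    intro w hw
    obtain ⟨w₁, h1, h2⟩ := exists_resolvent_step hR hκ hz hw
    obtain ⟨w', h3, h4⟩ := ih w₁ h1
    refine ⟨w', h3, ?_⟩
    have e : ((R - z • 1) ^ (k + 1)) w' - w =
        (R - z • 1) (((R - z • 1) ^ k) w' - w₁) + ((R - z • 1) w₁ - w) := by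
      rw [pow_succ', clm_mul_apply, map_sub]
      abel
    rw [e, map_add, h4, h2, map_zero, add_zero]

/-- If a bounded operator with dense range is diagonal, with distinct eigenvalues tending to
zero, on all but finitely many vectors of a Riesz basis, then it has a Riesz basis of root
vectors that contains these. -/
theorem exists_riesz_basis_root_vectors [CompleteSpace E] (hdense : DenseRange R)
    (hR : ∀ j ∉ F, R (P (b j)) = κ j • P (b j)) (h0 : ∀ j ∉ F, κ j ≠ 0)
    (hκ : ∀ ε > 0, {j | ε ≤ ‖κ j‖}.Finite) :
    ∃ T : E ≃L[ℂ] E, ∀ j, ∃ z : ℂ, z ≠ 0 ∧ ∃ k : ℕ, ((R - z • 1) ^ k) (T (b j)) = 0 := by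
  classical
  set Λ := finCoord b P F with hΛ
  have hb : ∀ i j, inner ℂ (b i) (b j) = if i = j then (1 : ℂ) else 0 :=
    orthonormal_iff_ite.1 b.orthonormal
  -- A linear section of `Λ`.
  let σ : (F → ℂ) →ₗ[ℂ] E := ∑ j : F, (LinearMap.proj j).smulRight (P (b j))
  have hσ : ∀ c, σ c = ∑ j : F, c j • P (b j) := fun c => by simp [σ]
  have hΛb : ∀ j i : F, Λ (P (b j)) i = if i = j then 1 else 0 := by
    intro j i
    rw [hΛ, finCoord_apply, P.symm_apply_apply, b.repr_apply_apply, hb]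
    simp only [Subtype.val_inj]
  have hΛσ : ∀ c, Λ (σ c) = c := by
    intro c
    funext i
    rw [hσ, map_sum, Finset.sum_apply]
    simp [hΛb]
  -- The map induced by `R` on the quotient of `E` by the kernel of `Λ`, identified with `ℂ^F`.
  let Rq : Module.End ℂ (F → ℂ) := Λ ∘ₗ R.toLinearMap ∘ₗ σ
  have hRq : ∀ y, Rq (Λ y) = Λ (R y) := by
    intro y
    have h : Λ (y - σ (Λ y)) = 0 := by rw [map_sub, hΛσ, sub_self]
    have := finCoord_map_eq_zero hR h
    rw [map_sub, map_sub, sub_eq_zero] at this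
    exact this.symm
  -- The range of `Rq` is dense because that of `R` is, and closed because it is finite dimensional.
  have hsurj : Function.Surjective Rq := by
    have hd : DenseRange (fun y => Λ (R y)) :=
      (Function.Surjective.denseRange fun c => ⟨σ c, hΛσ c⟩).comp hdense
        (continuous_finCoord b P F)
    have hcl : IsClosed (LinearMap.range Rq : Set (F → ℂ)) :=
      Submodule.closed_of_finiteDimensional _
    have hsub : range (fun y => Λ (R y)) ⊆ LinearMap.range Rq := by
      rintro _ ⟨y, rfl⟩
      exact ⟨Λ y, hRq y⟩
    intro c
    have : c ∈ closure (range fun y => Λ (R y)) := hd c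
    exact hcl.closure_subset_iff.2 hsub this
  have hker : Function.Injective Rq := LinearMap.injective_iff_surjective.2 hsurj
  obtain ⟨v, hv⟩ := exists_basis_root_vectors (ι := F) (V := F → ℂ) (by simp) Rq
  have hpow : ∀ (z : ℂ) (k : ℕ) y, ((Rq - z • 1) ^ k) (Λ y) = Λ (((R - z • 1) ^ k) y) := by
    intro z k
    induction k with
    | zero => intro y; rfl
    | succ k ih =>
      intro y
      have : (Rq - z • 1) (Λ y) = Λ ((R - z • 1) y) := by
        simp [hRq]
      rw [pow_succ, pow_succ, Module.End.mul_apply, clm_mul_apply, this, ih]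
  have hlift : ∀ i : F, ∃ u : E, Λ u = v i ∧
      ∃ z : ℂ, z ≠ 0 ∧ ∃ k : ℕ, ((R - z • 1) ^ k) u = 0 := by
    intro i
    obtain ⟨z, k, hk⟩ := hv i
    have hz : z ≠ 0 := by
      rintro rfl
      rw [zero_smul, sub_zero, Module.End.pow_apply] at hk
      exact v.ne_zero i (hker.iterate k (hk.trans (by rw [← Module.End.pow_apply, map_zero])))
    have hw : Λ (((R - z • 1) ^ k) (σ (v i))) = 0 := by rw [← hpow, hΛσ, hk]
    -- The lift `σ (v i)` satisfies the root vector equation only modulo the kernel of `Λ`.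
    -- Subtracting `w'`, which lies in this kernel, corrects it at the price of the exponent `k +
    -- 1`.
    obtain ⟨w', h1, h2⟩ := exists_resolvent_pow hR hκ hz k _ hw
    refine ⟨σ (v i) - w', by rw [map_sub, hΛσ, h1, sub_zero], z, hz, k + 1, ?_⟩
    rw [pow_succ', clm_mul_apply, map_sub, map_sub, ← neg_eq_zero, neg_sub, ← map_sub]
    exact h2
  choose u hu1 hu2 using hlift
  -- `P` with the images of `b j`, `j ∈ F`, replaced by the root vectors `u j`.
  let T₀ : E →L[ℂ] E := (P : E →L[ℂ] E) -
    ∑ j : F, (innerSL ℂ (b j)).smulRight (P (b j) - u j)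
  have hT₀ : ∀ y, T₀ y = P y - ∑ j : F, b.repr y j • (P (b j) - u j) := by
    intro y
    simp [T₀, b.repr_apply_apply]
  have hΛT : ∀ y, Λ (T₀ y) = ∑ j : F, b.repr y j • v j := by
    intro y
    rw [hT₀, map_sub, map_sum, sub_eq_iff_eq_add, ← Finset.sum_add_distrib]
    have : ∀ j : F, b.repr y j • v j + Λ (b.repr y j • (P (b j) - u j)) =
        b.repr y j • Λ (P (b j)) := by
      intro j
      rw [map_smul, map_sub, hu1, smul_sub]
      abel
    simp only [this]
    funext i
    rw [hΛ, finCoord_apply, P.symm_apply_apply, ← hΛ, Finset.sum_apply]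
    simp [hΛb]
  -- Applying `Λ` to `T₀ y = 0` and using the independence of `v` kills the coefficients in `F`;
  -- what is left says `P y = 0`.
  have hTinj : LinearMap.ker (T₀ : E →ₗ[ℂ] E) = ⊥ := by
    refine (Submodule.eq_bot_iff _).2 fun y hy => ?_
    have hy' : T₀ y = 0 := hy
    have h1 := hΛT y
    rw [hy', map_zero] at h1
    have h2 : ∀ j : F, b.repr y j = 0 :=
      Fintype.linearIndependent_iff.1 v.linearIndependent _ h1.symm
    rw [hT₀] at hy'
    simpa [h2] using hy'
  have hTsurj : LinearMap.range (T₀ : E →ₗ[ℂ] E) = ⊤ := by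
    refine LinearMap.range_eq_top.2 fun y => ?_
    set c := v.repr (Λ y)
    have hc : Λ y = ∑ j : F, c j • v j := (v.sum_repr (Λ y)).symm
    -- After subtracting the combination of the `u j` with the same image under `Λ`, the remainder
    -- lies in the kernel of `Λ`, where `T₀` agrees with `P`.
    set a := P.symm (y - ∑ j : F, c j • u j) with ha
    have ha0 : ∀ j : F, b.repr a j = 0 := by
      intro j
      rw [ha, ← finCoord_apply b P F, ← hΛ, map_sub, map_sum, hc]
      simp [hu1]
    have hPa : P a = y - ∑ j : F, c j • u j := by rw [ha, P.apply_symm_apply]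
    refine ⟨a + ∑ j : F, c j • b j, ?_⟩
    have hr : ∀ i : F, b.repr (a + ∑ j : F, c j • b j) i = c i := by
      intro i
      rw [map_add, lp.coeFn_add, Pi.add_apply, ha0, zero_add, b.repr_apply_apply, inner_sum]
      simp [inner_smul_right, hb]
    change T₀ _ = _
    rw [hT₀]
    simp only [hr]
    rw [map_add, hPa, map_sum]
    simp only [map_smul, smul_sub, Finset.sum_sub_distrib]
    abel
  let T := ContinuousLinearEquiv.ofBijective T₀ hTinj hTsurj
  refine ⟨T, fun j => ?_⟩
  have hTj : T (b j) = T₀ (b j) := rfl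
  by_cases hj : j ∈ F
  · have : T₀ (b j) = u ⟨j, hj⟩ := by
      rw [hT₀, Finset.sum_eq_single ⟨j, hj⟩]
      · simp only [b.repr_apply_apply, hb, if_true, one_smul, sub_sub_cancel]
      · intro i _ hi
        have : ¬ (i : J) = j := fun h => hi (Subtype.ext h)
        simp only [b.repr_apply_apply, hb, this, if_false, zero_smul]
      · simp
    rw [hTj, this]
    exact hu2 ⟨j, hj⟩
  · have : T₀ (b j) = P (b j) := by
      rw [hT₀, Finset.sum_eq_zero, sub_zero]
      intro i _
      have : ¬ (i : J) = j := fun h => hj (h ▸ i.2)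
      simp only [b.repr_apply_apply, hb, this, if_false, zero_smul]
    refine ⟨κ j, h0 j hj, 1, ?_⟩
    rw [hTj, this, pow_one]
    simp [hR j hj]

end RootVectors

/-! ### The primitive of a square integrable function. -/

section Primitive

theorem integrableOn_coe_L2 (u : L2) : IntegrableOn u (Ioo (0 : ℝ) 1) :=
  (Lp.memLp u).integrable one_le_two

theorem isProbabilityMeasure_restrict_Ioo :
    IsProbabilityMeasure (volume.restrict (Ioo (0 : ℝ) 1)) :=
  ⟨by simp⟩

theorem integral_norm_le_norm (u : L2) : ∫ x in Ioo (0 : ℝ) 1, ‖u x‖ ≤ ‖u‖ := by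
  have := isProbabilityMeasure_restrict_Ioo
  rw [integral_norm_eq_lintegral_enorm (Lp.aestronglyMeasurable u), Lp.norm_def,
    ← eLpNorm_one_eq_lintegral_enorm]
  exact ENNReal.toReal_mono (Lp.eLpNorm_ne_top u)
    (eLpNorm_le_eLpNorm_of_exponent_le one_le_two (Lp.aestronglyMeasurable u))

theorem Ioo_subset_unit (x : unitInterval) : Ioo (0 : ℝ) x ⊆ Ioo 0 1 :=
  Ioo_subset_Ioo_right x.2.2

theorem norm_setIntegral_le (u : L2) (x : unitInterval) :
    ‖∫ t in Ioo (0 : ℝ) x, u t‖ ≤ ‖u‖ :=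
  (norm_integral_le_integral_norm _).trans <|
    (setIntegral_mono_set (integrableOn_coe_L2 u).norm
      (Filter.Eventually.of_forall fun _ => norm_nonneg _)
      (Ioo_subset_unit x).eventuallyLE).trans (integral_norm_le_norm u)

theorem continuous_setIntegral (u : L2) :
    Continuous fun x : unitInterval => ∫ t in Ioo (0 : ℝ) x, u t := by
  have h : IntegrableOn u (Icc (0 : ℝ) 1) :=
    (integrableOn_coe_L2 u).congr_set_ae Ioo_ae_eq_Icc.symm
  have := continuousOn_iff_continuous_domRestrict.1 (intervalIntegral.continuousOn_primitive h)
  refine this.congr fun x => ?_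
  rw [Set.domRestrict_apply, integral_Ioc_eq_integral_Ioo]

/-- The primitive `x ↦ ∫₀ˣ u` as a bounded operator from `L²(0,1)` to `C[0,1]`. -/
noncomputable def prim : L2 →L[ℂ] C(unitInterval, ℂ) :=
  LinearMap.mkContinuous
    { toFun := fun u => ⟨fun x => ∫ t in Ioo (0 : ℝ) x, u t, continuous_setIntegral u⟩
      map_add' := fun u v => by
        ext x
        change ∫ t in Ioo (0 : ℝ) x, (u + v : L2) t =
          (∫ t in Ioo (0 : ℝ) x, u t) + ∫ t in Ioo (0 : ℝ) x, v t
        rw [← integral_add ((integrableOn_coe_L2 u).mono_set (Ioo_subset_unit x))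
          ((integrableOn_coe_L2 v).mono_set (Ioo_subset_unit x))]
        exact integral_congr_ae
          (ae_restrict_of_ae_restrict_of_subset (Ioo_subset_unit x) (Lp.coeFn_add u v))
      map_smul' := fun c u => by
        ext x
        change ∫ t in Ioo (0 : ℝ) x, (c • u : L2) t = c • ∫ t in Ioo (0 : ℝ) x, u t
        rw [← integral_smul]
        exact integral_congr_ae
          (ae_restrict_of_ae_restrict_of_subset (Ioo_subset_unit x) (Lp.coeFn_smul c u)) }
    1 fun u => by
      rw [one_mul]
      exact (ContinuousMap.norm_le _ (norm_nonneg u)).2 (norm_setIntegral_le u)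

theorem prim_apply (u : L2) (x : unitInterval) : prim u x = ∫ t in Ioo (0 : ℝ) x, u t := rfl

theorem prim_zero_right (u : L2) : prim u 0 = 0 := by
  rw [prim_apply]
  simp

/-- Fubini on the triangle `t < x`: the inner integral of `φ'` over `(t,1)` equals `-φ(t)`, since
`φ(1) = 0`. -/
theorem hasWeakDeriv_prim (u : L2) : HasWeakDeriv (ext (prim u)) u := by
  intro φ h1 h2 h3
  set μ : Measure ℝ := volume.restrict (Ioo (0 : ℝ) 1) with hμ
  have hd : Continuous (deriv φ) := h1.continuous_deriv (by simp)
  have hφ1 : φ 1 = 0 := image_eq_zero_of_notMem_tsupport fun h => lt_irrefl _ (h3 h).2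
  have hdi : Integrable (deriv φ) μ :=
    (hd.integrable_of_hasCompactSupport h2.deriv).integrableOn
  set f : ℝ × ℝ → ℂ := {p : ℝ × ℝ | p.2 < p.1}.indicator fun p => deriv φ p.1 • u p.2 with hf
  have hfi : Integrable f (μ.prod μ) :=
    (hdi.smul_prod (integrableOn_coe_L2 u)).indicator
      (measurableSet_lt measurable_snd measurable_fst)
  have e1 : ∀ x ∈ Ioo (0 : ℝ) 1, deriv φ x • ext (prim u) x = ∫ t, f (x, t) ∂μ := by
    intro x hx
    have hx' : x ∈ unitInterval := ⟨hx.1.le, hx.2.le⟩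
    have : ext (prim u) x = ∫ t in Ioo (0 : ℝ) x, u t := by
      have := ext_apply (prim u) ⟨x, hx'⟩
      rw [prim_apply] at this
      exact this
    rw [this, ← integral_smul]
    have : (fun t => f (x, t)) = (Iio x).indicator fun t => deriv φ x • u t := by
      funext t
      by_cases ht : t < x <;> simp [hf, ht, indicator]
    rw [this, integral_indicator measurableSet_Iio, hμ, Measure.restrict_restrict measurableSet_Iio]
    congr 2
    ext t
    simp only [mem_inter_iff, mem_Ioo, mem_Iio]
    constructor
    · rintro ⟨a, b⟩
      exact ⟨b, a, b.trans hx.2⟩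
    · rintro ⟨a, b, -⟩
      exact ⟨b, a⟩
  have e2 : ∀ t ∈ Ioo (0 : ℝ) 1, ∫ x, f (x, t) ∂μ = -(φ t • u t) := by
    intro t ht
    have : (fun x => f (x, t)) = (Ioi t).indicator fun x => deriv φ x • u t := by
      funext x
      by_cases hx : t < x <;> simp [hf, hx, indicator]
    rw [this, integral_indicator measurableSet_Ioi, hμ, Measure.restrict_restrict measurableSet_Ioi,
      integral_smul_const]
    have hset : Ioi t ∩ Ioo (0 : ℝ) 1 = Ioo t 1 := by
      ext x
      simp only [mem_inter_iff, mem_Ioo, mem_Ioi]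
      constructor
      · rintro ⟨a, -, b⟩
        exact ⟨a, b⟩
      · rintro ⟨a, b⟩
        exact ⟨a, ht.1.trans a, b⟩
    rw [hset, ← integral_Ioc_eq_integral_Ioo, ← intervalIntegral.integral_of_le ht.2.le,
      intervalIntegral.integral_deriv_eq_sub
        (fun x _ => (h1.differentiable (by simp)).differentiableAt)
        (hd.intervalIntegrable _ _), hφ1, zero_sub, neg_smul]
  rw [setIntegral_congr_fun measurableSet_Ioo e1, integral_integral_swap (f := fun x t => f (x, t)) hfi,
    setIntegral_congr_fun measurableSet_Ioo e2, integral_neg]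

end Primitive

/-! ### Coordinates on `H¹(0,1)`: value at `0` and derivative. -/

section CoordinatesH1

theorem one_mem_H1 : ((1 : C(unitInterval, ℂ)), (0 : L2)) ∈ H1 := by
  intro φ h1 h2 h3
  have hd : Continuous (deriv φ) := h1.continuous_deriv (by simp)
  have hz : ∫ x in Ioo (0 : ℝ) 1, φ x • (0 : L2) x = 0 := by
    refine integral_eq_zero_of_ae ?_
    filter_upwards [Lp.coeFn_zero ℂ 2 (volume.restrict (Ioo (0 : ℝ) 1))] with x hx
    rw [hx]
    exact smul_zero _
  have hφ : ∀ x ∉ Ioo (0 : ℝ) 1, φ x = 0 := fun x hx =>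
    image_eq_zero_of_notMem_tsupport fun h => hx (h3 h)
  have hone : ∀ x, ext 1 x = 1 := fun x => rfl
  simp only [hone]
  rw [hz, integral_smul_const, ← integral_Ioc_eq_integral_Ioo,
    ← intervalIntegral.integral_of_le zero_le_one,
    intervalIntegral.integral_deriv_eq_sub
      (fun x _ => (h1.differentiable (by simp)).differentiableAt)
      (hd.intervalIntegrable _ _), hφ 1 (by simp), hφ 0 (by simp)]
  simp

/-- The element of `H¹(0,1)` with value `c` at `0` and derivative `u`. -/
noncomputable def H1.mk : ℂ × L2 →ₗ[ℂ] H1 :=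
  LinearMap.codRestrict H1
    ((((LinearMap.toSpanSingleton ℂ _ (1 : C(unitInterval, ℂ))) ∘ₗ LinearMap.fst ℂ ℂ L2) +
      prim.toLinearMap ∘ₗ LinearMap.snd ℂ ℂ L2).prod (LinearMap.snd ℂ ℂ L2)) <| by
    rintro ⟨c, u⟩
    have hp : (prim u, u) ∈ H1 := hasWeakDeriv_prim u
    have h := H1.add_mem (H1.smul_mem c one_mem_H1) hp
    convert h using 1
    simp

theorem H1.fn_mk (p : ℂ × L2) : H1.fn (H1.mk p) = p.1 • 1 + prim p.2 := rfl

theorem H1.der_mk (p : ℂ × L2) : H1.der (H1.mk p) = p.2 := rfl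

theorem H1.fn_mk_zero (p : ℂ × L2) : H1.fn (H1.mk p) 0 = p.1 := by
  rw [H1.fn_mk, ContinuousMap.add_apply, prim_zero_right]
  simp

theorem H1.eq_zero {f : H1} (h0 : H1.der f = 0) {x₀ : unitInterval} (h1 : H1.fn f x₀ = 0) :
    f = 0 := by
  obtain ⟨c, hc⟩ := apply_eq_of_weakDeriv_zero (H1.hasWeakDeriv f)
    (by rw [h0]; exact Lp.coeFn_zero ℂ 2 _)
  have hc0 : c = 0 := by
    rw [hc] at h1
    exact h1
  have hfn : H1.fn f = 0 := by
    rw [hc, hc0]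
    rfl
  exact Subtype.ext (Prod.ext hfn h0)

theorem H1.mk_eq (f : H1) : H1.mk (H1.fn f 0, H1.der f) = f := by
  rw [← sub_eq_zero]
  refine H1.eq_zero (x₀ := 0) ?_ ?_
  · rw [map_sub, H1.der_mk, sub_self]
  · rw [map_sub, ContinuousMap.sub_apply, H1.fn_mk_zero, sub_self]

theorem norm_contToL2_le (f : C(unitInterval, ℂ)) : ‖contToL2 f‖ ≤ 1 * ‖f‖ := by
  have := isProbabilityMeasure_restrict_Ioo
  have h := Lp.norm_le_of_ae_bound (f := contToL2 f) (norm_nonneg f) (by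
    filter_upwards [(memLp_ext f).coeFn_toLp] with x hx
    change ‖(memLp_ext f).toLp (ext f) x‖ ≤ _
    rw [hx]
    exact f.norm_coe_le_norm _)
  simpa [measureUnivNNReal] using h

/-- The bounded embedding `C[0,1] → L²(0,1)`. -/
noncomputable def contL : C(unitInterval, ℂ) →L[ℂ] L2 :=
  contToL2.mkContinuous 1 norm_contToL2_le

theorem H1.toL2_eq (f : H1) : H1.toL2 f = contL (H1.fn f) := rfl

end CoordinatesH1

/-! ### Coordinates on the state space and its completeness. -/

section CoordinatesH2

variable {β m : ℝ}

/-- Coordinates `(f(0), f', g, η)` of a state `(f, g, η)`. -/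
noncomputable def H2.coordₗ (β m : ℝ) : H2 β m ≃ₗ[ℂ] ℂ × L2 × L2 × ℂ where
  toFun y := (H1.fn (H2.pos y) 0, H1.der (H2.pos y), H2.vel y, H2.tip y)
  map_add' y z := by simp
  map_smul' c y := by simp
  invFun k := (H1.mk (k.1, k.2.1), k.2.2.1, k.2.2.2)
  left_inv y := H2.ext_iff'.2 ⟨H1.mk_eq (H2.pos y), rfl, rfl⟩
  right_inv k := Prod.ext (H1.fn_mk_zero _) rfl

variable [hβ : Fact (0 < β)] [hm : Fact (0 < m)]

theorem H2.inner_eq (y z : H2 β m) : inner ℂ y z =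
    inner ℂ (H1.der (H2.pos y)) (H1.der (H2.pos z)) + inner ℂ (H2.vel y) (H2.vel z)
    + (β : ℂ) * inner ℂ (H1.fn (H2.pos y) 0) (H1.fn (H2.pos z) 0)
    + inner ℂ (H2.tip y) (H2.tip z) / (m : ℂ) := rfl

theorem H2.norm_sq_eq (y : H2 β m) : ‖y‖ ^ 2 =
    ‖H1.der (H2.pos y)‖ ^ 2 + ‖H2.vel y‖ ^ 2 + β * ‖H1.fn (H2.pos y) 0‖ ^ 2
      + ‖H2.tip y‖ ^ 2 / m := by
  rw [← inner_self_eq_norm_sq (𝕜 := ℂ) y, H2.inner_eq]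
  simp only [RCLike.re_to_complex, Complex.add_re, Complex.re_ofReal_mul,
    Complex.div_ofReal_re, H2.re_inner_self]

theorem H2.exists_norm_coord_le (β m : ℝ) [hβ : Fact (0 < β)] [hm : Fact (0 < m)] :
    ∃ C : ℝ, ∀ y : H2 β m, ‖H2.coordₗ β m y‖ ≤ C * ‖y‖ := by
  have hβ' := hβ.out
  have hm' := hm.out
  refine ⟨1 + √(1 / β) + √m, fun y => ?_⟩
  have h := H2.norm_sq_eq y
  have p1 : 0 ≤ β * ‖H1.fn (H2.pos y) 0‖ ^ 2 := by positivity
  have p2 : 0 ≤ ‖H2.tip y‖ ^ 2 / m := by positivity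
  have p3 := sq_nonneg ‖H1.der (H2.pos y)‖
  have p4 := sq_nonneg ‖H2.vel y‖
  have n0 := norm_nonneg y
  have s1 := Real.sqrt_nonneg (1 / β)
  have s2 := Real.sqrt_nonneg m
  have b1 : ‖H1.der (H2.pos y)‖ ≤ ‖y‖ := abs_le_of_sq_le_sq' (by linarith) n0 |>.2
  have b2 : ‖H2.vel y‖ ≤ ‖y‖ := abs_le_of_sq_le_sq' (by linarith) n0 |>.2
  have b3 : ‖H1.fn (H2.pos y) 0‖ ≤ √(1 / β) * ‖y‖ := by
    refine abs_le_of_sq_le_sq' ?_ (by positivity) |>.2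
    rw [mul_pow, Real.sq_sqrt (by positivity), one_div, inv_mul_eq_div, le_div_iff₀ hβ']
    linarith
  have b4 : ‖H2.tip y‖ ≤ √m * ‖y‖ := by
    refine abs_le_of_sq_le_sq' ?_ (by positivity) |>.2
    rw [mul_pow, Real.sq_sqrt hm'.le, ← div_le_iff₀' hm']
    linarith
  have q1 := mul_nonneg s1 n0
  have q2 := mul_nonneg s2 n0
  change ‖((H1.fn (H2.pos y) 0, H1.der (H2.pos y), H2.vel y, H2.tip y) : ℂ × L2 × L2 × ℂ)‖ ≤ _
  simp only [norm_prod_le_iff]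
  refine ⟨?_, ?_, ?_, ?_⟩ <;> nlinarith

theorem H2.exists_norm_symm_le (β m : ℝ) [hβ : Fact (0 < β)] [hm : Fact (0 < m)] :
    ∃ C : ℝ, ∀ k, ‖(H2.coordₗ β m).symm k‖ ≤ C * ‖k‖ := by
  have hβ' := hβ.out
  have hm' := hm.out
  refine ⟨√(2 + β + 1 / m), fun k => ?_⟩
  refine abs_le_of_sq_le_sq' ?_ (by positivity) |>.2
  rw [H2.norm_sq_eq, mul_pow, Real.sq_sqrt (by positivity)]
  have e1 : H1.fn (H2.pos ((H2.coordₗ β m).symm k)) 0 = k.1 := H1.fn_mk_zero _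
  have e2 : H1.der (H2.pos ((H2.coordₗ β m).symm k)) = k.2.1 := rfl
  have e3 : H2.vel ((H2.coordₗ β m).symm k) = k.2.2.1 := rfl
  have e4 : H2.tip ((H2.coordₗ β m).symm k) = k.2.2.2 := rfl
  rw [e1, e2, e3, e4]
  have h1 : ‖k.1‖ ≤ ‖k‖ := norm_fst_le k
  have h2 : ‖k.2.1‖ ≤ ‖k‖ := (norm_fst_le k.2).trans (norm_snd_le k)
  have h3 : ‖k.2.2.1‖ ≤ ‖k‖ := (norm_fst_le k.2.2).trans ((norm_snd_le k.2).trans (norm_snd_le k))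
  have h4 : ‖k.2.2.2‖ ≤ ‖k‖ := (norm_snd_le k.2.2).trans ((norm_snd_le k.2).trans (norm_snd_le k))
  have : (2 + β + 1 / m) * ‖k‖ ^ 2 = ‖k‖ ^ 2 + ‖k‖ ^ 2 + β * ‖k‖ ^ 2 + ‖k‖ ^ 2 / m := by ring
  rw [this]
  gcongr

/-- The coordinates `(f(0), f', g, η)` identify the state space, as a topological vector space,
with `ℂ × L² × L² × ℂ`. -/
noncomputable def H2.coord (β m : ℝ) [Fact (0 < β)] [Fact (0 < m)] :
    H2 β m ≃L[ℂ] ℂ × L2 × L2 × ℂ :=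
  (H2.coordₗ β m).toContinuousLinearEquivOfBounds (H2.exists_norm_coord_le β m).choose
    (H2.exists_norm_symm_le β m).choose (H2.exists_norm_coord_le β m).choose_spec
    (H2.exists_norm_symm_le β m).choose_spec

theorem H2.coord_apply (y : H2 β m) : H2.coord β m y =
    (H1.fn (H2.pos y) 0, H1.der (H2.pos y), H2.vel y, H2.tip y) := rfl

theorem H2.pos_coord_symm (k : ℂ × L2 × L2 × ℂ) :
    H2.pos ((H2.coord β m).symm k) = H1.mk (k.1, k.2.1) := rfl

theorem H2.vel_coord_symm (k : ℂ × L2 × L2 × ℂ) : H2.vel ((H2.coord β m).symm k) = k.2.2.1 := rfl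

theorem H2.tip_coord_symm (k : ℂ × L2 × L2 × ℂ) : H2.tip ((H2.coord β m).symm k) = k.2.2.2 := rfl

/-- The energy norm is equivalent, through the coordinates, to the product norm on `ℂ × L² × L² ×
ℂ`. -/
theorem H2.completeSpace : CompleteSpace (H2 β m) :=
  (completeSpace_congr (e := (H2.coord β m).toEquiv)
    (H2.coord β m).isUniformEmbedding).2 inferInstance

end CoordinatesH2

/-! ### Smooth elements of `H¹(0,1)`, first-order equations, density. -/

section ClassicalFunctions

/-- The restriction to `[0,1]` of a continuous function on `ℝ`. -/
def restr (F : ℝ → ℂ) (hF : Continuous F) : C(unitInterval, ℂ) :=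
  ⟨fun x => F x, hF.comp continuous_subtype_val⟩

theorem restr_apply (F : ℝ → ℂ) (hF : Continuous F) (x : unitInterval) : restr F hF x = F x := rfl

theorem ext_restr {F : ℝ → ℂ} (hF : Continuous F) {x : ℝ} (hx : x ∈ Icc (0 : ℝ) 1) :
    ext (restr F hF) x = F x :=
  ext_apply (restr F hF) ⟨x, hx⟩

theorem coeFn_contL (q : C(unitInterval, ℂ)) :
    contL q =ᵐ[volume.restrict (Ioo (0 : ℝ) 1)] ext q :=
  (memLp_ext q).coeFn_toLp

theorem prim_contL (q : C(unitInterval, ℂ)) (x : unitInterval) :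
    prim (contL q) x = ∫ t in (0 : ℝ)..x, ext q t := by
  rw [prim_apply, intervalIntegral.integral_of_le x.2.1, integral_Ioc_eq_integral_Ioo]
  exact integral_congr_ae
    (ae_restrict_of_ae_restrict_of_subset (Ioo_subset_unit x) (coeFn_contL q))

/-- The element of `H¹(0,1)` given by a continuously differentiable function. -/
noncomputable def H1.ofC1 (F F' : ℝ → ℂ) (hF' : Continuous F') : H1 :=
  H1.mk (F 0, contL (restr F' hF'))

theorem H1.der_ofC1 (F F' : ℝ → ℂ) (hF' : Continuous F') :
    H1.der (H1.ofC1 F F' hF') = contL (restr F' hF') := rfl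

theorem H1.fn_ofC1 {F F' : ℝ → ℂ} (hF' : Continuous F') (hF : ∀ x, HasDerivAt F (F' x) x)
    (x : unitInterval) : H1.fn (H1.ofC1 F F' hF') x = F x := by
  have h : ∫ t in (0 : ℝ)..x, ext (restr F' hF') t = F x - F 0 := by
    rw [← intervalIntegral.integral_eq_sub_of_hasDerivAt (fun t _ => hF t)
      (hF'.intervalIntegrable _ _)]
    refine intervalIntegral.integral_congr fun t ht => ?_
    rw [uIcc_of_le x.2.1] at ht
    exact ext_restr hF' ⟨ht.1, ht.2.trans x.2.2⟩
  rw [H1.ofC1, H1.fn_mk, ContinuousMap.add_apply, prim_contL, h]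
  simp

theorem H1.fn_ofC1_eq {F F' : ℝ → ℂ} (hF' : Continuous F') (hF : ∀ x, HasDerivAt F (F' x) x)
    (hc : Continuous F) : H1.fn (H1.ofC1 F F' hF') = restr F hc :=
  ContinuousMap.ext fun x => H1.fn_ofC1 hF' hF x

theorem H1.fn_injective {p q : H1} (h : H1.fn p = H1.fn q) : p = q :=
  H1.toL2_injective (congrArg contToL2 h)

/-- An `H¹` solution of `p' = c p` is an exponential function. -/
theorem H1.fn_eq_exp {p : H1} {c : ℂ} (hp : H1.der p = c • H1.toL2 p) (x : unitInterval) :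
    H1.fn p x = H1.fn p 0 * Complex.exp (c * (x : ℝ)) := by
  set q := H1.fn p with hq
  have hcq : Continuous (ext q) := continuous_ext q
  -- The integrated equation: `G` is differentiable on all of `ℝ` and agrees with `q` on `[0,1]`,
  -- which makes `G e^{-ct}` constant there.
  set G : ℝ → ℂ := fun t => q 0 + c * ∫ s in (0 : ℝ)..t, ext q s with hG
  have hGd : ∀ t, HasDerivAt G (c * ext q t) t := fun t =>
    ((intervalIntegral.integral_hasDerivAt_right (hcq.intervalIntegrable _ _)
      hcq.stronglyMeasurable.stronglyMeasurableAtFilter hcq.continuousAt).const_mul c).const_add _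
  have hGq : ∀ t ∈ Icc (0 : ℝ) 1, ext q t = G t := by
    intro t ht
    have h1 : q = q 0 • 1 + c • prim (contL q) := by
      have := congrArg H1.fn (H1.mk_eq p)
      rw [H1.fn_mk, hp, H1.toL2_eq] at this
      rw [← map_smul]
      exact this.symm
    have h2 := ext_apply q ⟨t, ht⟩
    have h3 := DFunLike.congr_fun h1 (⟨t, ht⟩ : unitInterval)
    rw [ContinuousMap.add_apply, ContinuousMap.smul_apply, ContinuousMap.smul_apply,
      prim_contL] at h3
    simp only [ContinuousMap.one_apply, smul_eq_mul, mul_one] at h3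
    exact h2.trans h3
  have hd : ∀ t ∈ Ico (0 : ℝ) 1,
      HasDerivWithinAt (fun t : ℝ => G t * Complex.exp (-(c * t))) 0 (Ici t) t := by
    intro t ht
    have h1 : HasDerivAt (fun t : ℝ => Complex.exp (-(c * t)))
        (Complex.exp (-(c * t)) * -(c * 1)) t :=
      ((((hasDerivAt_id (t : ℂ)).const_mul c).neg).cexp).comp_ofReal
    have h2 := (hGd t).mul h1
    have h3 : c * ext q t * Complex.exp (-(c * t)) + G t * (Complex.exp (-(c * t)) * -(c * 1))
        = 0 := by
      rw [hGq t ⟨ht.1, ht.2.le⟩]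
      ring
    rw [h3] at h2
    exact h2.hasDerivWithinAt
  have hcont : ContinuousOn (fun t : ℝ => G t * Complex.exp (-(c * t))) (Icc 0 1) := by
    have : Continuous G := continuous_iff_continuousAt.2 fun t => (hGd t).continuousAt
    fun_prop
  have h := constant_of_has_deriv_right_zero hcont hd x x.2
  have h4 : q x = G x := (ext_apply q x).symm.trans (hGq x x.2)
  have h0 : G 0 = q 0 := by simp [hG]
  simp only [h0, Complex.ofReal_zero, mul_zero, neg_zero, Complex.exp_zero, mul_one] at h
  rw [h4, ← h, mul_assoc, ← Complex.exp_add, neg_add_cancel, Complex.exp_zero, mul_one]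

/-- The elements `(v, v(x₀))` with `v ∈ H¹(0,1)`, `x₀ ∈ {0, 1}`, are total in `L² × ℂ`. -/
theorem eq_zero_of_orthogonal_H1 {x₀ : unitInterval} (hx₀ : (x₀ : ℝ) ∉ Ioo (0 : ℝ) 1) {u : L2}
    {c : ℂ} (h : ∀ v : H1, inner ℂ (H1.toL2 v) u + inner ℂ (H1.fn v x₀) c = 0) :
    u = 0 ∧ c = 0 := by
  have hu : u = 0 := by
    have key : ∀ᵐ x ∂(volume : Measure ℝ), x ∈ Ioo (0 : ℝ) 1 → u x = 0 := by
      refine IsOpen.ae_eq_zero_of_integral_contDiff_smul_eq_zero isOpen_Ioo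
        (integrableOn_coe_L2 u).locallyIntegrableOn ?_
      intro g g1 g2 g3
      have hz : ∀ x ∉ Ioo (0 : ℝ) 1, g x = 0 := fun x hx =>
        image_eq_zero_of_notMem_tsupport fun h' => hx (g3 h')
      have hd : Continuous fun x => ((deriv g x : ℝ) : ℂ) :=
        Complex.continuous_ofReal.comp (g1.continuous_deriv (by simp))
      have hgd : ∀ x, HasDerivAt (fun x => ((g x : ℝ) : ℂ)) ((deriv g x : ℝ) : ℂ) x := fun x =>
        ((g1.differentiable (by simp)).differentiableAt.hasDerivAt).ofReal_comp
      have hgc : Continuous fun x => ((g x : ℝ) : ℂ) :=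
        Complex.continuous_ofReal.comp g1.continuous
      -- A test function vanishes at `x₀`, so only the `L²` term survives; the constant function `1`
      -- then gives `c = 0`.
      have hv := h (H1.ofC1 (fun x => ((g x : ℝ) : ℂ)) _ hd)
      rw [H1.toL2_eq, H1.fn_ofC1 hd hgd, hz _ hx₀, H1.fn_ofC1_eq hd hgd hgc] at hv
      simp only [Complex.ofReal_zero, inner_zero_left, add_zero] at hv
      rw [L2.inner_def] at hv
      rw [← setIntegral_eq_integral_of_forall_compl_eq_zero (s := Ioo (0 : ℝ) 1)
        (fun x hx => by rw [hz x hx, zero_smul]), ← hv]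
      refine integral_congr_ae ?_
      filter_upwards [coeFn_contL (restr _ hgc), ae_restrict_mem measurableSet_Ioo] with x hx hx'
      rw [hx, ext_restr hgc ⟨hx'.1.le, hx'.2.le⟩]
      simp [mul_comm]
    refine Lp.ext ?_
    have : ∀ᵐ x ∂(volume.restrict (Ioo (0 : ℝ) 1)), u x = 0 :=
      (ae_restrict_iff' measurableSet_Ioo).2 key
    filter_upwards [this, Lp.coeFn_zero ℂ 2 (volume.restrict (Ioo (0 : ℝ) 1))] with x h1 h2
    rw [h1, h2]
    rfl
  refine ⟨hu, ?_⟩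
  have h1 := h (H1.mk (1, 0))
  rw [hu, inner_zero_right, zero_add, H1.fn_mk] at h1
  simpa using h1

end ClassicalFunctions

/-! ### The bounded inverse of `A₂`. -/

section Resolvent

variable {m β γ : ℝ}

theorem mem_A2Graph_iff {y z : H2 β m} :
    (y, z) ∈ A2Graph m β γ ↔ ∃ h : y ∈ (A2 m β γ).domain, A2 m β γ ⟨y, h⟩ = z := by
  rw [← A2_graph, LinearPMap.mem_graph_iff]
  constructor
  · rintro ⟨⟨y', h⟩, rfl, h2⟩
    exact ⟨h, h2⟩
  · rintro ⟨h, h2⟩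
    exact ⟨⟨y, h⟩, rfl, h2⟩

theorem inEigenspace_iff {μ : ℂ} {y : H2 β m} :
    InEigenspace (A2 m β γ) μ y ↔ (y, μ • y) ∈ A2Graph m β γ :=
  mem_A2Graph_iff.symm

/-- From `g = 0`, `f'' = 0` and `f'(1) = 0` follows `f' = 0`; the condition at `0` is then `β f(0) =
0`. -/
theorem eq_zero_of_mem_A2Graph_zero (hβ : β ≠ 0) {y : H2 β m} (h : (y, 0) ∈ A2Graph m β γ) :
    y = 0 := by
  obtain ⟨h1, h2, v, h3, h4, h5, h6⟩ := h
  simp only [map_zero, ContinuousMap.zero_apply, mul_zero, zero_add, neg_eq_zero] at h1 h2 h4 h5 h6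
  have hv : v = 0 := H1.eq_zero h4 h5
  subst hv
  simp only [map_zero] at h3 h6
  have h7 : H1.fn (H2.pos y) 0 = 0 := by
    have := h6.symm
    simpa [hβ] using this
  exact H2.ext_iff'.2 ⟨(H1.eq_zero h3.symm h7).trans (map_zero _).symm,
    h1.symm.trans (map_zero _).symm, h2.trans (map_zero _).symm⟩

/-- The inverse of `A₂` in the coordinates `(f(0), f', g, η)`. -/
noncomputable def invCoord (m β γ : ℝ) : (ℂ × L2 × L2 × ℂ) →L[ℂ] (ℂ × L2 × L2 × ℂ) :=
  let F : (ℂ × L2 × L2 × ℂ) →L[ℂ] C(unitInterval, ℂ) :=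
    (ContinuousLinearMap.toSpanSingleton ℂ (1 : C(unitInterval, ℂ))).comp
      (ContinuousLinearMap.fst ℂ _ _) +
    prim.comp ((ContinuousLinearMap.fst ℂ _ _).comp (ContinuousLinearMap.snd ℂ _ _))
  let g : (ℂ × L2 × L2 × ℂ) →L[ℂ] L2 := (ContinuousLinearMap.fst ℂ _ _).comp
    ((ContinuousLinearMap.snd ℂ _ _).comp (ContinuousLinearMap.snd ℂ _ _))
  let ξ : (ℂ × L2 × L2 × ℂ) →L[ℂ] ℂ := (ContinuousLinearMap.snd ℂ _ _).comp
    ((ContinuousLinearMap.snd ℂ _ _).comp (ContinuousLinearMap.snd ℂ _ _))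
  let ev : unitInterval → C(unitInterval, ℂ) →L[ℂ] ℂ := fun x => ContinuousMap.evalCLM ℂ x
  -- The unknown derivative is `v = v₀ + ∫₀ˣ g`, with `v₀` fixed by `-v(1) = ξ`. The boundary
  -- condition at `0` then yields `f(0) = (v₀ - γ F(0)) / β`.
  let v₀ : (ℂ × L2 × L2 × ℂ) →L[ℂ] ℂ := -ξ - (ev 1).comp (prim.comp g)
  let v : (ℂ × L2 × L2 × ℂ) →L[ℂ] C(unitInterval, ℂ) :=
    (ContinuousLinearMap.toSpanSingleton ℂ (1 : C(unitInterval, ℂ))).comp v₀ + prim.comp g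
  ((β : ℂ)⁻¹ • (v₀ - (γ : ℂ) • (ContinuousLinearMap.fst ℂ _ _))).prod <|
    (contL.comp v).prod <| (contL.comp F).prod ((m : ℂ) • (ev 1).comp F)

variable [hβ : Fact (0 < β)] [hm : Fact (0 < m)]

/-- The bounded inverse of `A₂`. -/
noncomputable def A2inv (m β γ : ℝ) [Fact (0 < β)] [Fact (0 < m)] : H2 β m →L[ℂ] H2 β m :=
  ((H2.coord β m).symm : _ →L[ℂ] H2 β m).comp
    ((invCoord m β γ).comp (H2.coord β m : H2 β m →L[ℂ] _))

theorem A2inv_mem (z : H2 β m) : (A2inv m β γ z, z) ∈ A2Graph m β γ := by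
  have hβ0 : (β : ℂ) ≠ 0 := Complex.ofReal_ne_zero.2 hβ.out.ne'
  set F := H2.pos z with hF
  have eF : H1.fn F 0 • (1 : C(unitInterval, ℂ)) + prim (H1.der F) = H1.fn F := by
    have := congrArg H1.fn (H1.mk_eq F)
    rwa [H1.fn_mk] at this
  set v₀ : ℂ := -(H2.tip z) - prim (H2.vel z) 1 with hv₀
  set v : H1 := H1.mk (v₀, H2.vel z) with hv
  have e : A2inv m β γ z = (H2.coord β m).symm
      ((β : ℂ)⁻¹ • (v₀ - (γ : ℂ) • H1.fn F 0),
        contL (v₀ • (1 : C(unitInterval, ℂ)) + prim (H2.vel z)),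
        contL (H1.fn F 0 • (1 : C(unitInterval, ℂ)) + prim (H1.der F)),
        (m : ℂ) • (H1.fn F 0 • (1 : C(unitInterval, ℂ)) + prim (H1.der F)) 1) := rfl
  rw [eF] at e
  refine ⟨?_, ?_, v, ?_, ?_, ?_, ?_⟩
  · rw [e]
    rfl
  · rw [e]
    rfl
  · rw [e]
    rfl
  · rfl
  · rw [hv, H1.fn_mk, ContinuousMap.add_apply]
    simp [hv₀]
  · simp only [e, H2.pos_coord_symm, H1.fn_mk_zero, hv, smul_eq_mul]
    field_simp
    ring

theorem A2inv_eq {y z : H2 β m} (h : (y, z) ∈ A2Graph m β γ) : A2inv m β γ z = y := by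
  have h1 := (A2Graph m β γ).sub_mem h (A2inv_mem (γ := γ) z)
  rw [Prod.mk_sub_mk, sub_self] at h1
  exact (sub_eq_zero.1 (eq_zero_of_mem_A2Graph_zero hβ.out.ne' h1)).symm

theorem A2inv_injective : Function.Injective (A2inv m β γ) := by
  intro z w h
  have h1 := (A2Graph m β γ).sub_mem (A2inv_mem (γ := γ) z) (A2inv_mem (γ := γ) w)
  rw [Prod.mk_sub_mk, h, sub_self] at h1
  exact sub_eq_zero.1 (A2Graph_single_valued m β γ _ h1 rfl)

/-- The domain of `A₂` is dense. -/
theorem denseRange_A2inv (hγ : γ ≠ 0) : DenseRange (A2inv m β γ) := by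
  have := H2.completeSpace (β := β) (m := m)
  have hm' : (m : ℂ) ≠ 0 := Complex.ofReal_ne_zero.2 hm.out.ne'
  have hβ' : (β : ℂ) ≠ 0 := Complex.ofReal_ne_zero.2 hβ.out.ne'
  have hγ' : (γ : ℂ) ≠ 0 := Complex.ofReal_ne_zero.2 hγ
  suffices h : (LinearMap.range (A2inv m β γ).toLinearMap)ᗮ = ⊥ by
    have h2 := (Submodule.topologicalClosure_eq_top_iff).2 h
    intro y
    have : y ∈ (LinearMap.range (A2inv m β γ).toLinearMap).topologicalClosure := by
      rw [h2]
      trivial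
    exact this
  refine (Submodule.eq_bot_iff _).2 fun y hy => ?_
  -- Any `v` and `F` in `H¹` occur as derivative and velocity of an element of the domain, since the
  -- boundary conditions only prescribe `f(0)` and `η`. The weights `β` and `1/m` of the inner
  -- product cancel.
  have key : ∀ v F : H1, inner ℂ (H1.toL2 v) (H1.der (H2.pos y)) +
      inner ℂ (H1.toL2 F) (H2.vel y) +
      inner ℂ (H1.fn v 0 - γ * H1.fn F 0) (H1.fn (H2.pos y) 0) +
      inner ℂ (H1.fn F 1) (H2.tip y) = 0 := by
    intro v F
    set w : H2 β m := (H2.coord β m).symm ((β : ℂ)⁻¹ * (H1.fn v 0 - γ * H1.fn F 0), H1.toL2 v,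
      H1.toL2 F, m * H1.fn F 1) with hw
    set z : H2 β m := (H2.coord β m).symm (H1.fn F 0, H1.der F, H1.der v, -(H1.fn v 1)) with hz
    have hzp : H2.pos z = F := H1.mk_eq F
    have hmem : (w, z) ∈ A2Graph m β γ := by
      refine ⟨by rw [hzp]; rfl, by rw [hzp]; rfl, v, rfl, rfl, rfl, ?_⟩
      simp only [hzp, hw, H2.pos_coord_symm, H1.fn_mk_zero]
      field_simp
      ring
    have h0 := hy w ⟨z, A2inv_eq hmem⟩
    rw [H2.inner_eq, hw, H2.pos_coord_symm, H1.fn_mk_zero, H1.der_mk, H2.vel_coord_symm,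
      H2.tip_coord_symm] at h0
    rw [← h0]
    simp only [RCLike.inner_apply, map_mul, map_inv₀, Complex.conj_ofReal]
    field_simp
  have h1 := eq_zero_of_orthogonal_H1 (x₀ := 0) (by simp) (u := H1.der (H2.pos y))
    (c := H1.fn (H2.pos y) 0) (fun v => by simpa using key v 0)
  have h2 := eq_zero_of_orthogonal_H1 (x₀ := 1) (by simp) (u := H2.vel y)
    (c := H2.tip y) (fun F => by simpa [h1.1, h1.2] using key 0 F)
  exact H2.ext_iff'.2 ⟨by rw [H1.eq_zero h1.1 h1.2, map_zero], by rw [h2.1, map_zero],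
    by rw [h2.2, map_zero]⟩

/-- Expanding `(R - z)^(k+1) y = 0` exhibits a nonzero multiple of `y` in the range of `R`, so `y`
lies in the domain of `A₂`. With `w = A₂ y` one has `w - z⁻¹ y = -z⁻¹ (R - z) w`, and injectivity of
`R` transfers the vanishing from `y = R w` to `w`. -/
theorem inKerPow_of_A2inv {z : ℂ} (hz : z ≠ 0) (k : ℕ) :
    ∀ y : H2 β m, ((A2inv m β γ - z • 1) ^ k) y = 0 → InKerPow (A2 m β γ) z⁻¹ k y := by
  set R := A2inv m β γ with hR
  induction k with
  | zero => exact fun y hy => hy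
  | succ k ih =>
    intro y hy
    have hrange : ∀ k : ℕ, ∃ u, ((R - z • 1) ^ k) y - (-z) ^ k • y = R u := by
      intro k
      induction k with
      | zero => exact ⟨0, by simp⟩
      | succ k ihk =>
        obtain ⟨u, hu⟩ := ihk
        refine ⟨((R - z • 1) ^ k) y - z • u, ?_⟩
        rw [pow_succ', clm_mul_apply, pow_succ', map_sub, map_smul, ← hu]
        simp only [sub_apply, smul_apply, one_apply_eq_self]
        module
    obtain ⟨u, hu⟩ := hrange (k + 1)
    have hzk : (-z) ^ (k + 1) ≠ 0 := pow_ne_zero _ (neg_ne_zero.2 hz)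
    set w := -((-z) ^ (k + 1))⁻¹ • u with hw
    have hy2 : y = R w := by
      rw [hy, zero_sub] at hu
      rw [hw, map_smul, ← hu, neg_smul_neg, smul_smul, inv_mul_cancel₀ hzk, one_smul]
    have hmem : (y, w) ∈ A2Graph m β γ := by
      rw [hy2]
      exact A2inv_mem w
    obtain ⟨hd, hA⟩ := mem_A2Graph_iff.1 hmem
    refine ⟨hd, ?_⟩
    rw [hA]
    apply ih
    have e1 : w - z⁻¹ • y = -z⁻¹ • (R - z • 1) w := by
      rw [sub_apply, smul_apply, one_apply_eq_self, ← hy2, smul_sub, neg_smul,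
        neg_smul, smul_smul, inv_mul_cancel₀ hz, one_smul]
      abel
    rw [e1, map_smul, ← clm_mul_apply, ← pow_succ]
    have hcomm : R * (R - z • 1) ^ (k + 1) = (R - z • 1) ^ (k + 1) * R := by
      refine (Commute.pow_right ?_ _).eq
      refine ContinuousLinearMap.ext fun y => ?_
      simp
    have e2 : R (((R - z • 1) ^ (k + 1)) w) = 0 := by
      rw [← clm_mul_apply, hcomm, clm_mul_apply, ← hy2, hy]
    rw [A2inv_injective (γ := γ) (e2.trans (map_zero _).symm), smul_zero]

end Resolvent

/-! ### Eigenvectors and the characteristic equation. -/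

section Eigenvectors

/-- The derivative of `eigFun`, divided by `μ`. -/
noncomputable def eigFunD (β γ : ℝ) (μ : ℂ) (x : ℝ) : ℂ :=
  ((1 + γ) * μ + β) * Complex.exp (μ * x) - ((1 - γ) * μ - β) * Complex.exp (-(μ * x))

/-- The characteristic function, whose zeros are the eigenvalues. -/
noncomputable def charFun (m β γ : ℝ) (μ : ℂ) : ℂ :=
  ((1 + γ) * μ + β) * (1 + m * μ) * Complex.exp μ -
    ((1 - γ) * μ - β) * (1 - m * μ) * Complex.exp (-μ)

variable {m β γ : ℝ} {μ : ℂ}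

theorem hasDerivAt_exp_mul (c : ℂ) (x : ℝ) :
    HasDerivAt (fun x : ℝ => Complex.exp (c * x)) (Complex.exp (c * x) * (c * 1)) x :=
  (((hasDerivAt_id (x : ℂ)).const_mul c).cexp).comp_ofReal

theorem hasDerivAt_exp_neg_mul (c : ℂ) (x : ℝ) :
    HasDerivAt (fun x : ℝ => Complex.exp (-(c * x))) (Complex.exp (-(c * x)) * -(c * 1)) x :=
  ((((hasDerivAt_id (x : ℂ)).const_mul c).neg).cexp).comp_ofReal

theorem hasDerivAt_eigFun (β γ : ℝ) (μ : ℂ) (x : ℝ) :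
    HasDerivAt (eigFun β γ μ) (μ * eigFunD β γ μ x) x := by
  refine (((hasDerivAt_exp_mul μ x).const_mul ((1 + γ) * μ + β : ℂ)).add
    ((hasDerivAt_exp_neg_mul μ x).const_mul ((1 - γ) * μ - β : ℂ))).congr_deriv ?_
  rw [eigFunD]
  ring

theorem hasDerivAt_eigFunD (β γ : ℝ) (μ : ℂ) (x : ℝ) :
    HasDerivAt (eigFunD β γ μ) (μ * eigFun β γ μ x) x := by
  refine (((hasDerivAt_exp_mul μ x).const_mul ((1 + γ) * μ + β : ℂ)).sub
    ((hasDerivAt_exp_neg_mul μ x).const_mul ((1 - γ) * μ - β : ℂ))).congr_deriv ?_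
  rw [eigFun]
  ring

theorem continuous_eigFun (β γ : ℝ) (μ : ℂ) : Continuous (eigFun β γ μ) :=
  continuous_iff_continuousAt.2 fun x => (hasDerivAt_eigFun β γ μ x).continuousAt

theorem continuous_eigFunD (β γ : ℝ) (μ : ℂ) : Continuous (eigFunD β γ μ) :=
  continuous_iff_continuousAt.2 fun x => (hasDerivAt_eigFunD β γ μ x).continuousAt

theorem eigFun_zero (β γ : ℝ) (μ : ℂ) : eigFun β γ μ 0 = 2 * μ := by
  simp only [eigFun, Complex.ofReal_zero, mul_zero, neg_zero, Complex.exp_zero]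
  ring

theorem eigFunD_zero (β γ : ℝ) (μ : ℂ) : eigFunD β γ μ 0 = 2 * (γ * μ + β) := by
  simp only [eigFunD, Complex.ofReal_zero, mul_zero, neg_zero, Complex.exp_zero]
  ring

/-- Since `f' = μ · eigFunD` and `η = m μ f(1)`, this is the remaining condition `-f'(1) = μ η` up
to the factor `-μ`. -/
theorem charFun_eq (m β γ : ℝ) (μ : ℂ) :
    charFun m β γ μ = eigFunD β γ μ 1 + m * μ * eigFun β γ μ 1 := by
  simp only [charFun, eigFunD, eigFun, Complex.ofReal_one, mul_one]
  ring

/-- Serves twice: `0` is not a zero of `charFun`, and `charFun` is not identically zero. -/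
theorem charFun_zero (hβ : β ≠ 0) : charFun m β γ 0 ≠ 0 := by
  have : charFun m β γ 0 = 2 * β := by
    simp only [charFun, mul_zero, neg_zero, Complex.exp_zero]
    ring
  rw [this]
  simpa using hβ

/-- The element of `H¹(0,1)` given by `eigFun`. -/
noncomputable def eigPos (β γ : ℝ) (μ : ℂ) : H1 :=
  H1.ofC1 (eigFun β γ μ) (fun x => μ * eigFunD β γ μ x)
    (continuous_const.mul (continuous_eigFunD β γ μ))

theorem fn_eigPos (β γ : ℝ) (μ : ℂ) (x : unitInterval) :
    H1.fn (eigPos β γ μ) x = eigFun β γ μ x :=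
  H1.fn_ofC1 _ (hasDerivAt_eigFun β γ μ) x

theorem der_eigPos (β γ : ℝ) (μ : ℂ) : H1.der (eigPos β γ μ) =
    μ • contL (restr (eigFunD β γ μ) (continuous_eigFunD β γ μ)) := by
  rw [eigPos, H1.der_ofC1, ← map_smul]
  rfl

theorem toL2_eigPos (β γ : ℝ) (μ : ℂ) : H1.toL2 (eigPos β γ μ) =
    contL (restr (eigFun β γ μ) (continuous_eigFun β γ μ)) := by
  rw [H1.toL2_eq, eigPos, H1.fn_ofC1_eq _ (hasDerivAt_eigFun β γ μ) (continuous_eigFun β γ μ)]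

/-- The candidate eigenvector `(f_μ, μ f_μ, m μ f_μ(1))`. -/
noncomputable def eigVec (m β γ : ℝ) (μ : ℂ) : H2 β m :=
  (eigPos β γ μ, μ • H1.toL2 (eigPos β γ μ), m * μ * eigFun β γ μ 1)

theorem pos_eigVec : H2.pos (eigVec m β γ μ) = eigPos β γ μ := rfl

theorem vel_eigVec : H2.vel (eigVec m β γ μ) = μ • H1.toL2 (eigPos β γ μ) := rfl

theorem tip_eigVec : H2.tip (eigVec m β γ μ) = m * μ * eigFun β γ μ 1 := rfl

theorem eigVec_ne_zero (hμ : μ ≠ 0) : eigVec m β γ μ ≠ 0 := by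
  intro h
  have h1 : H1.fn (H2.pos (eigVec m β γ μ)) 0 = 0 := by
    rw [h]
    simp
  rw [pos_eigVec, fn_eigPos] at h1
  simp [eigFun_zero, hμ] at h1

theorem eigVec_mem (h : charFun m β γ μ = 0) :
    (eigVec m β γ μ, μ • eigVec m β γ μ) ∈ A2Graph m β γ := by
  set v := H1.ofC1 (eigFunD β γ μ) (fun x => μ * eigFun β γ μ x)
    (continuous_const.mul (continuous_eigFun β γ μ)) with hv
  have hfv : ∀ x : unitInterval, H1.fn v x = eigFunD β γ μ x :=
    H1.fn_ofC1 _ (hasDerivAt_eigFunD β γ μ)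
  have h1 : H1.toL2 v = contL (restr (eigFunD β γ μ) (continuous_eigFunD β γ μ)) := by
    rw [H1.toL2_eq, hv, H1.fn_ofC1_eq _ (hasDerivAt_eigFunD β γ μ) (continuous_eigFunD β γ μ)]
  have h2 : H1.der v = μ • H1.toL2 (eigPos β γ μ) := by
    rw [toL2_eigPos, hv, H1.der_ofC1, ← map_smul]
    rfl
  rw [charFun_eq] at h
  refine ⟨?_, ?_, μ • v, ?_, ?_, ?_, ?_⟩
  · simp only [map_smul, pos_eigVec, vel_eigVec]
  · simp only [map_smul, pos_eigVec, tip_eigVec, ContinuousMap.smul_apply, fn_eigPos,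
      Icc.coe_one, smul_eq_mul]
    ring
  · simp only [map_smul, pos_eigVec, der_eigPos, h1]
  · simp only [map_smul, vel_eigVec, h2]
  · simp only [map_smul, tip_eigVec, ContinuousMap.smul_apply, hfv, Icc.coe_one,
      smul_eq_mul]
    linear_combination -μ * h
  · simp only [map_smul, pos_eigVec, ContinuousMap.smul_apply, fn_eigPos, hfv,
      Icc.coe_zero, smul_eq_mul, eigFun_zero, eigFunD_zero]
    ring

/-- The solutions of `A₂ y = μ y`. -/
theorem eigenspace_structure (hμ : μ ≠ 0) {y : H2 β m} (h : (y, μ • y) ∈ A2Graph m β γ) :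
    y = (H1.fn (H2.pos y) 0 / (2 * μ)) • eigVec m β γ μ ∧
      H1.fn (H2.pos y) 0 * charFun m β γ μ = 0 := by
  obtain ⟨h1, h2, v, h3, h4, h5, h6⟩ := h
  simp only [map_smul, ContinuousMap.smul_apply, smul_eq_mul] at h1 h2 h4 h5 h6
  set f := H2.pos y with hf
  -- With `v = f'` and `v' = μ² f`, the second-order equation splits into `(v ± μf)' = ±μ (v ± μf)`.
  have hp : H1.der (v + μ • f) = μ • H1.toL2 (v + μ • f) := by
    rw [map_add, map_add, map_smul, map_smul, h4, ← h1, ← h3]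
    module
  have hm : H1.der (v + (-μ) • f) = (-μ) • H1.toL2 (v + (-μ) • f) := by
    rw [map_add, map_add, map_smul, map_smul, h4, ← h1, ← h3]
    module
  have ep : ∀ x : unitInterval, H1.fn v x + μ * H1.fn f x =
      ((1 + γ) * μ + β) * H1.fn f 0 * Complex.exp (μ * (x : ℝ)) := by
    intro x
    have := H1.fn_eq_exp hp x
    simp only [map_add, map_smul, ContinuousMap.add_apply, ContinuousMap.smul_apply,
      smul_eq_mul] at this
    rw [this, h6]
    ring
  have em : ∀ x : unitInterval, H1.fn v x - μ * H1.fn f x =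
      -(((1 - γ) * μ - β) * H1.fn f 0 * Complex.exp (-(μ * (x : ℝ)))) := by
    intro x
    have := H1.fn_eq_exp hm x
    simp only [map_add, map_smul, ContinuousMap.add_apply, ContinuousMap.smul_apply,
      smul_eq_mul, neg_mul] at this
    rw [sub_eq_add_neg, this, h6]
    ring
  have ef : ∀ x : unitInterval, H1.fn f x = H1.fn f 0 / (2 * μ) * eigFun β γ μ x := by
    intro x
    have e1 := ep x
    have e2 := em x
    rw [eigFun]
    field_simp
    linear_combination e1 - e2
  have ef' : f = (H1.fn f 0 / (2 * μ)) • eigPos β γ μ := by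
    refine H1.fn_injective (ContinuousMap.ext fun x => ?_)
    rw [ef x, map_smul, ContinuousMap.smul_apply, fn_eigPos, smul_eq_mul]
  have ev : H2.vel y = (H1.fn f 0 / (2 * μ)) • H2.vel (eigVec m β γ μ) := by
    rw [vel_eigVec, ← h1, smul_comm, ← map_smul H1.toL2 (_ / _), ← ef']
  have et : H2.tip y = (H1.fn f 0 / (2 * μ)) • H2.tip (eigVec m β γ μ) := by
    rw [h2, ef 1, tip_eigVec, smul_eq_mul, Icc.coe_one]
    ring
  refine ⟨H2.ext_iff'.2 ⟨by rw [map_smul, pos_eigVec]; exact ef', by rw [map_smul]; exact ev,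
    by rw [map_smul]; exact et⟩, ?_⟩
  have e1 := ep 1
  have e2 := em 1
  simp only [Icc.coe_one, Complex.ofReal_one, mul_one] at e1 e2
  rw [h2] at h5
  rw [charFun]
  linear_combination (-1 : ℂ) * (1 + m * μ) * e1 - (1 - m * μ) * e2 - 2 * h5

theorem smul_mem_A2Graph (c : ℂ) {y z : H2 β m} (h : (y, z) ∈ A2Graph m β γ) :
    (c • y, c • z) ∈ A2Graph m β γ := by
  have h1 := (A2Graph m β γ).smul_mem c h
  rwa [Prod.smul_mk] at h1

variable [hβ : Fact (0 < β)]

theorem ne_zero_of_charFun_eq_zero (h : charFun m β γ μ = 0) : μ ≠ 0 := by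
  rintro rfl
  exact charFun_zero hβ.out.ne' h

theorem isEigenvalue_iff : IsEigenvalue (A2 m β γ) μ ↔ charFun m β γ μ = 0 := by
  constructor
  · rintro ⟨y, hy, h⟩
    rw [inEigenspace_iff] at h
    have hμ : μ ≠ 0 := by
      rintro rfl
      rw [zero_smul] at h
      exact hy (eq_zero_of_mem_A2Graph_zero hβ.out.ne' h)
    obtain ⟨h1, h2⟩ := eigenspace_structure hμ h
    refine (mul_eq_zero.1 h2).resolve_left fun h0 => hy ?_
    rw [h1, h0, zero_div, zero_smul]
  · intro h
    exact ⟨eigVec m β γ μ, eigVec_ne_zero (ne_zero_of_charFun_eq_zero h),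
      inEigenspace_iff.2 (eigVec_mem h)⟩

theorem eigenspace_spanned (h : IsEigenvalue (A2 m β γ) μ) (z : H2 β m) :
    InEigenspace (A2 m β γ) μ z ↔ ∃ c : ℂ, z = c • eigVec m β γ μ := by
  have hc := isEigenvalue_iff.1 h
  rw [inEigenspace_iff]
  constructor
  · exact fun hz => ⟨_, (eigenspace_structure (ne_zero_of_charFun_eq_zero hc) hz).1⟩
  · rintro ⟨c, rfl⟩
    rw [smul_comm]
    exact smul_mem_A2Graph c (eigVec_mem hc)

theorem A2inv_eigVec [Fact (0 < m)] (h : charFun m β γ μ = 0) :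
    A2inv m β γ (eigVec m β γ μ) = μ⁻¹ • eigVec m β γ μ := by
  have h1 : (μ⁻¹ • eigVec m β γ μ, μ⁻¹ • μ • eigVec m β γ μ) ∈ A2Graph m β γ :=
    smul_mem_A2Graph μ⁻¹ (eigVec_mem h)
  rw [smul_smul μ⁻¹ μ, inv_mul_cancel₀ (ne_zero_of_charFun_eq_zero h), one_smul] at h1
  exact A2inv_eq h1

end Eigenvectors

/-! ### Estimates for the perturbed fixed point equation. -/

section Perturbation

/-- Applied to `(μ - a)/(μ + s) = 1 - c/(μ + s)` with `c = a + s`. The radius `2 + 2‖s‖ + 16‖c‖` is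
chosen so that `‖μ + s‖ ≥ ‖μ‖/2 ≥ 1` and `2‖c‖/‖μ‖ ≤ 1/8`. -/
theorem mobius_bounds (c s : ℂ) : ∃ R : ℝ, 2 ≤ R ∧ (∀ μ : ℂ, R ≤ ‖μ‖ → μ + s ≠ 0) ∧
    (∀ μ : ℂ, R ≤ ‖μ‖ → ‖c / (μ + s)‖ ≤ 2 * ‖c‖ / ‖μ‖) ∧
    (∀ μ : ℂ, R ≤ ‖μ‖ → ‖c / (μ + s)‖ ≤ 1 / 8) ∧
    ∀ μ ν : ℂ, R ≤ ‖μ‖ → R ≤ ‖ν‖ → ‖c / (μ + s) - c / (ν + s)‖ ≤ 1 / 8 * ‖μ - ν‖ := by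
  have hs := norm_nonneg s
  have hc := norm_nonneg c
  have h1 : ∀ μ : ℂ, 2 + 2 * ‖s‖ + 16 * ‖c‖ ≤ ‖μ‖ → ‖μ‖ / 2 ≤ ‖μ + s‖ := by
    intro μ h
    have := norm_sub_le (μ + s) s
    rw [add_sub_cancel_right] at this
    linarith
  have h2 : ∀ μ : ℂ, 2 + 2 * ‖s‖ + 16 * ‖c‖ ≤ ‖μ‖ → μ + s ≠ 0 := by
    intro μ h h0
    have := h1 μ h
    rw [h0, norm_zero] at this
    linarith
  have h3 : ∀ μ : ℂ, 2 + 2 * ‖s‖ + 16 * ‖c‖ ≤ ‖μ‖ → ‖c / (μ + s)‖ ≤ 2 * ‖c‖ / ‖μ‖ := by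
    intro μ h
    have := h1 μ h
    have hμ : 0 < ‖μ‖ := by linarith
    rw [norm_div, div_le_div_iff₀ (by linarith) hμ]
    nlinarith
  have h4 : ∀ μ : ℂ, 2 + 2 * ‖s‖ + 16 * ‖c‖ ≤ ‖μ‖ → ‖c / (μ + s)‖ ≤ 1 / 8 := by
    intro μ h
    refine (h3 μ h).trans ?_
    rw [div_le_div_iff₀ (by linarith) (by norm_num)]
    linarith
  refine ⟨2 + 2 * ‖s‖ + 16 * ‖c‖, by linarith, h2, h3, h4, fun μ ν hμ hν => ?_⟩
  have e : c / (μ + s) - c / (ν + s) = -(c / (μ + s) * (1 / (ν + s)) * (μ - ν)) := by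
    have := h2 μ hμ
    have := h2 ν hν
    field_simp
    ring
  have h5 : ‖1 / (ν + s)‖ ≤ 1 := by
    rw [norm_div, norm_one]
    have := h1 ν hν
    exact (div_le_one (by linarith)).2 (by linarith)
  rw [e, norm_neg, norm_mul, norm_mul]
  have := h4 μ hμ
  gcongr
  calc ‖c / (μ + s)‖ * ‖1 / (ν + s)‖ ≤ 1 / 8 * 1 := by gcongr
    _ = 1 / 8 := mul_one _

/-- Mean value inequality on the disc of radius `1/2` about `1`: it is convex, avoids the cut, and
there `‖u⁻¹‖ ≤ 2`. -/
theorem norm_log_sub_log_le {z w : ℂ} (hz : ‖z - 1‖ ≤ 1 / 2) (hw : ‖w - 1‖ ≤ 1 / 2) :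
    ‖Complex.log z - Complex.log w‖ ≤ 2 * ‖z - w‖ := by
  have hre : ∀ u ∈ Metric.closedBall (1 : ℂ) (1 / 2), u ∈ Complex.slitPlane ∧ 1 / 2 ≤ ‖u‖ := by
    intro u hu
    rw [mem_closedBall_iff_norm] at hu
    have h1 := (Complex.abs_re_le_norm (u - 1)).trans hu
    rw [Complex.sub_re, Complex.one_re, abs_le] at h1
    exact ⟨Or.inl (by linarith), (by linarith : (1 / 2 : ℝ) ≤ u.re).trans (Complex.re_le_norm u)⟩
  refine (convex_closedBall (1 : ℂ) (1 / 2)).norm_image_sub_le_of_norm_hasDerivWithin_le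
    (f' := fun u => u⁻¹)
    (fun u hu => (Complex.hasDerivAt_log (hre u hu).1).hasDerivWithinAt) (fun u hu => ?_)
    (by rwa [mem_closedBall_iff_norm]) (by rwa [mem_closedBall_iff_norm])
  have := (hre u hu).2
  rw [norm_inv]
  exact inv_le_of_inv_le₀ (by norm_num) (by linarith)

/-- Contraction principle for a small perturbation of a constant. -/
theorem exists_fixed_point {h : ℂ → ℂ} {R : ℝ}
    (hb : ∀ μ, R ≤ ‖μ‖ → ‖h μ‖ ≤ 1 / 4)
    (hl : ∀ μ ν, R ≤ ‖μ‖ → R ≤ ‖ν‖ → ‖h μ - h ν‖ ≤ 1 / 2 * ‖μ - ν‖) {ξ : ℂ}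
    (hξ : R + 1 ≤ ‖ξ‖) : ∃ μ, R ≤ ‖μ‖ ∧ μ = ξ + h μ := by
  have hR : ∀ μ ∈ Metric.closedBall ξ (1 / 4), R ≤ ‖μ‖ := by
    intro μ hμ
    rw [mem_closedBall_iff_norm'] at hμ
    have := norm_sub_norm_le ξ μ
    linarith
  have hmaps : MapsTo (fun μ => ξ + h μ) (Metric.closedBall ξ (1 / 4))
      (Metric.closedBall ξ (1 / 4)) := by
    intro μ hμ
    rw [mem_closedBall_iff_norm, add_sub_cancel_left]
    exact hb μ (hR μ hμ)
  have hcontr : ContractingWith (1 / 2) (hmaps.restrict _ _ _) := by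
    refine ⟨by rw [← NNReal.coe_lt_coe]; norm_num, LipschitzWith.of_dist_le_mul fun μ ν => ?_⟩
    rw [Subtype.dist_eq, Subtype.dist_eq, dist_eq_norm, dist_eq_norm]
    simpa using hl μ ν (hR μ μ.2) (hR ν ν.2)
  obtain ⟨μ, hμ, hfix, -⟩ := hcontr.exists_fixedPoint' Metric.isClosed_closedBall.isComplete hmaps
    (Metric.mem_closedBall_self (by norm_num)) (edist_ne_top _ _)
  exact ⟨μ, hR μ hμ, hfix.symm⟩

end Perturbation

/-! ### Location and asymptotics of the eigenvalues. -/

section Eigenvalues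

/-- The leading part of the `n`-th eigenvalue. -/
noncomputable def leadEv (γ : ℝ) (n : ℤ) : ℂ :=
  (1 / 2 * Real.log (|γ - 1| / (γ + 1)) : ℝ) + shiftedIndex γ n * Real.pi * Complex.I

theorem leadEv_eq (γ : ℝ) (n : ℤ) : leadEv γ n = leadEv γ 0 + n * Real.pi * Complex.I := by
  simp only [leadEv, shiftedIndex]
  split_ifs <;> push_cast <;> ring

theorem leadEv_im (γ : ℝ) (n : ℤ) : (leadEv γ n).im = shiftedIndex γ n * Real.pi := by
  simp [leadEv]

theorem leadEv_re (γ : ℝ) (n : ℤ) :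
    (leadEv γ n).re = 1 / 2 * Real.log (|γ - 1| / (γ + 1)) := by
  simp [leadEv]

/-- For `n ≠ 0` the imaginary part is at least `(|n| - 1/2) π`, and `π > 3` absorbs the half. -/
theorem abs_le_norm_leadEv (γ : ℝ) (n : ℤ) : |(n : ℝ)| ≤ ‖leadEv γ n‖ := by
  refine le_trans ?_ (Complex.abs_im_le_norm _)
  rw [leadEv_im, abs_mul, abs_of_pos Real.pi_pos]
  have hpi := Real.pi_gt_three
  by_cases hn : n = 0
  · subst hn
    simp only [Int.cast_zero, abs_zero]
    positivity
  have h1 : (1 : ℝ) ≤ |(n : ℝ)| := by exact_mod_cast Int.one_le_abs hn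
  have h2 : |(n : ℝ)| - 1 / 2 ≤ |shiftedIndex γ n| := by
    rw [shiftedIndex]
    split_ifs
    · linarith
    · have := abs_sub_abs_le_abs_sub (n : ℝ) (-(1 / 2))
      rw [abs_neg, sub_neg_eq_add, abs_of_pos (by norm_num : (0 : ℝ) < 1 / 2)] at this
      exact this
  nlinarith [abs_nonneg (shiftedIndex γ n)]

theorem norm_leadEv_le (γ : ℝ) (n : ℤ) : ‖leadEv γ n‖ ≤ ‖leadEv γ 0‖ + 4 * |(n : ℝ)| := by
  rw [leadEv_eq]
  refine (norm_add_le _ _).trans ?_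
  have : ‖(n : ℂ) * Real.pi * Complex.I‖ = |(n : ℝ)| * Real.pi := by
    rw [norm_mul, norm_mul, Complex.norm_I, mul_one, Complex.norm_real, Real.norm_eq_abs,
      abs_of_pos Real.pi_pos, Complex.norm_intCast]
  rw [this]
  nlinarith [Real.pi_le_four, abs_nonneg (n : ℝ)]

/-- The half-integer shift for `γ < 1` contributes `e^{iπ} = -1`, which restores the sign lost in
`|γ - 1|`. -/
theorem exp_two_mul_leadEv {γ : ℝ} (hγ : 0 < γ) (hγ1 : γ ≠ 1) (n : ℤ) :
    Complex.exp (2 * leadEv γ n) = (γ - 1) / (γ + 1) := by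
  have hpos : 0 < |γ - 1| / (γ + 1) := div_pos (abs_pos.2 (sub_ne_zero.2 hγ1)) (by linarith)
  have e : 2 * leadEv γ n = ((Real.log (|γ - 1| / (γ + 1)) : ℝ) : ℂ) +
      (2 * shiftedIndex γ n * Real.pi * Complex.I) := by
    rw [leadEv]
    push_cast
    ring
  rw [e, Complex.exp_add, ← Complex.ofReal_exp, Real.exp_log hpos]
  rcases lt_or_gt_of_ne hγ1 with h | h
  · have h2 : (2 * shiftedIndex γ n * Real.pi * Complex.I : ℂ) =
        Real.pi * Complex.I + n * (2 * Real.pi * Complex.I) := by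
      rw [shiftedIndex, if_neg (not_lt.2 h.le)]
      push_cast
      ring
    rw [h2, Complex.exp_add, Complex.exp_pi_mul_I, Complex.exp_int_mul_two_pi_mul_I,
      abs_of_neg (by linarith)]
    push_cast
    ring
  · have h2 : (2 * shiftedIndex γ n * Real.pi * Complex.I : ℂ) =
        n * (2 * Real.pi * Complex.I) := by
      rw [shiftedIndex, if_pos h]
      push_cast
      ring
    rw [h2, Complex.exp_int_mul_two_pi_mul_I, abs_of_pos (by linarith)]
    push_cast
    ring

/-- Far from the origin, the characteristic equation takes the form `μ = ξₙ + h(μ)` with a small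
perturbation `h`. -/
theorem exists_charFun_perturbation {m β γ : ℝ} (hm : 0 < m) (hγ : 0 < γ) (hγ1 : γ ≠ 1) :
    ∃ (h : ℂ → ℂ) (R C : ℝ), 0 ≤ R ∧ 0 ≤ C ∧ (∀ μ, R ≤ ‖μ‖ → ‖h μ‖ ≤ 1 / 4) ∧
      (∀ μ ν, R ≤ ‖μ‖ → R ≤ ‖ν‖ → ‖h μ - h ν‖ ≤ 1 / 2 * ‖μ - ν‖) ∧
      (∀ μ, R ≤ ‖μ‖ → ‖h μ‖ ≤ C / ‖μ‖) ∧
      ∀ μ, R ≤ ‖μ‖ → (charFun m β γ μ = 0 ↔ ∃ n : ℤ, μ = leadEv γ n + h μ) := by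
  have g1 : (1 + γ : ℂ) ≠ 0 := by
    norm_cast
    linarith
  have g2 : (1 - γ : ℂ) ≠ 0 := by
    norm_cast
    exact sub_ne_zero.2 hγ1.symm
  have g3 : (m : ℂ) ≠ 0 := by
    norm_cast
    exact hm.ne'
  -- Dividing the equation by its leading coefficients leaves `q(μ) = (μ - β/(1-γ))/(μ + s₁) · (μ -
  -- 1/m)/(μ + s₂)`; `c₁` and `c₂` are the differences between poles and zeros.
  set s₁ : ℂ := β / (1 + γ) with hs₁
  set s₂ : ℂ := 1 / m with hs₂
  set c₁ : ℂ := β / (1 - γ) + s₁ with hc₁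
  set c₂ : ℂ := 2 / m with hc₂
  obtain ⟨R₁, r1, a1, a2, a3, a4⟩ := mobius_bounds c₁ s₁
  obtain ⟨R₂, r2, b1, b2, b3, b4⟩ := mobius_bounds c₂ s₂
  set q : ℂ → ℂ := fun μ => (1 - c₁ / (μ + s₁)) * (1 - c₂ / (μ + s₂)) with hq
  have hR₁ : ∀ μ : ℂ, max R₁ R₂ ≤ ‖μ‖ → R₁ ≤ ‖μ‖ := fun μ h => (le_max_left _ _).trans h
  have hR₂ : ∀ μ : ℂ, max R₁ R₂ ≤ ‖μ‖ → R₂ ≤ ‖μ‖ := fun μ h => (le_max_right _ _).trans h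
  have hq1 : ∀ μ, max R₁ R₂ ≤ ‖μ‖ →
      ‖q μ - 1‖ ≤ ‖c₁ / (μ + s₁)‖ + ‖c₂ / (μ + s₂)‖ + ‖c₁ / (μ + s₁)‖ * ‖c₂ / (μ + s₂)‖ := by
    intro μ _
    have e : q μ - 1 = -(c₁ / (μ + s₁)) - c₂ / (μ + s₂) + c₁ / (μ + s₁) * (c₂ / (μ + s₂)) := by
      rw [hq]
      ring
    rw [e, ← norm_mul]
    refine (norm_add_le _ _).trans ?_
    gcongr
    refine (norm_sub_le _ _).trans ?_
    rw [norm_neg]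
  have hq3 : ∀ μ, max R₁ R₂ ≤ ‖μ‖ → ‖q μ - 1‖ ≤ 1 / 3 := by
    intro μ h
    have := hq1 μ h
    have h1 := a3 μ (hR₁ μ h)
    have h2 := b3 μ (hR₂ μ h)
    nlinarith [norm_nonneg (c₁ / (μ + s₁)), norm_nonneg (c₂ / (μ + s₂))]
  have hq4 : ∀ μ, max R₁ R₂ ≤ ‖μ‖ → ‖q μ - 1‖ ≤ 4 * (‖c₁‖ + ‖c₂‖) / ‖μ‖ := by
    intro μ h
    have := hq1 μ h
    have h1 := a3 μ (hR₁ μ h)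
    have h2 := b2 μ (hR₂ μ h)
    have h3 := a2 μ (hR₁ μ h)
    have e : 4 * (‖c₁‖ + ‖c₂‖) / ‖μ‖ = 2 * (2 * ‖c₁‖ / ‖μ‖) + 2 * (2 * ‖c₂‖ / ‖μ‖) := by ring
    rw [e]
    nlinarith [norm_nonneg (c₁ / (μ + s₁)), norm_nonneg (c₂ / (μ + s₂))]
  have hlog : ∀ μ, max R₁ R₂ ≤ ‖μ‖ → ‖1 / 2 * Complex.log (q μ)‖ ≤ 3 / 4 * ‖q μ - 1‖ := by
    intro μ h
    have h1 := Complex.norm_log_one_add_half_le_self (z := q μ - 1)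
      ((hq3 μ h).trans (by norm_num))
    rw [add_sub_cancel] at h1
    rw [norm_mul]
    norm_num
    linarith
  have hqne : ∀ μ, max R₁ R₂ ≤ ‖μ‖ → q μ ≠ 0 := by
    intro μ h h0
    have := hq3 μ h
    rw [h0, zero_sub, norm_neg, norm_one] at this
    norm_num at this
  refine ⟨fun μ => 1 / 2 * Complex.log (q μ), max R₁ R₂, 4 * (‖c₁‖ + ‖c₂‖),
    (by linarith : (0 : ℝ) ≤ R₁).trans (le_max_left _ _), by positivity, ?_, ?_, ?_, ?_⟩
  · intro μ h
    exact (hlog μ h).trans (by linarith [hq3 μ h])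
  · intro μ ν hμ hν
    have h1 := norm_log_sub_log_le ((hq3 μ hμ).trans (by norm_num))
      ((hq3 ν hν).trans (by norm_num))
    have e : q μ - q ν = -((c₁ / (μ + s₁) - c₁ / (ν + s₁)) * (1 - c₂ / (μ + s₂))) -
        (1 - c₁ / (ν + s₁)) * (c₂ / (μ + s₂) - c₂ / (ν + s₂)) := by
      rw [hq]
      ring
    have h2 := a4 μ ν (hR₁ μ hμ) (hR₁ ν hν)
    have h3 := b4 μ ν (hR₂ μ hμ) (hR₂ ν hν)
    have h4 : ‖1 - c₂ / (μ + s₂)‖ ≤ 2 := by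
      refine (norm_sub_le _ _).trans ?_
      rw [norm_one]
      linarith [b3 μ (hR₂ μ hμ)]
    have h5 : ‖1 - c₁ / (ν + s₁)‖ ≤ 2 := by
      refine (norm_sub_le _ _).trans ?_
      rw [norm_one]
      linarith [a3 ν (hR₁ ν hν)]
    have h6 : ‖q μ - q ν‖ ≤ 1 / 2 * ‖μ - ν‖ := by
      rw [e]
      refine (norm_sub_le _ _).trans ?_
      rw [norm_neg, norm_mul, norm_mul]
      calc _ ≤ 1 / 8 * ‖μ - ν‖ * 2 + 2 * (1 / 8 * ‖μ - ν‖) := by gcongr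
        _ = 1 / 2 * ‖μ - ν‖ := by ring
    simp only [← mul_sub]
    rw [norm_mul]
    norm_num
    linarith
  · intro μ h
    refine (hlog μ h).trans ?_
    linarith [hq4 μ h, norm_nonneg (q μ - 1)]
  · intro μ h
    have d1 := a1 μ (hR₁ μ h)
    have d2 := b1 μ (hR₂ μ h)
    have e1 : ((1 + γ) * μ + β : ℂ) = (1 + γ) * (μ + s₁) := by
      rw [hs₁]
      field_simp
    have e2 : (1 + m * μ : ℂ) = m * (μ + s₂) := by
      rw [hs₂]
      field_simp
      ring
    have e3 : ((1 - γ) * μ - β : ℂ) * (1 - m * μ) =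
        (γ - 1) * m * (μ + s₁) * (μ + s₂) * q μ := by
      have f1 : (μ + s₁) * (1 - c₁ / (μ + s₁)) = μ - β / (1 - γ) := by
        rw [mul_sub, mul_div_cancel₀ _ d1, hc₁]
        ring
      have f2 : (μ + s₂) * (1 - c₂ / (μ + s₂)) = μ - 1 / m := by
        rw [mul_sub, mul_div_cancel₀ _ d2, hc₂, hs₂]
        ring
      have : (γ - 1) * m * (μ + s₁) * (μ + s₂) * q μ =
          (γ - 1) * m * ((μ + s₁) * (1 - c₁ / (μ + s₁))) * ((μ + s₂) * (1 - c₂ / (μ + s₂))) := by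
        rw [hq]
        ring
      rw [this, f1, f2]
      field_simp
      ring
    -- As `q μ ≠ 0`, both sides of the equation are exponentials; comparing exponents modulo `2πi`
    -- produces the index `n`.
    have hchar : charFun m β γ μ = 0 ↔
        Complex.exp (2 * μ) = Complex.exp (2 * leadEv γ 0 + Complex.log (q μ)) := by
      rw [Complex.exp_add, exp_two_mul_leadEv hγ hγ1, Complex.exp_log (hqne μ h), charFun, e1, e2,
        e3, Complex.exp_neg, two_mul, Complex.exp_add, sub_eq_zero, div_mul_eq_mul_div,
        eq_div_iff (by rwa [add_comm]), ← div_eq_mul_inv, eq_div_iff (Complex.exp_ne_zero μ)]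
      have hne : (m : ℂ) * (μ + s₁) * (μ + s₂) ≠ 0 := mul_ne_zero (mul_ne_zero g3 d1) d2
      constructor
      · intro hh
        apply mul_left_cancel₀ hne
        linear_combination hh
      · intro hh
        linear_combination ((m : ℂ) * (μ + s₁) * (μ + s₂)) * hh
    rw [hchar, Complex.exp_eq_exp_iff_exists_int]
    refine exists_congr fun n => ?_
    rw [leadEv_eq γ n]
    constructor
    · intro hh
      linear_combination hh / 2
    · intro hh
      linear_combination 2 * hh

/-- Identity theorem: infinitely many zeros in a compact disc would accumulate and force the entire
function to vanish at `0`. -/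
theorem finite_charFun_zeros_closedBall {m β γ : ℝ} (hβ : β ≠ 0) (r : ℝ) :
    {μ : ℂ | charFun m β γ μ = 0 ∧ ‖μ‖ ≤ r}.Finite := by
  have han : AnalyticOnNhd ℂ (charFun m β γ) univ := by
    have : Differentiable ℂ (charFun m β γ) := by
      unfold charFun
      fun_prop
    exact fun z _ => this.analyticAt z
  by_contra hinf
  obtain ⟨z, -, hz⟩ := Set.Infinite.exists_accPt_of_subset_isCompact hinf
    (isCompact_closedBall (0 : ℂ) r) (fun μ hμ => mem_closedBall_zero_iff.2 hμ.2)
  have hfreq : ∃ᶠ μ in nhdsWithin z {z}ᶜ, charFun m β γ μ = 0 :=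
    (accPt_iff_frequently_nhdsNE.1 hz).mono fun μ hμ => hμ.1
  have := han.eqOn_zero_of_preconnected_of_frequently_eq_zero isPreconnected_univ (mem_univ z)
    hfreq
  exact charFun_zero hβ (this (mem_univ 0))

/-- The gap exceeds twice the displacement bound `1/4` of the fixed points, so different indices
give different eigenvalues. -/
theorem leadEv_sub_norm (γ : ℝ) (n k : ℤ) (h : n ≠ k) : 3 ≤ ‖leadEv γ n - leadEv γ k‖ := by
  have e : leadEv γ n - leadEv γ k = ((n - k : ℤ) : ℂ) * Real.pi * Complex.I := by
    rw [leadEv_eq γ n, leadEv_eq γ k]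
    push_cast
    ring
  have h1 : (1 : ℝ) ≤ |((n - k : ℤ) : ℝ)| := by exact_mod_cast Int.one_le_abs (sub_ne_zero.2 h)
  rw [e, norm_mul, norm_mul, Complex.norm_I, mul_one, Complex.norm_real, Real.norm_eq_abs,
    abs_of_pos Real.pi_pos, Complex.norm_intCast]
  nlinarith [Real.pi_gt_three]

/-- The zeros of the characteristic function, up to finitely many, and their asymptotics. -/
theorem exists_charFun_zeros {m β γ : ℝ} (hm : 0 < m) (hβ : 0 < β) (hγ : 0 < γ) (hγ1 : γ ≠ 1) :
    ∃ (ev : ℤ → ℂ) (N : ℕ) (C : ℝ), 0 ≤ C ∧ (∀ n, charFun m β γ (ev n) = 0) ∧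
      InjOn ev {n : ℤ | (N : ℤ) ≤ |n|} ∧
      ({μ : ℂ | charFun m β γ μ = 0} \ ev '' {n : ℤ | (N : ℤ) ≤ |n|}).Finite ∧
      (∀ n : ℤ, |(n : ℝ)| / 2 ≤ ‖ev n‖) ∧
      ∀ n : ℤ, n ≠ 0 → ‖ev n - leadEv γ n‖ ≤ C / |(n : ℝ)| := by
  obtain ⟨h, R, C₁, hR, hC₁, hb, hl, hC, hchar⟩ :=
    exists_charFun_perturbation (β := β) hm hγ hγ1
  -- With `|n| ≤ ‖ξₙ‖` this puts every `ξₙ` with `|n| ≥ N` where the contraction applies.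
  obtain ⟨N, hN⟩ := exists_nat_ge (R + 1)
  have hfix : ∀ n : ℤ, ∃ μ, (N : ℤ) ≤ |n| → R ≤ ‖μ‖ ∧ μ = leadEv γ n + h μ := by
    intro n
    by_cases hn : (N : ℤ) ≤ |n|
    · have h1 : (N : ℝ) ≤ |(n : ℝ)| := by exact_mod_cast hn
      obtain ⟨μ, hμ⟩ := exists_fixed_point hb hl (hN.trans (h1.trans (abs_le_norm_leadEv γ n)))
      exact ⟨μ, fun _ => hμ⟩
    · exact ⟨0, fun h => absurd h hn⟩
  choose lam hlam using hfix
  -- For `|n| < N` an arbitrary eigenvalue serves as a filler; `lam N` is large enough to keep the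
  -- lower bound `|n|/2`.
  set ev : ℤ → ℂ := fun n => if (N : ℤ) ≤ |n| then lam n else lam N with hev
  have hNN : (N : ℤ) ≤ |(N : ℤ)| := le_abs_self _
  have ev1 : ∀ n : ℤ, (N : ℤ) ≤ |n| → ev n = lam n := fun n hn => if_pos hn
  have ev2 : ∀ n : ℤ, ¬ (N : ℤ) ≤ |n| → ev n = lam N := fun n hn => if_neg hn
  have hN1 : (1 : ℝ) ≤ N := by linarith
  have hdiff : ∀ n : ℤ, (N : ℤ) ≤ |n| → lam n - leadEv γ n = h (lam n) := by
    intro n hn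
    exact sub_eq_iff_eq_add'.2 (hlam n hn).2
  have hlow : ∀ n : ℤ, (N : ℤ) ≤ |n| → |(n : ℝ)| / 2 ≤ ‖lam n‖ := by
    intro n hn
    have h1 : (N : ℝ) ≤ |(n : ℝ)| := by exact_mod_cast hn
    have h2 := hb _ (hlam n hn).1
    rw [← hdiff n hn] at h2
    have h3 := norm_sub_norm_le (leadEv γ n) (lam n)
    rw [norm_sub_rev] at h3
    have h4 := abs_le_norm_leadEv γ n
    linarith
  have hsmall : ∀ n : ℤ, ¬ (N : ℤ) ≤ |n| → |(n : ℝ)| ≤ N := by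
    intro n hn
    exact_mod_cast (not_le.1 hn).le
  have hevlow : ∀ n : ℤ, |(n : ℝ)| / 2 ≤ ‖ev n‖ := by
    intro n
    by_cases hn : (N : ℤ) ≤ |n|
    · rw [ev1 n hn]
      exact hlow n hn
    · rw [ev2 n hn]
      refine le_trans ?_ (hlow N hNN)
      have := hsmall n hn
      rw [Int.cast_natCast, Nat.abs_cast]
      linarith
  have hzero : ∀ n : ℤ, (N : ℤ) ≤ |n| → charFun m β γ (lam n) = 0 := fun n hn =>
    (hchar _ (hlam n hn).1).2 ⟨n, (hlam n hn).2⟩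
  -- The perturbation has Lipschitz constant `1/2` on the whole region `R ≤ ‖μ‖`, so uniqueness is
  -- not confined to the ball of the contraction argument.
  have huniq : ∀ (n : ℤ) (μ : ℂ), (N : ℤ) ≤ |n| → R ≤ ‖μ‖ → μ = leadEv γ n + h μ →
      μ = lam n := by
    intro n μ hn hμ hμ'
    have h1 := hl μ (lam n) hμ (hlam n hn).1
    have h2 : μ - lam n = h μ - h (lam n) := by
      rw [← hdiff n hn]
      linear_combination hμ'
    rw [← h2] at h1
    have h3 : ‖μ - lam n‖ = 0 := by linarith [norm_nonneg (μ - lam n)]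
    exact sub_eq_zero.1 (norm_eq_zero.1 h3)
  -- `D` bounds the distance of the filler from `ξₙ` when `|n| < N`; the factor `N` then absorbs
  -- `|n|`.
  set D : ℝ := ‖lam N‖ + ‖leadEv γ 0‖ + 4 * N with hD
  refine ⟨ev, N, 2 * C₁ + D * N, by positivity, ?_, ?_, ?_, hevlow, ?_⟩
  · intro n
    by_cases hn : (N : ℤ) ≤ |n|
    · rw [ev1 n hn]
      exact hzero n hn
    · rw [ev2 n hn]
      exact hzero N hNN
  · intro n hn k hk hnk
    by_contra hne
    have hn' : (N : ℤ) ≤ |n| := hn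
    have hk' : (N : ℤ) ≤ |k| := hk
    rw [ev1 n hn', ev1 k hk'] at hnk
    have h1 := leadEv_sub_norm γ n k hne
    have h2 := hb _ (hlam n hn').1
    have h3 := hb _ (hlam k hk').1
    rw [← hdiff n hn'] at h2
    rw [← hdiff k hk', ← hnk] at h3
    have e : leadEv γ n - leadEv γ k = (lam n - leadEv γ k) - (lam n - leadEv γ n) := by ring
    rw [e] at h1
    have := norm_sub_le (lam n - leadEv γ k) (lam n - leadEv γ n)
    linarith
  -- A zero with `‖μ‖ ≥ R` is `ξₙ + h μ` for some `n`. If `|n| ≥ N` it is `lam n`; otherwise it lies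
  -- in the stated disc.
  · refine (finite_charFun_zeros_closedBall (m := m) (γ := γ) hβ.ne'
      (R + 1 + ‖leadEv γ 0‖ + 4 * N)).subset ?_
    rintro μ ⟨hμ, hμ'⟩
    refine ⟨hμ, ?_⟩
    by_contra hlt
    have hlt' := not_le.1 hlt
    have hRμ : R ≤ ‖μ‖ := by
      have := norm_nonneg (leadEv γ 0)
      linarith
    obtain ⟨n, hn⟩ := (hchar μ hRμ).1 hμ
    by_cases hnN : (N : ℤ) ≤ |n|
    · exact hμ' ⟨n, hnN, (ev1 n hnN).trans (huniq n μ hnN hRμ hn).symm⟩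
    · have h1 := hb μ hRμ
      have h2 := norm_add_le (leadEv γ n) (h μ)
      rw [← hn] at h2
      have h3 := norm_leadEv_le γ n
      have h4 := hsmall n hnN
      linarith
  · intro n hn0
    have hnpos : 0 < |(n : ℝ)| := abs_pos.2 (Int.cast_ne_zero.2 hn0)
    by_cases hn : (N : ℤ) ≤ |n|
    · rw [ev1 n hn, hdiff n hn]
      refine (hC _ (hlam n hn).1).trans ?_
      have := hlow n hn
      rw [div_le_div_iff₀ (by linarith) hnpos]
      have hDN : 0 ≤ D * N := by positivity
      nlinarith [mul_nonneg hDN (norm_nonneg (lam n))]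
    · rw [ev2 n hn, le_div_iff₀ hnpos]
      have h1 := norm_sub_le (lam N) (leadEv γ n)
      have h2 := norm_leadEv_le γ n
      have h3 := hsmall n hn
      have h4 : ‖lam N - leadEv γ n‖ ≤ D := by linarith
      calc ‖lam N - leadEv γ n‖ * |(n : ℝ)| ≤ D * N := by gcongr
        _ ≤ 2 * C₁ + D * N := by linarith

end Eigenvalues

/-! ### Asymptotics of the eigenfunctions. -/

section Eigenfunctions

theorem waveR_eq {γ : ℝ} (hγ : 0 < γ) (hγ1 : γ ≠ 1) (n : ℤ) (x : ℝ) :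
    waveR γ n x = Complex.exp (leadEv γ n * x) := by
  have e : |(γ - 1) / (γ + 1)| = |γ - 1| / (γ + 1) := by
    rw [abs_div, abs_of_pos (by linarith : 0 < γ + 1)]
  have hpos : 0 < |γ - 1| / (γ + 1) := div_pos (abs_pos.2 (sub_ne_zero.2 hγ1)) (by linarith)
  rw [waveR, e, Real.rpow_def_of_pos hpos, Complex.ofReal_exp, ← Complex.exp_add, leadEv]
  congr 1
  push_cast
  ring

theorem waveL_eq {γ : ℝ} (hγ : 0 < γ) (hγ1 : γ ≠ 1) (n : ℤ) (x : ℝ) :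
    waveL γ n x = Complex.exp (-(leadEv γ n * x)) := by
  have e : |(γ + 1) / (γ - 1)| = (|γ - 1| / (γ + 1))⁻¹ := by
    rw [abs_div, abs_of_pos (by linarith : 0 < γ + 1), inv_div]
  have hpos : 0 < |γ - 1| / (γ + 1) := div_pos (abs_pos.2 (sub_ne_zero.2 hγ1)) (by linarith)
  rw [waveL, e, Real.rpow_def_of_pos (inv_pos.2 hpos), Real.log_inv, Complex.ofReal_exp,
    ← Complex.exp_add, leadEv]
  congr 1
  push_cast
  ring

theorem norm_exp_sub_exp_le {z w : ℂ} {δ K : ℝ} (h : ‖z - w‖ ≤ δ) (hK : δ ≤ K) :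
    ‖Complex.exp z - Complex.exp w‖ ≤ Real.exp w.re * Real.exp K * δ := by
  have e : Complex.exp z - Complex.exp w = Complex.exp w * (Complex.exp (z - w) - 1) := by
    rw [mul_sub, ← Complex.exp_add, add_sub_cancel, mul_one]
  have h1 := Complex.norm_exp_sub_sum_le_norm_mul_exp (z - w) 1
  simp only [Finset.range_one, Finset.sum_singleton, pow_zero, Nat.factorial_zero, Nat.cast_one,
    div_one, pow_one] at h1
  have h0 : 0 ≤ δ := (norm_nonneg _).trans h
  rw [e, norm_mul, Complex.norm_exp, mul_assoc]
  gcongr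
  calc ‖Complex.exp (z - w) - 1‖ ≤ ‖z - w‖ * Real.exp ‖z - w‖ := h1
    _ ≤ δ * Real.exp K := by
      gcongr
      exact h.trans hK
    _ = Real.exp K * δ := mul_comm _ _

/-- `P`, `Q` stand for the exact exponentials, `A`, `B` for their limits, and `r`, `t` for the lower
order terms `±β/μ` of the coefficients. -/
theorem norm_lincomb_le {a b r t A B P Q : ℂ} {p q ρ δ M : ℝ} (ha : ‖a‖ ≤ p) (hb : ‖b‖ ≤ q)
    (hr : ‖r‖ ≤ ρ) (ht : ‖t‖ ≤ ρ) (hA : ‖P - A‖ ≤ δ) (hB : ‖Q - B‖ ≤ δ) (hP : ‖P‖ ≤ M)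
    (hQ : ‖Q‖ ≤ M) :
    ‖(a + r) * P + (b + t) * Q - (a * A + b * B)‖ ≤ (p + q) * δ + 2 * ρ * M := by
  have e : (a + r) * P + (b + t) * Q - (a * A + b * B) =
      a * (P - A) + b * (Q - B) + (r * P + t * Q) := by ring
  have hp := (norm_nonneg a).trans ha
  have hq := (norm_nonneg b).trans hb
  have hρ := (norm_nonneg r).trans hr
  have h1 : ‖a * (P - A)‖ ≤ p * δ := by rw [norm_mul]; gcongr
  have h2 : ‖b * (Q - B)‖ ≤ q * δ := by rw [norm_mul]; gcongr
  have h3 : ‖r * P‖ ≤ ρ * M := by rw [norm_mul]; gcongr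
  have h4 : ‖t * Q‖ ≤ ρ * M := by rw [norm_mul]; gcongr
  rw [e]
  refine (norm_add₃_le).trans ?_
  have := norm_add_le (r * P) (t * Q)
  linarith

/-- Asymptotics of the eigenfunctions, uniformly on `[0,1]`. -/
theorem exists_eigFun_asymptotics (β : ℝ) {γ : ℝ} (hγ : 0 < γ) (hγ1 : γ ≠ 1)
    {ev : ℤ → ℂ} {C : ℝ} (hC : 0 ≤ C) (hlow : ∀ n : ℤ, |(n : ℝ)| / 2 ≤ ‖ev n‖)
    (hev : ∀ n : ℤ, n ≠ 0 → ‖ev n - leadEv γ n‖ ≤ C / |(n : ℝ)|) :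
    ∃ K : ℝ, 0 ≤ K ∧ ∀ n : ℤ, n ≠ 0 →
      (∀ x ∈ Icc (0 : ℝ) 1,
        ‖eigFunD β γ (ev n) x / ev n - ((1 + γ) * waveR γ n x - (1 - γ) * waveL γ n x)‖
          ≤ K / |(n : ℝ)| ∧
        ‖eigFun β γ (ev n) x / ev n - ((1 + γ) * waveR γ n x + (1 - γ) * waveL γ n x)‖
          ≤ K / |(n : ℝ)| ∧ ‖eigFunD β γ (ev n) x / ev n‖ ≤ K) := by
  -- The real part of `ξₙ` does not depend on `n`, so `M` bounds all waves in both directions on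
  -- `[0,1]`.
  set M : ℝ := Real.exp |1 / 2 * Real.log (|γ - 1| / (γ + 1))| with hM
  have hM0 : 0 < M := Real.exp_pos _
  set a : ℝ := M * Real.exp C * C with ha
  have ha0 : 0 ≤ a := by positivity
  have hg1 : ‖(1 + γ : ℂ)‖ ≤ 1 + γ := by
    refine (norm_add_le _ _).trans ?_
    rw [norm_one, Complex.norm_real, Real.norm_of_nonneg hγ.le]
  have hg2 : ‖(1 - γ : ℂ)‖ ≤ 1 + γ := by
    refine (norm_sub_le _ _).trans ?_
    rw [norm_one, Complex.norm_real, Real.norm_of_nonneg hγ.le]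
  set K₀ : ℝ := (1 + γ + (1 + γ)) * a + 2 * (2 * |β|) * (M + a) with hK₀
  have hK₀0 : 0 ≤ K₀ := by positivity
  refine ⟨K₀ + 2 * (1 + γ) * M, by positivity, fun n hn x hx => ?_⟩
  have hn1 : (1 : ℝ) ≤ |(n : ℝ)| := by exact_mod_cast Int.one_le_abs hn
  have hnpos : 0 < |(n : ℝ)| := by linarith
  have hCn : C / |(n : ℝ)| ≤ C := div_le_self hC hn1
  have hevpos : 0 < ‖ev n‖ := by linarith [hlow n]
  have hev0 : ev n ≠ 0 := norm_pos_iff.1 hevpos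
  have hdist : ‖ev n * x - leadEv γ n * x‖ ≤ C / |(n : ℝ)| := by
    rw [← sub_mul, norm_mul, Complex.norm_real, Real.norm_of_nonneg hx.1]
    calc ‖ev n - leadEv γ n‖ * x ≤ C / |(n : ℝ)| * 1 := by
          gcongr
          · exact hx.1
          · exact hev n hn
          · exact hx.2
      _ = _ := mul_one _
  have hre : |(leadEv γ n * x).re| ≤ |1 / 2 * Real.log (|γ - 1| / (γ + 1))| := by
    rw [Complex.re_mul_ofReal, leadEv_re, abs_mul, abs_of_nonneg hx.1]
    exact mul_le_of_le_one_right (abs_nonneg _) hx.2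
  have hRM : ‖waveR γ n x‖ ≤ M := by
    rw [waveR_eq hγ hγ1, Complex.norm_exp]
    exact Real.exp_le_exp.2 ((le_abs_self _).trans hre)
  have hLM : ‖waveL γ n x‖ ≤ M := by
    rw [waveL_eq hγ hγ1, Complex.norm_exp, Complex.neg_re]
    exact Real.exp_le_exp.2 ((neg_le_abs _).trans hre)
  have hP : ‖Complex.exp (ev n * x) - waveR γ n x‖ ≤ a / |(n : ℝ)| := by
    rw [waveR_eq hγ hγ1]
    refine (norm_exp_sub_exp_le hdist hCn).trans ?_
    rw [ha, mul_div_assoc]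
    gcongr
    exact Real.exp_le_exp.2 ((le_abs_self _).trans hre)
  have hQ : ‖Complex.exp (-(ev n * x)) - waveL γ n x‖ ≤ a / |(n : ℝ)| := by
    rw [waveL_eq hγ hγ1]
    refine (norm_exp_sub_exp_le (δ := C / |(n : ℝ)|) ?_ hCn).trans ?_
    · rw [neg_sub_neg, norm_sub_rev]
      exact hdist
    · rw [ha, mul_div_assoc, Complex.neg_re]
      gcongr
      exact Real.exp_le_exp.2 ((neg_le_abs _).trans hre)
  have han : a / |(n : ℝ)| ≤ a := div_le_self ha0 hn1
  have hP' : ‖Complex.exp (ev n * x)‖ ≤ M + a := by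
    have := norm_le_norm_add_norm_sub' (Complex.exp (ev n * x)) (waveR γ n x)
    linarith
  have hQ' : ‖Complex.exp (-(ev n * x))‖ ≤ M + a := by
    have := norm_le_norm_add_norm_sub' (Complex.exp (-(ev n * x))) (waveL γ n x)
    linarith
  have hr : ‖(β : ℂ) / ev n‖ ≤ 2 * |β| / |(n : ℝ)| := by
    rw [norm_div, Complex.norm_real, Real.norm_eq_abs, div_le_div_iff₀ hevpos hnpos]
    nlinarith [hlow n, abs_nonneg β]
  have hbound : (1 + γ + (1 + γ)) * (a / |(n : ℝ)|) + 2 * (2 * |β| / |(n : ℝ)|) * (M + a) =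
      K₀ / |(n : ℝ)| := by
    rw [hK₀]
    ring
  have hKn : K₀ / |(n : ℝ)| ≤ (K₀ + 2 * (1 + γ) * M) / |(n : ℝ)| := by
    gcongr
    have : 0 ≤ 2 * (1 + γ) * M := by positivity
    linarith
  have i1 : ‖eigFunD β γ (ev n) x / ev n -
      ((1 + γ) * waveR γ n x - (1 - γ) * waveL γ n x)‖ ≤ K₀ / |(n : ℝ)| := by
    have h := norm_lincomb_le (a := 1 + γ) (b := -(1 - γ)) (q := 1 + γ) (r := β / ev n)
      (t := β / ev n) hg1 (by rwa [norm_neg]) hr hr hP hQ hP' hQ'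
    rw [hbound] at h
    convert h using 2
    · rw [eigFunD]
      field_simp
      ring
  have i2 : ‖eigFun β γ (ev n) x / ev n -
      ((1 + γ) * waveR γ n x + (1 - γ) * waveL γ n x)‖ ≤ K₀ / |(n : ℝ)| := by
    have h := norm_lincomb_le (a := 1 + γ) (b := 1 - γ) (r := β / ev n) (t := -(β / ev n))
      hg1 hg2 hr (by rwa [norm_neg]) hP hQ hP' hQ'
    rw [hbound] at h
    convert h using 2
    · rw [eigFun]
      field_simp
      ring
  refine ⟨i1.trans hKn, i2.trans hKn, ?_⟩
  have h1 := norm_le_norm_add_norm_sub' (eigFunD β γ (ev n) x / ev n)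
    ((1 + γ) * waveR γ n x - (1 - γ) * waveL γ n x)
  have h2 : ‖(1 + γ) * waveR γ n x - (1 - γ) * waveL γ n x‖ ≤ (1 + γ) * M + (1 + γ) * M := by
    refine (norm_sub_le _ _).trans ?_
    rw [norm_mul, norm_mul]
    gcongr
  have h3 : K₀ / |(n : ℝ)| ≤ K₀ := div_le_self hK₀0 hn1
  linarith

end Eigenfunctions

/-! ### Completeness of the exponential system. -/

section Fourier

theorem intervalIntegral_symm_eq {G : Type*} [NormedAddCommGroup G] [NormedSpace ℝ G]
    {F : ℝ → G} (hF : IntervalIntegrable F volume (-1) 1) :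
    ∫ x in (-1 : ℝ)..1, F x = (∫ x in Ioo (0 : ℝ) 1, F x) + ∫ x in Ioo (0 : ℝ) 1, F (-x) := by
  have h1 : IntervalIntegrable F volume (-1) 0 := hF.mono_set (by
    rw [uIcc_of_le (by norm_num), uIcc_of_le (by norm_num)]
    exact Icc_subset_Icc_right (by norm_num))
  have h2 : IntervalIntegrable F volume 0 1 := hF.mono_set (by
    rw [uIcc_of_le (by norm_num), uIcc_of_le (by norm_num)]
    exact Icc_subset_Icc_left (by norm_num))
  rw [← intervalIntegral.integral_add_adjacent_intervals h1 h2, add_comm,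
    ← integral_Ioc_eq_integral_Ioo, ← integral_Ioc_eq_integral_Ioo,
    ← intervalIntegral.integral_of_le zero_le_one, ← intervalIntegral.integral_of_le zero_le_one,
    intervalIntegral.integral_comp_neg]
  simp

theorem eq_zero_of_integral_norm_sq {u : L2} (h : ∫ x in Ioo (0 : ℝ) 1, ‖u x‖ ^ 2 = 0) :
    u = 0 := by
  have hi : Integrable (fun x => ‖u x‖ ^ 2) (volume.restrict (Ioo (0 : ℝ) 1)) :=
    (Lp.memLp u).integrable_norm_pow two_ne_zero
  have h1 := (integral_eq_zero_iff_of_nonneg (fun x => sq_nonneg ‖u x‖) hi).1 h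
  refine Lp.ext ?_
  filter_upwards [h1, Lp.coeFn_zero ℂ 2 (volume.restrict (Ioo (0 : ℝ) 1))] with x h2 h3
  rw [h3]
  simpa using h2

/-- Completeness of the system `(e^{i(n+s)πx}, e^{-i(n+s)πx})` in `L²(0,1)²`. -/
theorem eq_zero_of_forall_integral_exp (s : ℝ) {p q : L2}
    (H : ∀ n : ℤ, (∫ x in Ioo (0 : ℝ) 1,
        Complex.exp (-(Complex.I * (n + s) * Real.pi * x)) * p x) +
      ∫ x in Ioo (0 : ℝ) 1, Complex.exp (Complex.I * (n + s) * Real.pi * x) * q x = 0) :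
    p = 0 ∧ q = 0 := by
  have hq : MemLp (fun x => q (-x)) 2 (volume.restrict (Ioo (-1 : ℝ) 0)) := by
    have h := (Lp.memLp q).comp_measurePreserving
      ((Measure.measurePreserving_neg (volume : Measure ℝ)).restrict_preimage
        (measurableSet_Ioo (a := (0 : ℝ)) (b := 1)))
    have hs : (fun x : ℝ => -x) ⁻¹' Ioo 0 1 = Ioo (-1) 0 := by
      ext x
      simp only [mem_preimage, mem_Ioo]
      constructor <;> rintro ⟨h1, h2⟩ <;> constructor <;> linarith
    simp only [hs] at h
    exact h
  -- Gluing `p` on `(0,1)` with the reflection of `q` on `(-1,0)` makes the hypothesis say that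
  -- `e^{-isπx} h` has no Fourier coefficients on `(-1,1)`; Parseval then gives `h = 0` almost
  -- everywhere on `(-1,1)`.
  set h : ℝ → ℂ := (Ioo (0 : ℝ) 1).indicator p + (Ioo (-1 : ℝ) 0).indicator fun x => q (-x)
    with hh
  have hmem : MemLp h 2 volume :=
    ((memLp_indicator_iff_restrict measurableSet_Ioo).2 (Lp.memLp p)).add
      ((memLp_indicator_iff_restrict measurableSet_Ioo).2 hq)
  have hpos : ∀ x ∈ Ioo (0 : ℝ) 1, h x = p x := by
    intro x hx
    have : x ∉ Ioo (-1 : ℝ) 0 := fun h' => lt_asymm hx.1 h'.2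
    simp [hh, indicator_of_mem hx, indicator_of_notMem this]
  have hneg : ∀ x ∈ Ioo (0 : ℝ) 1, h (-x) = q x := by
    intro x hx
    have h1 : -x ∉ Ioo (0 : ℝ) 1 := fun h' => by linarith [hx.1, h'.1]
    have h2 : -x ∈ Ioo (-1 : ℝ) 0 := ⟨by linarith [hx.2], by linarith [hx.1]⟩
    simp [hh, indicator_of_mem h2, indicator_of_notMem h1]
  set E : ℝ → ℂ := fun x => Complex.exp (-(Complex.I * s * Real.pi * x)) with hE
  have hEn : ∀ x, ‖E x‖ = 1 := by
    intro x
    have : -(Complex.I * s * Real.pi * x) = ((-(s * Real.pi * x) : ℝ) : ℂ) * Complex.I := by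
      push_cast
      ring
    rw [hE]
    simp only [this]
    exact Complex.norm_exp_ofReal_mul_I _
  have hEc : Continuous E := by
    rw [hE]
    fun_prop
  have hEh : MemLp (fun x => E x * h x) 2 volume :=
    hmem.of_le (hEc.aestronglyMeasurable.mul hmem.aestronglyMeasurable)
      (Filter.Eventually.of_forall fun x => by rw [norm_mul, hEn, one_mul])
  have hlt : (-1 : ℝ) < 1 := by norm_num
  have hparseval := hasSum_sq_fourierCoeffOn hlt (hEh.restrict (Ioc (-1 : ℝ) 1))
  have hloc : ∀ g : ℝ → ℂ, Continuous g →
      IntervalIntegrable (fun x => g x * h x) volume (-1) 1 := by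
    intro g hg
    have : IntervalIntegrable h volume (-1) 1 := by
      rw [intervalIntegrable_iff_integrableOn_Ioc_of_le hlt.le]
      exact (hmem.restrict _).integrable one_le_two
    exact this.continuousOn_mul hg.continuousOn
  have hcoeff : ∀ n : ℤ, fourierCoeffOn hlt (fun x => E x * h x) n = 0 := by
    intro n
    rw [fourierCoeffOn_eq_integral]
    have e : ∀ x : ℝ, fourier (-n) (x : AddCircle ((1 : ℝ) - -1)) • (E x * h x) =
        Complex.exp (-(Complex.I * (n + s) * Real.pi * x)) * h x := by
      intro x
      rw [fourier_coe_apply, smul_eq_mul, ← mul_assoc, hE, ← Complex.exp_add]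
      congr 2
      push_cast
      ring
    simp only [e]
    rw [intervalIntegral_symm_eq (hloc _ (by fun_prop))]
    have e1 : ∫ x in Ioo (0 : ℝ) 1, Complex.exp (-(Complex.I * (n + s) * Real.pi * x)) * h x =
        ∫ x in Ioo (0 : ℝ) 1, Complex.exp (-(Complex.I * (n + s) * Real.pi * x)) * p x :=
      setIntegral_congr_fun measurableSet_Ioo fun x hx => by simp only [hpos x hx]
    have e2 : ∫ x in Ioo (0 : ℝ) 1,
          Complex.exp (-(Complex.I * (n + s) * Real.pi * (-x : ℝ))) * h (-x) =
        ∫ x in Ioo (0 : ℝ) 1, Complex.exp (Complex.I * (n + s) * Real.pi * x) * q x :=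
      setIntegral_congr_fun measurableSet_Ioo fun x hx => by
        simp only [hneg x hx, Complex.ofReal_neg, mul_neg, neg_neg]
    rw [e1, e2, H n, smul_zero]
  simp only [hcoeff, norm_zero, ne_eq, OfNat.ofNat_ne_zero, not_false_eq_true, zero_pow]
    at hparseval
  have h0 : ∫ x in (-1 : ℝ)..1, ‖E x * h x‖ ^ 2 = 0 := by
    have := hparseval.unique hasSum_zero
    rw [smul_eq_zero] at this
    exact this.resolve_left (by norm_num)
  have hsq : IntervalIntegrable (fun x => ‖E x * h x‖ ^ 2) volume (-1) 1 := by
    rw [intervalIntegrable_iff_integrableOn_Ioc_of_le hlt.le]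
    exact (hEh.restrict _).integrable_norm_pow two_ne_zero
  rw [intervalIntegral_symm_eq hsq] at h0
  have e1 : ∫ x in Ioo (0 : ℝ) 1, ‖E x * h x‖ ^ 2 = ∫ x in Ioo (0 : ℝ) 1, ‖p x‖ ^ 2 :=
    setIntegral_congr_fun measurableSet_Ioo fun x hx => by
      simp only [norm_mul, hEn, one_mul, hpos x hx]
  have e2 : ∫ x in Ioo (0 : ℝ) 1, ‖E (-x) * h (-x)‖ ^ 2 = ∫ x in Ioo (0 : ℝ) 1, ‖q x‖ ^ 2 :=
    setIntegral_congr_fun measurableSet_Ioo fun x hx => by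
      simp only [norm_mul, hEn, one_mul, hneg x hx]
  rw [e1, e2] at h0
  have n1 : 0 ≤ ∫ x in Ioo (0 : ℝ) 1, ‖p x‖ ^ 2 := integral_nonneg fun x => sq_nonneg _
  have n2 : 0 ≤ ∫ x in Ioo (0 : ℝ) 1, ‖q x‖ ^ 2 := integral_nonneg fun x => sq_nonneg _
  exact ⟨eq_zero_of_integral_norm_sq (by linarith), eq_zero_of_integral_norm_sq (by linarith)⟩

end Fourier

/-! ### An orthonormal basis of the state space built from exponentials. -/

section OrthonormalBasis

theorem shiftedIndex_eq (γ : ℝ) (n : ℤ) : shiftedIndex γ n = n + shiftedIndex γ 0 := by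
  simp only [shiftedIndex]
  split_ifs <;> simp

/-- The exponential `e^{i n_β π x}` on `[0,1]`. -/
noncomputable def expR (γ : ℝ) (n : ℤ) : C(unitInterval, ℂ) :=
  restr (fun x => Complex.exp (Complex.I * shiftedIndex γ n * Real.pi * x)) (by fun_prop)

/-- The exponential `e^{-i n_β π x}` on `[0,1]`. -/
noncomputable def expL (γ : ℝ) (n : ℤ) : C(unitInterval, ℂ) :=
  restr (fun x => Complex.exp (-(Complex.I * shiftedIndex γ n * Real.pi * x))) (by fun_prop)

theorem inner_contL_restr {F : ℝ → ℂ} (hF : Continuous F) (u : L2) :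
    inner ℂ (contL (restr F hF)) u = ∫ x in Ioo (0 : ℝ) 1, starRingEnd ℂ (F x) * u x := by
  rw [L2.inner_def]
  refine integral_congr_ae ?_
  filter_upwards [coeFn_contL (restr F hF), ae_restrict_mem measurableSet_Ioo] with x hx hx'
  rw [hx, ext_restr hF ⟨hx'.1.le, hx'.2.le⟩, RCLike.inner_apply, mul_comm]

theorem conj_exp_I_mul (r x : ℝ) :
    starRingEnd ℂ (Complex.exp (Complex.I * r * Real.pi * x)) =
      Complex.exp (-(Complex.I * r * Real.pi * x)) := by
  rw [← Complex.exp_conj]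
  simp

theorem conj_exp_neg_I_mul (r x : ℝ) :
    starRingEnd ℂ (Complex.exp (-(Complex.I * r * Real.pi * x))) =
      Complex.exp (Complex.I * r * Real.pi * x) := by
  rw [← Complex.exp_conj]
  simp

theorem inner_expR (γ : ℝ) (n : ℤ) (u : L2) : inner ℂ (contL (expR γ n)) u =
    ∫ x in Ioo (0 : ℝ) 1, Complex.exp (-(Complex.I * shiftedIndex γ n * Real.pi * x)) * u x := by
  simp only [expR, inner_contL_restr, conj_exp_I_mul]

theorem inner_expL (γ : ℝ) (n : ℤ) (u : L2) : inner ℂ (contL (expL γ n)) u =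
    ∫ x in Ioo (0 : ℝ) 1, Complex.exp (Complex.I * shiftedIndex γ n * Real.pi * x) * u x := by
  simp only [expL, inner_contL_restr, conj_exp_neg_I_mul]

theorem setIntegral_mul_contL_restr {F G : ℝ → ℂ} (hG : Continuous G) :
    ∫ x in Ioo (0 : ℝ) 1, F x * contL (restr G hG) x = ∫ x in (0 : ℝ)..1, F x * G x := by
  rw [intervalIntegral.integral_of_le zero_le_one, integral_Ioc_eq_integral_Ioo]
  refine integral_congr_ae ?_
  filter_upwards [coeFn_contL (restr G hG), ae_restrict_mem measurableSet_Ioo] with x hx hx'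
  rw [hx, ext_restr hG ⟨hx'.1.le, hx'.2.le⟩]

/-- The sum is the integral of `e^{idπx}` over `(-1,1)`. For odd `d` neither summand vanishes; they
cancel because `e^{idπ} = e^{-idπ}`. -/
theorem integral_exp_add_integral_exp_neg (d : ℤ) :
    (∫ x in (0 : ℝ)..1, Complex.exp (Complex.I * d * Real.pi * x)) +
      ∫ x in (0 : ℝ)..1, Complex.exp (-(Complex.I * d * Real.pi) * x) = if d = 0 then 2 else 0 := by
  split_ifs with h
  · subst h
    norm_num
  · have hc : Complex.I * d * Real.pi ≠ 0 :=
      mul_ne_zero (mul_ne_zero Complex.I_ne_zero (Int.cast_ne_zero.2 h))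
        (Complex.ofReal_ne_zero.2 Real.pi_ne_zero)
    rw [integral_exp_mul_complex hc, integral_exp_mul_complex (neg_ne_zero.2 hc)]
    have e : Complex.exp (Complex.I * d * Real.pi) = Complex.exp (-(Complex.I * d * Real.pi)) := by
      rw [Complex.exp_eq_exp_iff_exists_int]
      exact ⟨d, by ring⟩
    simp only [Complex.ofReal_one, mul_one, Complex.ofReal_zero, mul_zero]
    rw [e]
    field_simp
    ring

theorem inner_exp_add_inner_exp (γ : ℝ) (n k : ℤ) :
    inner ℂ (contL (expR γ n)) (contL (expR γ k)) +
      inner ℂ (contL (expL γ n)) (contL (expL γ k)) = if n = k then (2 : ℂ) else 0 := by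
  have h := integral_exp_add_integral_exp_neg (k - n)
  have hiff : (k - n = 0) ↔ n = k := by rw [sub_eq_zero, eq_comm]
  simp only [hiff] at h
  rw [inner_expR, inner_expL, expR, expL, setIntegral_mul_contL_restr,
    setIntegral_mul_contL_restr, ← h]
  simp only [← Complex.exp_add, shiftedIndex_eq γ n, shiftedIndex_eq γ k]
  congr 1 <;>
  · refine intervalIntegral.integral_congr fun x _ => ?_
    congr 1
    push_cast
    ring

/-- The orthonormal system of the state space that is modelled on the exponentials
`e^{i n_β π x}` on `(-1,1)`, together with two unit vectors for the scalar components. -/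
noncomputable def refVec (m β γ : ℝ) [Fact (0 < β)] [Fact (0 < m)] : ℤ ⊕ Bool → H2 β m :=
  Sum.elim
    (fun n => (H2.coord β m).symm (0, (1 / 2 : ℂ) • contL (expR γ n) - (1 / 2 : ℂ) • contL (expL γ n),
      (1 / 2 : ℂ) • contL (expR γ n) + (1 / 2 : ℂ) • contL (expL γ n), 0))
    fun i => (H2.coord β m).symm (if i then ((1 / √β : ℝ) : ℂ) else 0, 0, 0,
      if i then 0 else ((√m : ℝ) : ℂ))

variable {m β γ : ℝ} [hβ : Fact (0 < β)] [hm : Fact (0 < m)]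

theorem H2.inner_coord_symm (k : ℂ × L2 × L2 × ℂ) (z : H2 β m) :
    inner ℂ ((H2.coord β m).symm k) z = inner ℂ k.2.1 (H1.der (H2.pos z)) +
      inner ℂ k.2.2.1 (H2.vel z) + (β : ℂ) * inner ℂ k.1 (H1.fn (H2.pos z) 0) +
      inner ℂ k.2.2.2 (H2.tip z) / (m : ℂ) := by
  rw [H2.inner_eq, H2.pos_coord_symm, H1.fn_mk_zero, H1.der_mk, H2.vel_coord_symm,
    H2.tip_coord_symm]

theorem H2.inner_coord_symm_symm (k l : ℂ × L2 × L2 × ℂ) :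
    inner ℂ ((H2.coord β m).symm k) ((H2.coord β m).symm l) = inner ℂ k.2.1 l.2.1 +
      inner ℂ k.2.2.1 l.2.2.1 + (β : ℂ) * inner ℂ k.1 l.1 + inner ℂ k.2.2.2 l.2.2.2 / (m : ℂ) := by
  rw [H2.inner_coord_symm, H2.pos_coord_symm, H1.fn_mk_zero, H1.der_mk, H2.vel_coord_symm,
    H2.tip_coord_symm]

/-- With `f' = (R - L)/2` and `g = (R + L)/2` the mixed terms cancel and half of the sum in
`inner_exp_add_inner_exp` remains. The scalars `1/√β` and `√m` compensate the weights `β` and `1/m`.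
-/
theorem orthonormal_refVec : Orthonormal ℂ (refVec m β γ) := by
  have hβ' := hβ.out
  have hm' := hm.out
  rw [orthonormal_iff_ite]
  rintro (n | i) (k | j)
  · simp only [refVec, Sum.elim_inl, H2.inner_coord_symm_symm, Sum.inl.injEq]
    have h := inner_exp_add_inner_exp γ n k
    have e : (if n = k then (1 : ℂ) else 0) = 1 / 2 * if n = k then (2 : ℂ) else 0 := by
      split_ifs <;> norm_num
    rw [e, ← h]
    simp only [inner_sub_left, inner_sub_right, inner_add_left, inner_add_right, inner_smul_left,
      inner_smul_right, inner_zero_left, map_div₀, map_one, map_ofNat]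
    ring
  · simp [refVec, H2.inner_coord_symm_symm]
  · simp [refVec, H2.inner_coord_symm_symm]
  · have h1 : (β : ℂ) * ((√β : ℝ) : ℂ)⁻¹ * ((√β : ℝ) : ℂ)⁻¹ = 1 := by
      norm_cast
      rw [mul_assoc, ← mul_inv, Real.mul_self_sqrt hβ'.le, mul_inv_cancel₀ hβ'.ne']
    have h2 : ((√m : ℝ) : ℂ) * ((√m : ℝ) : ℂ) / m = 1 := by
      norm_cast
      rw [Real.mul_self_sqrt hm'.le, div_self hm'.ne']
    simp only [refVec, Sum.elim_inr, H2.inner_coord_symm_symm]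
    cases i <;> cases j <;>
      simp [-inner_self_eq_norm_sq_to_K, RCLike.inner_apply, ← mul_assoc, h1, h2]

theorem orthogonal_span_refVec (m β γ : ℝ) [hβ : Fact (0 < β)] [hm : Fact (0 < m)] :
    (Submodule.span ℂ (range (refVec m β γ)))ᗮ = ⊥ := by
  have hβ' := hβ.out
  have hm' := hm.out
  refine (Submodule.eq_bot_iff _).2 fun y hy => ?_
  have h : ∀ j, inner ℂ (refVec m β γ j) y = 0 := fun j =>
    hy _ (Submodule.subset_span ⟨j, rfl⟩)
  have hc : H1.fn (H2.pos y) 0 = 0 := by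
    have := h (Sum.inr true)
    simp only [refVec, Sum.elim_inr, H2.inner_coord_symm] at this
    simpa [hβ'.ne', (Real.sqrt_pos.2 hβ').ne'] using this
  have ht : H2.tip y = 0 := by
    have := h (Sum.inr false)
    simp only [refVec, Sum.elim_inr, H2.inner_coord_symm] at this
    simpa [hm'.ne', (Real.sqrt_pos.2 hm').ne'] using this
  -- Orthogonality to the `n`-th exponential vector pairs the right-going exponential with `g + f'`
  -- and the left-going one with `g - f'`.
  have hpq := eq_zero_of_forall_integral_exp (shiftedIndex γ 0)
    (p := H2.vel y + H1.der (H2.pos y)) (q := H2.vel y - H1.der (H2.pos y)) (fun n => by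
      have h1 := h (Sum.inl n)
      simp only [refVec, Sum.elim_inl, H2.inner_coord_symm, inner_zero_left, mul_zero, zero_div,
        add_zero, inner_sub_left, inner_add_left, inner_smul_left, map_div₀, map_one,
        map_ofNat] at h1
      have e1 := inner_expR γ n (H2.vel y + H1.der (H2.pos y))
      have e2 := inner_expL γ n (H2.vel y - H1.der (H2.pos y))
      rw [shiftedIndex_eq] at e1 e2
      simp only [Complex.ofReal_add, Complex.ofReal_intCast] at e1 e2
      rw [← e1, ← e2, inner_add_right, inner_sub_right]
      linear_combination 2 * h1)
  have hg : H2.vel y = 0 := by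
    have h1 : (2 : ℂ) • H2.vel y = 0 := by
      have := congrArg₂ (· + ·) hpq.1 hpq.2
      simp only [add_zero] at this
      rw [← this]
      module
    exact (smul_eq_zero.1 h1).resolve_left two_ne_zero
  have hu : H1.der (H2.pos y) = 0 := by
    have := hpq.1
    rwa [hg, zero_add] at this
  exact H2.ext_iff'.2 ⟨by rw [H1.eq_zero hu hc, map_zero], by rw [hg, map_zero],
    by rw [ht, map_zero]⟩

theorem exists_hilbertBasis_refVec (m β γ : ℝ) [Fact (0 < β)] [Fact (0 < m)] :
    ∃ b : HilbertBasis (ℤ ⊕ Bool) ℂ (H2 β m), ⇑b = refVec m β γ := by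
  have := H2.completeSpace (β := β) (m := m)
  exact ⟨HilbertBasis.mkOfOrthogonalEqBot orthonormal_refVec (orthogonal_span_refVec m β γ),
    HilbertBasis.coe_mkOfOrthogonalEqBot _ _⟩

end OrthonormalBasis

/-! ### Multiplication operators on the travelling components. -/

section Multiplication

theorem memLp_ext_mul (a : C(unitInterval, ℂ)) (u : L2) :
    MemLp (fun x => ext a x * u x) 2 (volume.restrict (Ioo (0 : ℝ) 1)) :=
  MemLp.of_le_mul (c := ‖a‖) (Lp.memLp u)
    ((continuous_ext a).aestronglyMeasurable.mul (Lp.aestronglyMeasurable u))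
    (Filter.Eventually.of_forall fun x => by
      rw [norm_mul]
      gcongr
      exact a.norm_coe_le_norm _)

/-- Multiplication by a continuous function on `L²(0,1)`. -/
noncomputable def mulL (a : C(unitInterval, ℂ)) : L2 →L[ℂ] L2 :=
  LinearMap.mkContinuous
    { toFun := fun u => (memLp_ext_mul a u).toLp _
      map_add' := fun u v => by
        refine Lp.ext ?_
        filter_upwards [(memLp_ext_mul a (u + v)).coeFn_toLp, (memLp_ext_mul a u).coeFn_toLp,
          (memLp_ext_mul a v).coeFn_toLp, Lp.coeFn_add u v,
          Lp.coeFn_add ((memLp_ext_mul a u).toLp _) ((memLp_ext_mul a v).toLp _)]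
          with x h1 h2 h3 h4 h5
        rw [h1, h5, Pi.add_apply, h2, h3, h4, Pi.add_apply, mul_add]
      map_smul' := fun c u => by
        refine Lp.ext ?_
        filter_upwards [(memLp_ext_mul a (c • u)).coeFn_toLp, (memLp_ext_mul a u).coeFn_toLp,
          Lp.coeFn_smul c u, Lp.coeFn_smul c ((memLp_ext_mul a u).toLp _)] with x h1 h2 h3 h4
        rw [h1, RingHom.id_apply, h4, Pi.smul_apply, h2, h3, Pi.smul_apply, mul_smul_comm] }
    ‖a‖ fun u => by
      refine Lp.norm_le_mul_norm_of_ae_le_mul ?_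
      filter_upwards [(memLp_ext_mul a u).coeFn_toLp] with x hx
      change ‖(memLp_ext_mul a u).toLp _ x‖ ≤ _
      rw [hx, norm_mul]
      gcongr
      exact a.norm_coe_le_norm _

theorem coeFn_mulL (a : C(unitInterval, ℂ)) (u : L2) :
    mulL a u =ᵐ[volume.restrict (Ioo (0 : ℝ) 1)] fun x => ext a x * u x :=
  (memLp_ext_mul a u).coeFn_toLp

theorem mulL_mulL_of_mul_eq_one {a b : C(unitInterval, ℂ)} (hab : a * b = 1) (u : L2) :
    mulL a (mulL b u) = u := by
  refine Lp.ext ?_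
  filter_upwards [coeFn_mulL a (mulL b u), coeFn_mulL b u] with x h1 h2
  have h3 : ext a x * ext b x = 1 := DFunLike.congr_fun hab (projIcc 0 1 zero_le_one x)
  rw [h1, h2, ← mul_assoc, h3, one_mul]

theorem mulL_contL (a f : C(unitInterval, ℂ)) : mulL a (contL f) = contL (a * f) := by
  refine Lp.ext ?_
  filter_upwards [coeFn_mulL a (contL f), coeFn_contL f, coeFn_contL (a * f)] with x h1 h2 h3
  rw [h1, h2, h3]
  rfl

/-- The operator acting as `A` on `g + f'` and as `B` on `g - f'`. -/
noncomputable def travel {E : Type*} [NormedAddCommGroup E] [NormedSpace ℂ E] (A B : E →L[ℂ] E) :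
    (ℂ × E × E × ℂ) →L[ℂ] (ℂ × E × E × ℂ) where
  toFun k := (k.1, (1 / 2 : ℂ) • (A (k.2.2.1 + k.2.1) - B (k.2.2.1 - k.2.1)),
    (1 / 2 : ℂ) • (A (k.2.2.1 + k.2.1) + B (k.2.2.1 - k.2.1)), k.2.2.2)
  map_add' k l := by
    refine Prod.ext rfl (Prod.ext ?_ (Prod.ext ?_ rfl)) <;>
    · simp only [Prod.fst_add, Prod.snd_add, map_add, map_sub]
      module
  map_smul' c k := by
    refine Prod.ext rfl (Prod.ext ?_ (Prod.ext ?_ rfl)) <;>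
    · simp only [Prod.smul_fst, Prod.smul_snd, map_add, map_sub, map_smul, RingHom.id_apply]
      module
  cont := by fun_prop

theorem travel_apply {E : Type*} [NormedAddCommGroup E] [NormedSpace ℂ E] (A B : E →L[ℂ] E)
    (k : ℂ × E × E × ℂ) : travel A B k =
    (k.1, (1 / 2 : ℂ) • (A (k.2.2.1 + k.2.1) - B (k.2.2.1 - k.2.1)),
      (1 / 2 : ℂ) • (A (k.2.2.1 + k.2.1) + B (k.2.2.1 - k.2.1)), k.2.2.2) := rfl

/-- In the variables `g + f'` and `g - f'` the operator is diagonal, so inverses are taken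
entrywise. -/
theorem travel_travel {E : Type*} [NormedAddCommGroup E] [NormedSpace ℂ E] {A B A' B' : E →L[ℂ] E}
    (hA : ∀ u, A (A' u) = u) (hB : ∀ u, B (B' u) = u)
    (k : ℂ × E × E × ℂ) : travel A B (travel A' B' k) = k := by
  obtain ⟨c, u, g, ξ⟩ := k
  simp only [travel_apply]
  have e1 : (1 / 2 : ℂ) • (A' (g + u) + B' (g - u)) +
      (1 / 2 : ℂ) • (A' (g + u) - B' (g - u)) = A' (g + u) := by module
  have e2 : (1 / 2 : ℂ) • (A' (g + u) + B' (g - u)) -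
      (1 / 2 : ℂ) • (A' (g + u) - B' (g - u)) = B' (g - u) := by module
  rw [e1, e2, hA, hB]
  refine Prod.ext rfl (Prod.ext ?_ (Prod.ext ?_ rfl)) <;>
  · simp only
    module

/-- The operator `travel` as a topological isomorphism. -/
noncomputable def travelEquiv {E : Type*} [NormedAddCommGroup E] [NormedSpace ℂ E]
    (A B A' B' : E →L[ℂ] E) (hA : ∀ u, A (A' u) = u) (hB : ∀ u, B (B' u) = u)
    (hA' : ∀ u, A' (A u) = u) (hB' : ∀ u, B' (B u) = u) :
    (ℂ × E × E × ℂ) ≃L[ℂ] (ℂ × E × E × ℂ) :=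
  ContinuousLinearEquiv.equivOfInverse (travel A B) (travel A' B')
    (travel_travel hA' hB') (travel_travel hA hB)

end Multiplication

/-! ### From exponentials to the leading terms of the eigenvectors. -/

section ReferenceBasis

theorem norm_contL_restr_le {F : ℝ → ℂ} (hF : Continuous F) {K : ℝ} (hK : 0 ≤ K)
    (h : ∀ x ∈ Icc (0 : ℝ) 1, ‖F x‖ ≤ K) : ‖contL (restr F hF)‖ ≤ K := by
  refine (norm_contToL2_le (restr F hF)).trans ?_
  rw [one_mul]
  exact (ContinuousMap.norm_le _ hK).2 fun x => h x x.2

/-- The function `c e^{ρx}` on `[0,1]`. -/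
noncomputable def scaledExp (c ρ : ℂ) : C(unitInterval, ℂ) :=
  restr (fun x => c * Complex.exp (ρ * x)) (by fun_prop)

theorem mulL_scaledExp {c : ℂ} (hc : c ≠ 0) (ρ : ℂ) (u : L2) :
    mulL (scaledExp c ρ) (mulL (scaledExp c⁻¹ (-ρ)) u) = u := by
  refine mulL_mulL_of_mul_eq_one (ContinuousMap.ext fun x => ?_) u
  change c * Complex.exp (ρ * (x : ℝ)) * (c⁻¹ * Complex.exp (-ρ * (x : ℝ))) = 1
  rw [mul_mul_mul_comm, mul_inv_cancel₀ hc, ← Complex.exp_add, neg_mul, add_neg_cancel,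
    Complex.exp_zero, one_mul]

theorem mulL_scaledExp' {c : ℂ} (hc : c ≠ 0) (ρ : ℂ) (u : L2) :
    mulL (scaledExp c⁻¹ (-ρ)) (mulL (scaledExp c ρ) u) = u := by
  have := mulL_scaledExp (inv_ne_zero hc) (-ρ) u
  rwa [inv_inv, neg_neg] at this

theorem continuous_waveR {γ : ℝ} (hγ : 0 < γ) (hγ1 : γ ≠ 1) (n : ℤ) : Continuous (waveR γ n) := by
  rw [funext (waveR_eq hγ hγ1 n)]
  fun_prop

theorem continuous_waveL {γ : ℝ} (hγ : 0 < γ) (hγ1 : γ ≠ 1) (n : ℤ) : Continuous (waveL γ n) := by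
  rw [funext (waveL_eq hγ hγ1 n)]
  fun_prop

variable {m β γ : ℝ} [hβ : Fact (0 < β)] [hm : Fact (0 < m)]

/-- A topological automorphism maps the exponential orthonormal basis to the leading terms of the
eigenfunctions. -/
theorem exists_equiv_refVec (m β : ℝ) [Fact (0 < β)] [Fact (0 < m)] (hγ : 0 < γ) (hγ1 : γ ≠ 1) :
    ∃ S : H2 β m ≃L[ℂ] H2 β m, ∀ n : ℤ, H2.coord β m (S (refVec m β γ (Sum.inl n))) =
      (0, contL (restr (fun x => (1 + γ) * waveR γ n x - (1 - γ) * waveL γ n x)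
          ((continuous_const.mul (continuous_waveR hγ hγ1 n)).sub
            (continuous_const.mul (continuous_waveL hγ hγ1 n)))),
        contL (restr (fun x => (1 + γ) * waveR γ n x + (1 - γ) * waveL γ n x)
          ((continuous_const.mul (continuous_waveR hγ hγ1 n)).add
            (continuous_const.mul (continuous_waveL hγ hγ1 n)))), 0) := by
  set ρ : ℂ := ((1 / 2 * Real.log (|γ - 1| / (γ + 1)) : ℝ) : ℂ) with hρ
  have hc : (2 * (1 + γ) : ℂ) ≠ 0 := by
    norm_cast
    positivity
  have hd : (2 * (1 - γ) : ℂ) ≠ 0 := by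
    norm_cast
    exact mul_ne_zero two_ne_zero (sub_ne_zero.2 hγ1.symm)
  -- The basis vector has travelling components `e^{±i n_β π x}`, the leading term `2(1+γ)pₙ` and
  -- `2(1-γ)qₙ`; these multipliers convert one into the other. The second is invertible because `γ ≠
  -- 1`.
  set A := mulL (scaledExp (2 * (1 + γ)) ρ) with hA
  set B := mulL (scaledExp (2 * (1 - γ)) (-ρ)) with hB
  set Φ := travelEquiv A B (mulL (scaledExp (2 * (1 + γ))⁻¹ (-ρ)))
    (mulL (scaledExp (2 * (1 - γ))⁻¹ (-(-ρ)))) (mulL_scaledExp hc ρ) (mulL_scaledExp hd (-ρ))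
    (mulL_scaledExp' hc ρ) (mulL_scaledExp' hd (-ρ)) with hΦ
  refine ⟨((H2.coord β m).trans Φ).trans (H2.coord β m).symm, fun n => ?_⟩
  have e : H2.coord β m ((((H2.coord β m).trans Φ).trans (H2.coord β m).symm)
      (refVec m β γ (Sum.inl n))) = travel A B (0,
        (1 / 2 : ℂ) • contL (expR γ n) - (1 / 2 : ℂ) • contL (expL γ n),
        (1 / 2 : ℂ) • contL (expR γ n) + (1 / 2 : ℂ) • contL (expL γ n), 0) := by
    simp only [refVec, Sum.elim_inl, ContinuousLinearEquiv.trans_apply,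
      ContinuousLinearEquiv.apply_symm_apply]
    rfl
  have e1 : (1 / 2 : ℂ) • contL (expR γ n) + (1 / 2 : ℂ) • contL (expL γ n) +
      ((1 / 2 : ℂ) • contL (expR γ n) - (1 / 2 : ℂ) • contL (expL γ n)) = contL (expR γ n) := by
    module
  have e2 : (1 / 2 : ℂ) • contL (expR γ n) + (1 / 2 : ℂ) • contL (expL γ n) -
      ((1 / 2 : ℂ) • contL (expR γ n) - (1 / 2 : ℂ) • contL (expL γ n)) = contL (expL γ n) := by
    module
  have hAR : ∀ x : unitInterval, (scaledExp (2 * (1 + γ)) ρ * expR γ n) x =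
      2 * ((1 + γ) * waveR γ n x) := by
    intro x
    change 2 * (1 + γ) * Complex.exp (ρ * (x : ℝ)) *
      Complex.exp (Complex.I * shiftedIndex γ n * Real.pi * (x : ℝ)) = _
    rw [waveR_eq hγ hγ1, leadEv, mul_assoc, ← Complex.exp_add, ← hρ]
    ring_nf
  have hBL : ∀ x : unitInterval, (scaledExp (2 * (1 - γ)) (-ρ) * expL γ n) x =
      2 * ((1 - γ) * waveL γ n x) := by
    intro x
    change 2 * (1 - γ) * Complex.exp (-ρ * (x : ℝ)) *
      Complex.exp (-(Complex.I * shiftedIndex γ n * Real.pi * (x : ℝ))) = _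
    rw [waveL_eq hγ hγ1, leadEv, mul_assoc, ← Complex.exp_add, ← hρ]
    ring_nf
  rw [e, travel_apply]
  simp only [e1, e2, hA, hB, mulL_contL]
  rw [← map_sub, ← map_add, ← map_smul, ← map_smul]
  congr 3 <;> congr 1 <;> ext x
  · rw [ContinuousMap.smul_apply, ContinuousMap.sub_apply, hAR, hBL, restr_apply, smul_eq_mul]
    ring
  · rw [ContinuousMap.smul_apply, ContinuousMap.add_apply, hAR, hBL, restr_apply, smul_eq_mul]
    ring

end ReferenceBasis

/-! ### Assembly of the Riesz basis and of the asymptotics. -/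

section RieszBasis

variable {m β γ : ℝ} [hβ : Fact (0 < β)] [hm : Fact (0 < m)]

/-- The form of the last coordinate matters: `m μ f(1)/μ²` looks merely bounded, but the
characteristic equation replaces `m μ f(1)` by `-eigFunD(1)`, which makes it `O(1/μ)`. -/
theorem coord_smul_eigVec {μ : ℂ} (hμ : μ ≠ 0) (h : charFun m β γ μ = 0) :
    H2.coord β m ((μ ^ 2)⁻¹ • eigVec m β γ μ) =
      (2 / μ, contL (restr (fun x => eigFunD β γ μ x / μ)
          ((continuous_eigFunD β γ μ).div_const μ)),
        contL (restr (fun x => eigFun β γ μ x / μ) ((continuous_eigFun β γ μ).div_const μ)),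
        -(eigFunD β γ μ 1 / μ / μ)) := by
  have e1 : restr (fun x => eigFunD β γ μ x / μ) ((continuous_eigFunD β γ μ).div_const μ) =
      (μ ^ 2)⁻¹ • μ • restr (eigFunD β γ μ) (continuous_eigFunD β γ μ) := by
    ext x
    simp only [ContinuousMap.smul_apply, restr_apply, smul_eq_mul]
    field_simp
  have e2 : restr (fun x => eigFun β γ μ x / μ) ((continuous_eigFun β γ μ).div_const μ) =
      (μ ^ 2)⁻¹ • μ • restr (eigFun β γ μ) (continuous_eigFun β γ μ) := by
    ext x
    simp only [ContinuousMap.smul_apply, restr_apply, smul_eq_mul]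
    field_simp
  have e3 : 2 / μ = (μ ^ 2)⁻¹ * (2 * μ) := by field_simp
  have e4 : -(eigFunD β γ μ 1 / μ / μ) = (μ ^ 2)⁻¹ * (m * μ * eigFun β γ μ 1) := by
    rw [charFun_eq] at h
    field_simp
    linear_combination -h
  rw [e1, e2, e3, e4]
  simp only [H2.coord_apply, map_smul, pos_eigVec, der_eigPos, vel_eigVec, toL2_eigPos,
    tip_eigVec, fn_eigPos, Icc.coe_zero, eigFun_zero, Prod.smul_mk, smul_eq_mul]

/-- The normalized eigenvectors are quadratically close to the leading terms. -/
theorem exists_norm_eigVec_sub_le {S : H2 β m ≃L[ℂ] H2 β m} {b : ℤ → H2 β m}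
    (hγ : 0 < γ) (hγ1 : γ ≠ 1)
    (hS : ∀ n : ℤ, H2.coord β m (S (b n)) =
      (0, contL (restr (fun x => (1 + γ) * waveR γ n x - (1 - γ) * waveL γ n x)
          ((continuous_const.mul (continuous_waveR hγ hγ1 n)).sub
            (continuous_const.mul (continuous_waveL hγ hγ1 n)))),
        contL (restr (fun x => (1 + γ) * waveR γ n x + (1 - γ) * waveL γ n x)
          ((continuous_const.mul (continuous_waveR hγ hγ1 n)).add
            (continuous_const.mul (continuous_waveL hγ hγ1 n)))), 0))
    {ev : ℤ → ℂ} {C : ℝ} (hC : 0 ≤ C) (hchar : ∀ n, charFun m β γ (ev n) = 0)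
    (hlow : ∀ n : ℤ, |(n : ℝ)| / 2 ≤ ‖ev n‖)
    (hev : ∀ n : ℤ, n ≠ 0 → ‖ev n - leadEv γ n‖ ≤ C / |(n : ℝ)|) :
    ∃ B : ℝ, ∀ n : ℤ, n ≠ 0 →
      ‖(ev n ^ 2)⁻¹ • eigVec m β γ (ev n) - S (b n)‖ ≤ B / |(n : ℝ)| := by
  obtain ⟨K, hK, hasym⟩ := exists_eigFun_asymptotics β hγ hγ1 hC hlow hev
  set D : ℝ := ‖((H2.coord β m).symm : (ℂ × L2 × L2 × ℂ) →L[ℂ] H2 β m)‖ with hD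
  refine ⟨D * (4 + 2 * K), fun n hn => ?_⟩
  have hn' : 0 < |(n : ℝ)| := abs_pos.2 (Int.cast_ne_zero.2 hn)
  have hμ : ev n ≠ 0 := ne_zero_of_charFun_eq_zero (hchar n)
  have hinv : ‖ev n‖⁻¹ ≤ 2 / |(n : ℝ)| := by
    rw [← inv_div]
    exact inv_anti₀ (by positivity) (hlow n)
  set y := (ev n ^ 2)⁻¹ • eigVec m β γ (ev n) - S (b n) with hy
  have hy' : y = ((H2.coord β m).symm : (ℂ × L2 × L2 × ℂ) →L[ℂ] H2 β m) (H2.coord β m y) :=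
    ((H2.coord β m).symm_apply_apply y).symm
  have hcoord : ‖H2.coord β m y‖ ≤ (4 + 2 * K) / |(n : ℝ)| := by
    have hKn : K / |(n : ℝ)| ≤ (4 + 2 * K) / |(n : ℝ)| := by
      gcongr
      linarith
    have e := hS n
    rw [hy, map_sub, coord_smul_eigVec hμ (hchar n), e]
    simp only [Prod.mk_sub_mk, norm_prod_le_iff, sub_zero, ← map_sub]
    refine ⟨?_, ?_, ?_, ?_⟩
    · rw [norm_div, RCLike.norm_ofNat, div_eq_mul_inv]
      calc 2 * ‖ev n‖⁻¹ ≤ 2 * (2 / |(n : ℝ)|) := by gcongr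
        _ = 4 / |(n : ℝ)| := by ring
        _ ≤ _ := by
          gcongr
          linarith
    · refine norm_contL_restr_le (F := fun x => eigFunD β γ (ev n) x / ev n -
        ((1 + γ) * waveR γ n x - (1 - γ) * waveL γ n x)) (((continuous_eigFunD β γ _).div_const _).sub
          ((continuous_const.mul (continuous_waveR hγ hγ1 n)).sub
            (continuous_const.mul (continuous_waveL hγ hγ1 n)))) (by positivity) fun x hx => ?_
      exact ((hasym n hn x hx).1).trans hKn
    · refine norm_contL_restr_le (F := fun x => eigFun β γ (ev n) x / ev n -
        ((1 + γ) * waveR γ n x + (1 - γ) * waveL γ n x)) (((continuous_eigFun β γ _).div_const _).sub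
          ((continuous_const.mul (continuous_waveR hγ hγ1 n)).add
            (continuous_const.mul (continuous_waveL hγ hγ1 n)))) (by positivity) fun x hx => ?_
      exact ((hasym n hn x hx).2.1).trans hKn
    · rw [norm_neg, norm_div, div_eq_mul_inv]
      calc ‖eigFunD β γ (ev n) 1 / ev n‖ * ‖ev n‖⁻¹ ≤ K * (2 / |(n : ℝ)|) := by
            gcongr
            exact (hasym n hn 1 (by simp)).2.2
        _ = 2 * K / |(n : ℝ)| := by ring
        _ ≤ _ := by
          gcongr
          linarith
  rw [hy', mul_div_assoc]
  refine (ContinuousLinearMap.le_opNorm _ _).trans ?_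
  gcongr

theorem finite_abs_lt (N : ℕ) : {n : ℤ | |n| < N}.Finite :=
  (finite_Ioo (-(N : ℤ)) N).subset fun _ hn => abs_lt.1 hn

theorem exists_hilbertBasis_root_vectors (m β : ℝ) {γ : ℝ} [hβ : Fact (0 < β)] [hm : Fact (0 < m)]
    (hγ : 0 < γ) (hγ1 : γ ≠ 1) :
    ∃ (b : HilbertBasis (ℤ ⊕ Bool) ℂ (H2 β m)) (T : H2 β m ≃L[ℂ] H2 β m),
      ∀ j, IsGeneralizedEigenvector (A2 m β γ) (T (b j)) := by
  classical
  have := H2.completeSpace (β := β) (m := m)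
  obtain ⟨ev, N, C, hC, hchar, -, -, hlow, hev⟩ := exists_charFun_zeros hm.out hβ.out hγ hγ1
  obtain ⟨b, hb⟩ := exists_hilbertBasis_refVec m β γ
  obtain ⟨S, hS⟩ := exists_equiv_refVec m β hγ hγ1
  obtain ⟨B, hB⟩ := exists_norm_eigVec_sub_le hγ hγ1 hS hC hchar hlow hev
  set x : ℤ ⊕ Bool → H2 β m :=
    Sum.elim (fun n => (ev n ^ 2)⁻¹ • eigVec m β γ (ev n)) 0 with hx
  -- Excluded from the start are the two scalar directions, which carry no eigenvector, and `n = 0`,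
  -- where the bound `B/|n|` says nothing.
  set F₀ : Finset (ℤ ⊕ Bool) := insert (Sum.inl 0) (Finset.univ.image Sum.inr) with hF₀
  have hsum : Summable ((F₀ : Set (ℤ ⊕ Bool))ᶜ.indicator fun j => ‖x j - S (b j)‖ ^ 2) := by
    rw [← (Sum.inl_injective (α := ℤ) (β := Bool)).summable_iff]
    · refine Summable.of_nonneg_of_le (fun _ => indicator_nonneg (fun _ _ => by positivity) _)
        (fun n => ?_) ((Real.summable_one_div_int_pow (p := 2)).2 one_lt_two |>.mul_left (B ^ 2))
      rw [Function.comp_apply]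
      by_cases hn : n = 0
      · rw [indicator_of_notMem (by simp [hF₀, hn])]
        positivity
      · rw [indicator_of_mem (by simp [hF₀, hn])]
        have h1 := hB n hn
        rw [hb, hx, Sum.elim_inl]
        calc _ ≤ (B / |(n : ℝ)|) ^ 2 := by gcongr
          _ = _ := by rw [div_pow, sq_abs]; ring
    · rintro (n | i) hj
      · exact absurd ⟨n, rfl⟩ hj
      · exact indicator_of_notMem (by simp [hF₀]) _
  -- Repetitions among the `ev n` do no harm: as `P` is injective, `F` must contain all but one
  -- index of each repeated vector.
  obtain ⟨F, P, hF, hP⟩ := exists_equiv_eq_off_finset b S x F₀ hsum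
  set κ : ℤ ⊕ Bool → ℂ := Sum.elim (fun n => (ev n)⁻¹) 0 with hκ
  have hmem : ∀ j ∉ F, ∃ n : ℤ, j = Sum.inl n := by
    rintro (n | i) hj
    · exact ⟨n, rfl⟩
    · exact absurd (hF (by simp [hF₀])) hj
  obtain ⟨T, hT⟩ := exists_riesz_basis_root_vectors (b := b) (P := P) (F := F)
    (R := A2inv m β γ) (κ := κ) (denseRange_A2inv hγ.ne')
    (fun j hj => by
      obtain ⟨n, rfl⟩ := hmem j hj
      rw [hP _ hj, hx, Sum.elim_inl, hκ, Sum.elim_inl, map_smul, A2inv_eigVec (hchar n),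
        smul_comm])
    (fun j hj => by
      obtain ⟨n, rfl⟩ := hmem j hj
      rw [hκ, Sum.elim_inl]
      exact inv_ne_zero (ne_zero_of_charFun_eq_zero (hchar n)))
    -- The numbers `κ j` tend to zero because `‖ev n‖ ≥ |n|/2`.
    (fun ε hε => by
      obtain ⟨M, hM⟩ := exists_nat_gt (2 / ε)
      refine ((finite_abs_lt M).image Sum.inl).subset ?_
      rintro (n | i) hj
      · refine ⟨n, ?_, rfl⟩
        simp only [hκ, mem_ofPred_eq, Sum.elim_inl, norm_inv] at hj
        have h1 : ‖ev n‖ ≤ ε⁻¹ := (le_inv_comm₀ hε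
          (norm_pos_iff.2 (ne_zero_of_charFun_eq_zero (hchar n)))).1 hj
        have h2 := hlow n
        have h3 : |(n : ℝ)| < M := by
          have : 2 / ε = 2 * ε⁻¹ := by ring
          linarith
        exact_mod_cast h3
      · simp only [hκ, mem_ofPred_eq, Sum.elim_inr, Pi.zero_apply, norm_zero] at hj
        exact absurd hj (not_le.2 hε))
  refine ⟨b, T, fun j => ⟨?_, ?_⟩⟩
  · rw [Ne, map_eq_zero_iff _ T.injective]
    exact b.orthonormal.ne_zero j
  · obtain ⟨z, hz, k, hk⟩ := hT j
    exact ⟨z⁻¹, k, inKerPow_of_A2inv hz k _ hk⟩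

theorem exists_hilbertBasis_reindex {ι κ E : Type*} [NormedAddCommGroup E]
    [InnerProductSpace ℂ E] [CompleteSpace E] (b : HilbertBasis ι ℂ E) (e : κ ≃ ι) :
    ∃ c : HilbertBasis κ ℂ E, ∀ k, c k = b (e k) := by
  have h1 : Orthonormal ℂ (b ∘ e) := b.orthonormal.comp e e.injective
  have h2 : (⊤ : Submodule ℂ E) ≤ (Submodule.span ℂ (range (b ∘ e))).topologicalClosure := by
    rw [e.surjective.range_comp]
    exact b.dense_span.ge
  exact ⟨HilbertBasis.mk h1 h2, fun k => by rw [HilbertBasis.coe_mk]; rfl⟩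

theorem exists_isRieszBasis_root_vectors (m β : ℝ) {γ : ℝ} [hβ : Fact (0 < β)]
    [hm : Fact (0 < m)] (hγ : 0 < γ) (hγ1 : γ ≠ 1) :
    ∃ φ : ℕ → H2 β m, (∀ k, IsGeneralizedEigenvector (A2 m β γ) (φ k)) ∧ IsRieszBasis φ := by
  have := H2.completeSpace (β := β) (m := m)
  obtain ⟨b, T, h⟩ := exists_hilbertBasis_root_vectors m β hγ hγ1
  obtain ⟨e⟩ := nonempty_equiv_of_countable (α := ℕ) (β := ℤ ⊕ Bool)
  obtain ⟨c, hc⟩ := exists_hilbertBasis_reindex b e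
  exact ⟨fun k => T (c k), fun k => by simpa only [hc] using h (e k), c, T, fun k => rfl⟩

/-- The two components of the eigenfunction asymptotics, and the smallness of the boundary
terms. -/
theorem exists_eigenvalue_asymptotics (m β : ℝ) {γ : ℝ} [hβ : Fact (0 < β)] [hm : Fact (0 < m)]
    (hγ : 0 < γ) (hγ1 : γ ≠ 1) :
    ∃ (ev : ℤ → ℂ) (N : ℕ) (C : ℝ),
      (∀ n, IsEigenvalue (A2 m β γ) (ev n)) ∧
      InjOn ev {n : ℤ | (N : ℤ) ≤ |n|} ∧
      ({μ : ℂ | IsEigenvalue (A2 m β γ) μ} \ ev '' {n : ℤ | (N : ℤ) ≤ |n|}).Finite ∧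
      ∀ n : ℤ, n ≠ 0 →
        ‖ev n - ((1 / 2 * Real.log (|γ - 1| / (γ + 1)) : ℝ)
            + shiftedIndex γ n * Real.pi * Complex.I)‖ ≤ C / |(n : ℝ)| ∧
        (∀ x ∈ Icc (0 : ℝ) 1,
          ‖deriv (eigFun β γ (ev n)) x / ev n ^ 2
            - ((1 + γ) * waveR γ n x - (1 - γ) * waveL γ n x)‖ ≤ C / |(n : ℝ)| ∧
          ‖ev n * eigFun β γ (ev n) x / ev n ^ 2
            - ((1 + γ) * waveR γ n x + (1 - γ) * waveL γ n x)‖ ≤ C / |(n : ℝ)|) ∧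
        ‖β * eigFun β γ (ev n) 0 / ev n ^ 2‖ ≤ C / |(n : ℝ)| ∧
        ‖-(ev n)⁻¹ * deriv (eigFun β γ (ev n)) 1 / ev n ^ 2‖ ≤ C / |(n : ℝ)| := by
  obtain ⟨ev, N, C, hC, hchar, hinj, hfin, hlow, hev⟩ :=
    exists_charFun_zeros hm.out hβ.out hγ hγ1
  obtain ⟨K, hK, hasym⟩ := exists_eigFun_asymptotics β hγ hγ1 hC hlow hev
  have hβ0 := hβ.out
  -- One constant for all estimates: `C` for the eigenvalues, `K` for the two profiles, `4β` and
  -- `2K` for the two scalar terms.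
  refine ⟨ev, N, C + 2 * K + 4 * β, fun n => isEigenvalue_iff.2 (hchar n), hinj, ?_,
    fun n hn => ?_⟩
  · simpa only [isEigenvalue_iff] using hfin
  have hn' : 0 < |(n : ℝ)| := abs_pos.2 (Int.cast_ne_zero.2 hn)
  have hμ : ev n ≠ 0 := ne_zero_of_charFun_eq_zero (hchar n)
  have hinv : ‖ev n‖⁻¹ ≤ 2 / |(n : ℝ)| := by
    rw [← inv_div]
    exact inv_anti₀ (by positivity) (hlow n)
  have hd : ∀ x, deriv (eigFun β γ (ev n)) x / ev n ^ 2 = eigFunD β γ (ev n) x / ev n := by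
    intro x
    rw [(hasDerivAt_eigFun β γ (ev n) x).deriv]
    field_simp
  have hmono : ∀ {t a : ℝ}, t ≤ a / |(n : ℝ)| → a ≤ C + 2 * K + 4 * β →
      t ≤ (C + 2 * K + 4 * β) / |(n : ℝ)| := fun h1 h2 =>
    h1.trans (div_le_div_of_nonneg_right h2 hn'.le)
  refine ⟨hmono (hev n hn) (by linarith), fun x hx => ⟨?_, ?_⟩, ?_, ?_⟩
  · rw [hd]
    exact hmono (hasym n hn x hx).1 (by linarith)
  · have e : ev n * eigFun β γ (ev n) x / ev n ^ 2 = eigFun β γ (ev n) x / ev n := by field_simp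
    rw [e]
    exact hmono (hasym n hn x hx).2.1 (by linarith)
  · have e : β * eigFun β γ (ev n) 0 / ev n ^ 2 = 2 * β * (ev n)⁻¹ := by
      rw [eigFun_zero]
      field_simp
    rw [e, norm_mul, norm_mul, RCLike.norm_ofNat, norm_inv, Complex.norm_real,
      Real.norm_of_nonneg hβ0.le]
    refine hmono (a := 4 * β) ?_ (by linarith)
    calc 2 * β * ‖ev n‖⁻¹ ≤ 2 * β * (2 / |(n : ℝ)|) := by gcongr
      _ = _ := by ring
  · rw [mul_div_assoc, hd, norm_mul, norm_neg, norm_inv]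
    refine hmono (a := 2 * K) ?_ (by linarith)
    calc ‖ev n‖⁻¹ * ‖eigFunD β γ (ev n) 1 / ev n‖ ≤ 2 / |(n : ℝ)| * K := by
          gcongr
          exact (hasym n hn 1 (by simp)).2.2
      _ = _ := by ring

end RieszBasis

end TipMassWave

theorem lemma1 (m β γ : ℝ) [Fact (0 < m)] [Fact (0 < β)] (hγ : 0 < γ) (hγ1 : γ ≠ 1) :
    -- some sequence of generalized eigenfunctions is a Riesz basis of the state space
    (∃ φ : ℕ → H2 β m,
      (∀ k, IsGeneralizedEigenvector (A2 m β γ) (φ k)) ∧ IsRieszBasis φ) ∧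
    -- for every eigenvalue `μ` the eigenspace is spanned by `(f, μ f, m μ f(1))`
    (∀ μ : ℂ, IsEigenvalue (A2 m β γ) μ →
      ∃ y : H2 β m,
        (∀ x : unitInterval, H1.fn (H2.pos y) x = eigFun β γ μ x) ∧
        H2.vel y = μ • H1.toL2 (H2.pos y) ∧
        H2.tip y = m * μ * eigFun β γ μ 1 ∧
        y ≠ 0 ∧
        ∀ z : H2 β m, InEigenspace (A2 m β γ) μ z ↔ ∃ c : ℂ, z = c • y) ∧
    -- asymptotics of the eigenvalues and of the eigenfunctions
    ∃ (ev : ℤ → ℂ) (N : ℕ) (C : ℝ),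
      (∀ n, IsEigenvalue (A2 m β γ) (ev n)) ∧
      InjOn ev {n : ℤ | (N : ℤ) ≤ |n|} ∧
      ({μ : ℂ | IsEigenvalue (A2 m β γ) μ} \ ev '' {n : ℤ | (N : ℤ) ≤ |n|}).Finite ∧
      ∀ n : ℤ, n ≠ 0 →
        ‖ev n - ((1 / 2 * Real.log (|γ - 1| / (γ + 1)) : ℝ)
            + shiftedIndex γ n * Real.pi * Complex.I)‖ ≤ C / |(n : ℝ)| ∧
        (∀ x ∈ Icc (0 : ℝ) 1,
          ‖deriv (eigFun β γ (ev n)) x / ev n ^ 2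
            - ((1 + γ) * waveR γ n x - (1 - γ) * waveL γ n x)‖ ≤ C / |(n : ℝ)| ∧
          ‖ev n * eigFun β γ (ev n) x / ev n ^ 2
            - ((1 + γ) * waveR γ n x + (1 - γ) * waveL γ n x)‖ ≤ C / |(n : ℝ)|) ∧
        ‖β * eigFun β γ (ev n) 0 / ev n ^ 2‖ ≤ C / |(n : ℝ)| ∧
        ‖-(ev n)⁻¹ * deriv (eigFun β γ (ev n)) 1 / ev n ^ 2‖ ≤ C / |(n : ℝ)| := by
  refine ⟨exists_isRieszBasis_root_vectors m β hγ hγ1, fun μ hμ => ?_,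
    exists_eigenvalue_asymptotics m β hγ hγ1⟩
  exact ⟨eigVec m β γ μ, fn_eigPos β γ μ, vel_eigVec, tip_eigVec,
    eigVec_ne_zero (ne_zero_of_charFun_eq_zero (isEigenvalue_iff.1 hμ)), eigenspace_spanned hμ⟩
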